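/- \textbf{Theorem.} There is an algorithm which, given a set $P$ of $n$ points in the plane, each with a real weight, and an integer $k \ge 0$, computes in $O(n^2 \log n)$ time an axis-aligned (closed, possibly degenerate) rectangle that encloses exactly $k$ points of $P$ and minimizes, among all such rectangles, the total weight of the points of $P$ inside; if no axis-aligned rectangle encloses exactly $k$ points of $P$, the algorithm reports this. The constant in the $O$-bound depends neither on $k$ nor on the points and their weights. The model of computation is the real RAM: a single program for all inputs, whose memory cells hold real numbers or machine words (natural numbers bounded by a fixed power of $n+k+2$), with unit-cost memory access, the operations $+,-,\times,/$ on reals and on words (with truncated subtraction and rounded-down division on words), and comparisons; there is no conversion between reals and words and no rounding of reals. The $O$-bound is understood as: at most $C n^2\log n$ elementary operations for all $n\ge 2$ and some constant $C$ (the algorithm is correct for all $n \ge 0$). -/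

import Mathlib

/-!
## A real RAM

The machine has two kinds of memory cells: cells holding a natural number (a machine word) and
cells holding a real number.  Each kind of memory is organised in arrays; the name of an array is a
constant of the program (so that a program uses finitely many arrays), and an index into an array
is a computed machine word.  Programs are built from assignments by sequencing, branching and
`while` loops.  Every elementary operation (memory access, arithmetic operation, comparison, branch)
costs one unit of time.  Machine words are bounded: a computation in which some word exceeds
the bound `B` is undefined.  There is no conversion between words and reals, and no rounding.
-/

namespace RealRAM

/-- A memory state: `word a i` is the `i`-th cell of the word array `a`, and `real a i` is the `i`-th
cell of the real array `a`. -/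
structure State where
  word : ℕ → ℕ → ℕ
  real : ℕ → ℕ → ℝ

/-- Overwrite the cell `i` of the word array `a` by `v`. -/
def State.setWord (s : State) (a i v : ℕ) : State where
  word := fun b j => if b = a ∧ j = i then v else s.word b j
  real := s.real

/-- Overwrite the cell `i` of the real array `a` by `v`. -/
noncomputable def State.setReal (s : State) (a i : ℕ) (v : ℝ) : State where
  word := s.word
  real := fun b j => if b = a ∧ j = i then v else s.real b j

/-- Word expressions. Subtraction is truncated and division rounds down. -/
inductive WExpr : Type
  | const (c : ℕ)
  | get (a : ℕ) (i : WExpr)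
  | add (e f : WExpr)
  | sub (e f : WExpr)
  | mul (e f : WExpr)
  | div (e f : WExpr)

/-- The value of a word expression. -/
def WExpr.eval (s : State) : WExpr → ℕ
  | const c => c
  | get a i => s.word a (i.eval s)
  | add e f => e.eval s + f.eval s
  | sub e f => e.eval s - f.eval s
  | mul e f => e.eval s * f.eval s
  | div e f => e.eval s / f.eval s

/-- The evaluation of a word expression is defined: every intermediate value is at most the
word bound `B`, and there is no division by zero. -/
def WExpr.Ok (B : ℕ) (s : State) : WExpr → Prop
  | const c => c ≤ B
  | get a i => i.Ok B s ∧ s.word a (i.eval s) ≤ B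
  | add e f => e.Ok B s ∧ f.Ok B s ∧ e.eval s + f.eval s ≤ B
  | sub e f => e.Ok B s ∧ f.Ok B s
  | mul e f => e.Ok B s ∧ f.Ok B s ∧ e.eval s * f.eval s ≤ B
  | div e f => e.Ok B s ∧ f.Ok B s ∧ f.eval s ≠ 0

/-- The number of elementary operations in a word expression. -/
def WExpr.cost : WExpr → ℕ
  | const _ => 1
  | get _ i => i.cost + 1
  | add e f => e.cost + f.cost + 1
  | sub e f => e.cost + f.cost + 1
  | mul e f => e.cost + f.cost + 1
  | div e f => e.cost + f.cost + 1

/-- Real expressions. Only rational constants may occur in a program. -/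
inductive RExpr : Type
  | const (c : ℚ)
  | get (a : ℕ) (i : WExpr)
  | add (e f : RExpr)
  | sub (e f : RExpr)
  | mul (e f : RExpr)
  | div (e f : RExpr)

/-- The value of a real expression. -/
noncomputable def RExpr.eval (s : State) : RExpr → ℝ
  | const c => (c : ℝ)
  | get a i => s.real a (i.eval s)
  | add e f => e.eval s + f.eval s
  | sub e f => e.eval s - f.eval s
  | mul e f => e.eval s * f.eval s
  | div e f => e.eval s / f.eval s

/-- The evaluation of a real expression is defined. -/
def RExpr.Ok (B : ℕ) (s : State) : RExpr → Prop
  | const _ => True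
  | get _ i => i.Ok B s
  | add e f => e.Ok B s ∧ f.Ok B s
  | sub e f => e.Ok B s ∧ f.Ok B s
  | mul e f => e.Ok B s ∧ f.Ok B s
  | div e f => e.Ok B s ∧ f.Ok B s ∧ f.eval s ≠ 0

/-- The number of elementary operations in a real expression. -/
def RExpr.cost : RExpr → ℕ
  | const _ => 1
  | get _ i => i.cost + 1
  | add e f => e.cost + f.cost + 1
  | sub e f => e.cost + f.cost + 1
  | mul e f => e.cost + f.cost + 1
  | div e f => e.cost + f.cost + 1

/-- Tests: comparisons of words and of reals, and Boolean combinations (both sides of which are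
always evaluated). -/
inductive Test : Type
  | wordLt (e f : WExpr)
  | wordEq (e f : WExpr)
  | realLt (e f : RExpr)
  | realEq (e f : RExpr)
  | not (b : Test)
  | and (b c : Test)
  | or (b c : Test)

/-- The test succeeds. -/
def Test.Holds (s : State) : Test → Prop
  | wordLt e f => e.eval s < f.eval s
  | wordEq e f => e.eval s = f.eval s
  | realLt e f => e.eval s < f.eval s
  | realEq e f => e.eval s = f.eval s
  | not b => ¬ b.Holds s
  | and b c => b.Holds s ∧ c.Holds s
  | or b c => b.Holds s ∨ c.Holds s

/-- The evaluation of a test is defined. -/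
def Test.Ok (B : ℕ) (s : State) : Test → Prop
  | wordLt e f => e.Ok B s ∧ f.Ok B s
  | wordEq e f => e.Ok B s ∧ f.Ok B s
  | realLt e f => e.Ok B s ∧ f.Ok B s
  | realEq e f => e.Ok B s ∧ f.Ok B s
  | not b => b.Ok B s
  | and b c => b.Ok B s ∧ c.Ok B s
  | or b c => b.Ok B s ∧ c.Ok B s

/-- The number of elementary operations in a test. -/
def Test.cost : Test → ℕ
  | wordLt e f => e.cost + f.cost + 1
  | wordEq e f => e.cost + f.cost + 1
  | realLt e f => e.cost + f.cost + 1
  | realEq e f => e.cost + f.cost + 1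
  | not b => b.cost + 1
  | and b c => b.cost + c.cost + 1
  | or b c => b.cost + c.cost + 1

/-- Programs. `setWord a i e` stores the value of `e` in the cell `i` of the word array `a`, and
`setReal a i e` stores the value of `e` in the cell `i` of the real array `a`. -/
inductive Program : Type
  | skip
  | setWord (a : ℕ) (i : WExpr) (e : WExpr)
  | setReal (a : ℕ) (i : WExpr) (e : RExpr)
  | seq (P Q : Program)
  | ite (b : Test) (P Q : Program)
  | while (b : Test) (P : Program)

/-- `Exec B P s t s'`: on a machine with word bound `B`, the program `P` started in the state `s`
halts in the state `s'` after exactly `t` elementary operations. -/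
inductive Exec (B : ℕ) : Program → State → ℕ → State → Prop
  | skip (s : State) : Exec B .skip s 1 s
  | setWord {s : State} {a : ℕ} {i e : WExpr} (hi : i.Ok B s) (he : e.Ok B s) :
      Exec B (.setWord a i e) s (i.cost + e.cost + 1) (s.setWord a (i.eval s) (e.eval s))
  | setReal {s : State} {a : ℕ} {i : WExpr} {e : RExpr} (hi : i.Ok B s) (he : e.Ok B s) :
      Exec B (.setReal a i e) s (i.cost + e.cost + 1) (s.setReal a (i.eval s) (e.eval s))
  | seq {s s₁ s₂ : State} {P Q : Program} {t₁ t₂ : ℕ} (hP : Exec B P s t₁ s₁)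
      (hQ : Exec B Q s₁ t₂ s₂) : Exec B (.seq P Q) s (t₁ + t₂) s₂
  | ite_true {s s' : State} {b : Test} {P Q : Program} {t : ℕ} (hb : b.Ok B s) (h : b.Holds s)
      (hP : Exec B P s t s') : Exec B (.ite b P Q) s (b.cost + 1 + t) s'
  | ite_false {s s' : State} {b : Test} {P Q : Program} {t : ℕ} (hb : b.Ok B s) (h : ¬ b.Holds s)
      (hQ : Exec B Q s t s') : Exec B (.ite b P Q) s (b.cost + 1 + t) s'
  | while_false {s : State} {b : Test} {P : Program} (hb : b.Ok B s) (h : ¬ b.Holds s) :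
      Exec B (.while b P) s (b.cost + 1) s
  | while_true {s s₁ s₂ : State} {b : Test} {P : Program} {t₁ t₂ : ℕ} (hb : b.Ok B s)
      (h : b.Holds s) (hP : Exec B P s t₁ s₁) (hW : Exec B (.while b P) s₁ t₂ s₂) :
      Exec B (.while b P) s (b.cost + 1 + t₁ + t₂) s₂

end RealRAM

namespace MinWeightRect

open Classical in
/-- The (indices of the) points that lie in the closed axis-aligned rectangle with lower left
corner `lo` and upper right corner `hi`; the order on `ℝ × ℝ` is the coordinatewise one. -/
noncomputable def enclosed {n : ℕ} (p : Fin n → ℝ × ℝ) (lo hi : ℝ × ℝ) : Finset (Fin n) :=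
  Finset.univ.filter fun i => p i ∈ Set.Icc lo hi

/-- `lo` and `hi` are the corners of an axis-aligned rectangle that encloses exactly `k` points. -/
def Encloses {n : ℕ} (p : Fin n → ℝ × ℝ) (k : ℕ) (lo hi : ℝ × ℝ) : Prop :=
  lo ≤ hi ∧ (enclosed p lo hi).card = k

/-- The total weight of the points in the rectangle. -/
noncomputable def weight {n : ℕ} (p : Fin n → ℝ × ℝ) (w : Fin n → ℝ) (lo hi : ℝ × ℝ) : ℝ :=
  ∑ i ∈ enclosed p lo hi, w i

/-- The rectangle encloses exactly `k` points and has minimum total weight among all such. -/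
def IsOptimal {n : ℕ} (p : Fin n → ℝ × ℝ) (w : Fin n → ℝ) (k : ℕ) (lo hi : ℝ × ℝ) : Prop :=
  Encloses p k lo hi ∧
    ∀ lo' hi' : ℝ × ℝ, Encloses p k lo' hi' → weight p w lo hi ≤ weight p w lo' hi'

/-- The initial memory: `n` and `k` are in the cells `0` and `1` of the word array `0`; the
`x`-coordinates, the `y`-coordinates and the weights of the points are in the first `n` cells of the
real arrays `0`, `1` and `2`; every other cell is zero. -/
noncomputable def input (n k : ℕ) (p : Fin n → ℝ × ℝ) (w : Fin n → ℝ) : RealRAM.State where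
  word := fun a i => if a = 0 ∧ i = 0 then n else if a = 0 ∧ i = 1 then k else 0
  real := fun a i =>
    if h : i < n then
      if a = 0 then (p ⟨i, h⟩).1 else if a = 1 then (p ⟨i, h⟩).2 else if a = 2 then w ⟨i, h⟩ else 0
    else 0

/-- The final memory holds a correct answer: either the cell `0` of the word array `1` is `1`, and the
cells `0, 1, 2, 3` of the real array `3` hold the corners `(x₀, y₀)` and `(x₁, y₁)` of an optimal
rectangle, or the cell `0` of the word array `1` is `0`, and no axis-aligned rectangle encloses
exactly `k` points. -/
def CorrectOutput {n : ℕ} (k : ℕ) (p : Fin n → ℝ × ℝ) (w : Fin n → ℝ) (s : RealRAM.State) : Prop :=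
  (s.word 1 0 = 1 ∧ IsOptimal p w k (s.real 3 0, s.real 3 1) (s.real 3 2, s.real 3 3)) ∨
    (s.word 1 0 = 0 ∧ ¬ ∃ lo hi : ℝ × ℝ, Encloses p k lo hi)

end MinWeightRect

/-! ### Program logic for the real RAM: frames, timed triples, weakest preconditions. -/

namespace RealRAM

/-! Sort the points by ordinate into rows and pad the number of rows to a power of two `N` between
`n` and `2 n` (`N = 1` if `n = 0`). A vertical slab is a pair of cuts `i`, `j`: an open half-plane
to the left of a point and a closed half-plane reaching to a point, so that the slab, their
difference, is closed. For `k > 0` every nonempty set cut out by a rectangle consists of the points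
of a slab in a range of rows `u, …, v` that does not split a group of equal ordinates
(`Sorted.exists_box`). So it suffices to minimize over tuples `(u, v, i, j)`.

The search halves blocks of rows. At block size `s` a tuple `(u, v, i, j)` stands for all rectangles
in the slab `i, j` whose lowest row lies in block `u` and highest row in block `v`. Such a tuple
matters only if it is feasible: `k` lies between the number `lo` of points strictly between the
blocks and the number `up` of points including both blocks.

Two tuples at the same node are interchangeable if they agree in the numbers of points of the left
cut and of the right cut in the two blocks, and in `lo` (`SameKey`). Indeed cuts form a chain, so
equal numbers of points in the blocks force equal sets of points in the blocks. All descendants then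
have equal counts, and their weights differ by a constant, the difference of the weights `val`
between the blocks (`SameKey.child`). Hence only the tuple of least `val` in each class is kept.

The time bound rests on `sameKey_of_code`: a node of block size `s` has only `O(s²)` feasible
classes, although three parameters of range `O(s)` describe a class. There are at most `(N/s)²`
nodes, so each level has at most `30 N²` entries (`Queue.length_le`), and there are `log₂ N + 1`
levels.

Classes are found in constant time by using their key, a six-digit number in base `4 (n + 1)`, as an
address in an array that is initially zero. Prefix sums over the rows for all `2 n` cuts give each
count and weight in constant time. At block size one the surviving entries are scanned for the best
rectangle. The case `k = 0` is solved by a degenerate rectangle to the right of all points. -/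

@[simp] theorem State.word_setWord (s : State) (a i v b : ℕ) :
    (s.setWord a i v).word b = if b = a then Function.update (s.word b) i v else s.word b := by
  funext j
  by_cases h : b = a <;> simp [State.setWord, h, Function.update_apply]

@[simp] theorem State.real_setWord (s : State) (a i v : ℕ) : (s.setWord a i v).real = s.real := rfl

@[simp] theorem State.word_setReal (s : State) (a i : ℕ) (v : ℝ) :
    (s.setReal a i v).word = s.word := rfl

@[simp] theorem State.real_setReal (s : State) (a i : ℕ) (v : ℝ) (b : ℕ) :
    (s.setReal a i v).real b = if b = a then Function.update (s.real b) i v else s.real b := by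
  funext j
  by_cases h : b = a <;> simp [State.setReal, h, Function.update_apply]

/-- Started in `s`, the program halts within `T` steps in a state satisfying `Q`. -/
def Runs (B : ℕ) (P : Program) (s : State) (T : ℕ) (Q : State → Prop) : Prop :=
  ∃ t s', Exec B P s t s' ∧ t ≤ T ∧ Q s'

/-- The word arrays that a program may modify. -/
def Program.wordMods : Program → List ℕ
  | skip => []
  | setWord a _ _ => [a]
  | setReal _ _ _ => []
  | seq P Q => P.wordMods ++ Q.wordMods
  | ite _ P Q => P.wordMods ++ Q.wordMods
  | .while _ P => P.wordMods

/-- The real arrays that a program may modify. -/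
def Program.realMods : Program → List ℕ
  | skip => []
  | setWord _ _ _ => []
  | setReal a _ _ => [a]
  | seq P Q => P.realMods ++ Q.realMods
  | ite _ P Q => P.realMods ++ Q.realMods
  | .while _ P => P.realMods

/-- Two states agree on all arrays that the program does not modify. -/
structure Frame (P : Program) (s s' : State) : Prop where
  word : ∀ a, a ∉ P.wordMods → s'.word a = s.word a
  real : ∀ a, a ∉ P.realMods → s'.real a = s.real a

theorem Frame.refl (P : Program) (s : State) : Frame P s s := ⟨fun _ _ => rfl, fun _ _ => rfl⟩

theorem Frame.trans {P : Program} {s₁ s₂ s₃ : State} (h : Frame P s₁ s₂) (h' : Frame P s₂ s₃) :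
    Frame P s₁ s₃ :=
  ⟨fun a ha => (h'.word a ha).trans (h.word a ha), fun a ha => (h'.real a ha).trans (h.real a ha)⟩

/-- The set of assigned arrays is syntactic, so for a concrete program `decide` settles which arrays
survive. Loop invariants then need to mention only what changes. -/
theorem Exec.frame {B : ℕ} {P : Program} {s s' : State} {t : ℕ} (h : Exec B P s t s') :
    Frame P s s' := by
  induction h with
  | skip s => exact Frame.refl _ _
  | setWord hi he =>
    refine ⟨fun a ha => ?_, fun _ _ => rfl⟩
    simp only [Program.wordMods, List.mem_singleton] at ha
    simp [ha]
  | setReal hi he =>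
    refine ⟨fun _ _ => rfl, fun a ha => ?_⟩
    simp only [Program.realMods, List.mem_singleton] at ha
    simp [ha]
  | seq _ _ h₁ h₂ =>
    refine ⟨fun a ha => ?_, fun a ha => ?_⟩
    · simp only [Program.wordMods, List.mem_append, not_or] at ha
      rw [h₂.word a ha.2, h₁.word a ha.1]
    · simp only [Program.realMods, List.mem_append, not_or] at ha
      rw [h₂.real a ha.2, h₁.real a ha.1]
  | ite_true _ _ _ h₁ =>
    refine ⟨fun a ha => ?_, fun a ha => ?_⟩
    · simp only [Program.wordMods, List.mem_append, not_or] at ha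
      rw [h₁.word a ha.1]
    · simp only [Program.realMods, List.mem_append, not_or] at ha
      rw [h₁.real a ha.1]
  | ite_false _ _ _ h₁ =>
    refine ⟨fun a ha => ?_, fun a ha => ?_⟩
    · simp only [Program.wordMods, List.mem_append, not_or] at ha
      rw [h₁.word a ha.2]
    · simp only [Program.realMods, List.mem_append, not_or] at ha
      rw [h₁.real a ha.2]
  | while_false => exact Frame.refl _ _
  | while_true _ _ _ _ h₁ h₂ =>
    exact Frame.trans (P := .while _ _) ⟨h₁.word, h₁.real⟩ h₂

theorem Runs.mono {B : ℕ} {P : Program} {s : State} {T T' : ℕ} {Q Q' : State → Prop}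
    (h : Runs B P s T Q) (hT : T ≤ T') (hQ : ∀ s', Frame P s s' → Q s' → Q' s') :
    Runs B P s T' Q' := by
  obtain ⟨t, s', he, ht, hq⟩ := h
  exact ⟨t, s', he, ht.trans hT, hQ s' he.frame hq⟩

theorem Runs.seq {B : ℕ} {P P' : Program} {s : State} {T T' : ℕ} {Q R : State → Prop}
    (h : Runs B P s T Q) (h' : ∀ s', Frame P s s' → Q s' → Runs B P' s' T' R) :
    Runs B (.seq P P') s (T + T') R := by
  obtain ⟨t, s', he, ht, hq⟩ := h
  obtain ⟨t', s'', he', ht', hr⟩ := h' s' he.frame hq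
  exact ⟨t + t', s'', .seq he he', by omega, hr⟩

theorem Runs.ite {B : ℕ} {b : Test} {P P' : Program} {s : State} {T : ℕ}
    {Q : State → Prop} (hb : b.Ok B s) (h : b.Holds s → Runs B P s T Q)
    (h' : ¬ b.Holds s → Runs B P' s T Q) : Runs B (.ite b P P') s (b.cost + 1 + T) Q := by
  by_cases hh : b.Holds s
  · obtain ⟨t, s', he, ht, hq⟩ := h hh
    exact ⟨_, s', .ite_true hb hh he, by omega, hq⟩
  · obtain ⟨t, s', he, ht, hq⟩ := h' hh
    exact ⟨_, s', .ite_false hb hh he, by omega, hq⟩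

/-- The rule for a loop with `m` iterations. -/
theorem Runs.while {B : ℕ} {b : Test} {P : Program} {s : State} (m T : ℕ)
    {I : ℕ → State → Prop} (h0 : I 0 s)
    (hstep : ∀ j < m, ∀ s', Frame P s s' → I j s' →
      b.Ok B s' ∧ b.Holds s' ∧ Runs B P s' T (I (j + 1)))
    (hend : ∀ s', Frame P s s' → I m s' → b.Ok B s' ∧ ¬ b.Holds s') :
    Runs B (.while b P) s (m * (b.cost + 1 + T) + (b.cost + 1)) (I m) := by
  -- Induction on the number `r` of remaining iterations, for all intermediate states. The frame
  -- relative to the initial state is carried along so that each step may use it.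
  have key : ∀ r j s', j + r = m → Frame P s s' → I j s' →
      Runs B (.while b P) s' (r * (b.cost + 1 + T) + (b.cost + 1)) (I m) := by
    intro r
    induction r with
    | zero =>
      intro j s' hj hf hi
      obtain rfl : j = m := by omega
      obtain ⟨hb, hh⟩ := hend s' hf hi
      exact ⟨_, s', .while_false hb hh, by omega, hi⟩
    | succ r ih =>
      intro j s' hj hf hi
      obtain ⟨hb, hh, t, s₁, he, ht, hi'⟩ := hstep j (by omega) s' hf hi
      obtain ⟨t', s₂, he', ht', hi''⟩ := ih (j + 1) s₁ (by omega) (hf.trans he.frame) hi'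
      refine ⟨_, s₂, .while_true hb hh he he', ?_, hi''⟩
      rw [Nat.succ_mul]
      omega
  exact key m 0 s (by omega) (Frame.refl _ _) h0

/-- The weakest precondition of a program without loops. -/
def Program.wp (B : ℕ) : Program → (State → Prop) → State → Prop
  | skip, Q, s => Q s
  | setWord a i e, Q, s => i.Ok B s ∧ e.Ok B s ∧ Q (s.setWord a (i.eval s) (e.eval s))
  | setReal a i e, Q, s => i.Ok B s ∧ e.Ok B s ∧ Q (s.setReal a (i.eval s) (e.eval s))
  | seq P P', Q, s => P.wp B (P'.wp B Q) s
  | ite b P P', Q, s => b.Ok B s ∧ (b.Holds s → P.wp B Q s) ∧ (¬ b.Holds s → P'.wp B Q s)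
  | .while _ _, _, _ => False

/-- An upper bound for the running time of a program without loops. -/
def Program.maxCost : Program → ℕ
  | skip => 1
  | setWord _ i e => i.cost + e.cost + 1
  | setReal _ i e => i.cost + e.cost + 1
  | seq P Q => P.maxCost + Q.maxCost
  | ite b P Q => b.cost + 1 + (P.maxCost + Q.maxCost)
  | .while _ _ => 0

/-- A loop has precondition `False`, so the value `0` of `maxCost` at loops does no harm. -/
theorem Runs.of_wp {B : ℕ} {P : Program} {s : State} {Q : State → Prop} (h : P.wp B Q s) :
    Runs B P s P.maxCost Q := by
  induction P generalizing s Q with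
  | skip => exact ⟨_, s, .skip s, le_rfl, h⟩
  | setWord a i e => exact ⟨_, _, .setWord h.1 h.2.1, le_rfl, h.2.2⟩
  | setReal a i e => exact ⟨_, _, .setReal h.1 h.2.1, le_rfl, h.2.2⟩
  | seq P P' ih ih' => exact (ih h).seq fun s' _ hs => ih' hs
  | ite b P P' ih ih' =>
    exact Runs.ite h.1 (fun hb => (ih (h.2.1 hb)).mono (by omega) fun _ _ hq => hq)
      (fun hb => (ih' (h.2.2 hb)).mono (by omega) fun _ _ hq => hq)
  | _ => exact h.elim

/-- The word variable stored in the cell `0` of the word array `a`. -/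
abbrev var (a : ℕ) : WExpr := .get a (.const 0)

/-- Assignment to a word variable. -/
abbrev assign (a : ℕ) (e : WExpr) : Program := .setWord a (.const 0) e

/-- Increment of a word variable. -/
abbrev incr (a : ℕ) : Program := assign a (.add (var a) (.const 1))

end RealRAM

/-! ### Cuts, slabs and the exchange of tuples with the same key. -/

namespace MinWeightRect

/-- The points in the order of their `y`-coordinates (abscissas `X`, weights `W`), the number `k` of
points to enclose, and an upper bound `N` for the number `n` of points. -/
structure Grid where
  n : ℕ
  k : ℕ
  N : ℕ
  X : ℕ → ℝ
  W : ℕ → ℝ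

namespace Grid

/-- The cut `z < n` consists of the points strictly to the left of the point `z`, and the cut `n + z`
also contains the points on the vertical line through `z`. -/
def InCut (D : Grid) (z r : ℕ) : Prop := if z < D.n then D.X r < D.X z else D.X r ≤ D.X (z - D.n)

open Classical in
/-- The sum of `f` over the points of the cut `z` among the `d` lowest points. -/
noncomputable def cutSum {A : Type} [AddCommMonoid A] (D : Grid) (f : ℕ → A) (z d : ℕ) : A :=
  ∑ r ∈ Finset.range d, if r < D.n ∧ D.InCut z r then f r else 0

noncomputable def cnt (D : Grid) (z d : ℕ) : ℕ := D.cutSum (fun _ => 1) z d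

noncomputable def cw (D : Grid) (z d : ℕ) : ℝ := D.cutSum D.W z d

/-- The number of points between two cuts among the `d` lowest points. -/
noncomputable def win (D : Grid) (i j d : ℕ) : ℕ := D.cnt j d - D.cnt i d

noncomputable def wwin (D : Grid) (i j d : ℕ) : ℝ := D.cw j d - D.cw i d

/-- The number of points of a cut in the blocks `u` and `v` of size `s` (counted twice if `u = v`). -/
noncomputable def act (D : Grid) (s u v z : ℕ) : ℕ :=
  (D.cnt z (u * s + s) - D.cnt z (u * s)) + (D.cnt z (v * s + s) - D.cnt z (v * s))

/-- The number of points between two cuts and strictly between two blocks. -/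
noncomputable def lo (D : Grid) (s u v i j : ℕ) : ℕ := D.win i j (v * s) - D.win i j (u * s + s)

/-- The number of points between two cuts from one block to another. -/
noncomputable def up (D : Grid) (s u v i j : ℕ) : ℕ := D.win i j (v * s + s) - D.win i j (u * s)

/-- For `u < v` this is the weight strictly between the blocks. For `u = v` it is minus the weight
in the block, where `lo` is truncated to `0`. This is harmless: only differences of `val` within a
class matter. -/
noncomputable def val (D : Grid) (s u v i j : ℕ) : ℝ :=
  D.wwin i j (v * s) - D.wwin i j (u * s + s)

noncomputable def tot (D : Grid) (s u v i j : ℕ) : ℝ :=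
  D.wwin i j (v * s + s) - D.wwin i j (u * s)

/-- The left cut is open and the right cut is closed, so their difference is the closed slab from
the point `i` to the point `j - D.n`. -/
structure Pair (D : Grid) (i j : ℕ) : Prop where
  left : i < D.n
  right : D.n ≤ j
  lt : j < 2 * D.n
  le : D.X i ≤ D.X (j - D.n)

structure Node (D : Grid) (s u v : ℕ) : Prop where
  le : u ≤ v
  bound : v * s + s ≤ D.N

/-- Three numbers suffice because a cut is determined inside the blocks by its number of points
there. -/
structure SameKey (D : Grid) (s u v i j i' j' : ℕ) : Prop where
  left : D.act s u v i = D.act s u v i'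
  right : D.act s u v j = D.act s u v j'
  lo : D.lo s u v i j = D.lo s u v i' j'

variable (D : Grid)

theorem cutSum_zero {A : Type} [AddCommMonoid A] (f : ℕ → A) (z : ℕ) : D.cutSum f z 0 = 0 := by
  simp [cutSum]

open Classical in
theorem cutSum_succ {A : Type} [AddCommMonoid A] (f : ℕ → A) (z d : ℕ) :
    D.cutSum f z (d + 1) = D.cutSum f z d + if d < D.n ∧ D.InCut z d then f d else 0 := by
  simp [cutSum, Finset.sum_range_succ]

open Classical in
theorem cnt_succ (z d : ℕ) :
    D.cnt z (d + 1) = D.cnt z d + if d < D.n ∧ D.InCut z d then 1 else 0 :=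
  D.cutSum_succ _ z d

/-- Cuts are half-planes with parallel boundaries, hence a chain under inclusion. -/
theorem inCut_total (z z' : ℕ) :
    (∀ r, D.InCut z r → D.InCut z' r) ∨ (∀ r, D.InCut z' r → D.InCut z r) := by
  unfold InCut
  split_ifs
  · rcases le_total (D.X z) (D.X z') with h | h
    · exact .inl fun r hr => hr.trans_le h
    · exact .inr fun r hr => hr.trans_le h
  · rcases le_or_gt (D.X z) (D.X (z' - D.n)) with h | h
    · exact .inl fun r hr => hr.le.trans h
    · exact .inr fun r hr => hr.trans_lt h
  · rcases le_or_gt (D.X z') (D.X (z - D.n)) with h | h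
    · exact .inr fun r hr => hr.le.trans h
    · exact .inl fun r hr => hr.trans_lt h
  · rcases le_total (D.X (z - D.n)) (D.X (z' - D.n)) with h | h
    · exact .inl fun r hr => hr.trans h
    · exact .inr fun r hr => hr.trans h

variable {D}

theorem Pair.sub {i j : ℕ} (h : D.Pair i j) (r : ℕ) (hr : D.InCut i r) : D.InCut j r := by
  unfold InCut at *
  rw [if_pos h.left] at hr
  rw [if_neg (not_lt.2 h.right)]
  exact hr.le.trans h.le

/-- In the rows from `d` up to `d'` the larger cut has at least as many points. The additive form
avoids truncated subtraction. -/
theorem cnt_sub {z z' : ℕ} (h : ∀ r, D.InCut z r → D.InCut z' r) {d d' : ℕ} (hd : d ≤ d') :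
    D.cnt z d' + D.cnt z' d ≤ D.cnt z' d' + D.cnt z d := by
  induction d', hd using Nat.le_induction with
  | base => omega
  | succ e _ ih =>
    rw [cnt_succ, cnt_succ]
    have := h e
    split_ifs <;> first | omega | tauto

theorem cnt_mono (z : ℕ) {d d' : ℕ} (hd : d ≤ d') : D.cnt z d ≤ D.cnt z d' := by
  induction d', hd using Nat.le_induction with
  | base => omega
  | succ e _ ih => rw [cnt_succ]; omega

theorem cnt_add_le (z d t : ℕ) : D.cnt z (d + t) ≤ D.cnt z d + t := by
  induction t with
  | zero => simp
  | succ t ih => rw [← add_assoc, cnt_succ]; split_ifs <;> omega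

theorem cnt_zero (z : ℕ) : D.cnt z 0 = 0 := D.cutSum_zero _ z

theorem cnt_le (z d : ℕ) : D.cnt z d ≤ D.n := by
  have h : D.cnt z d ≤ min d D.n := by
    induction d with
    | zero => simp [cnt_zero]
    | succ d ih => rw [cnt_succ]; split_ifs <;> omega
  omega

theorem cnt_le_of_sub {z z' : ℕ} (h : ∀ r, D.InCut z r → D.InCut z' r) (d : ℕ) :
    D.cnt z d ≤ D.cnt z' d := by
  have := cnt_sub h (Nat.zero_le d)
  simpa [cnt_zero] using this

theorem win_mono {i j : ℕ} (h : D.Pair i j) {d d' : ℕ} (hd : d ≤ d') :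
    D.win i j d ≤ D.win i j d' := by
  have h1 := cnt_sub h.sub hd
  have h2 := cnt_le_of_sub h.sub d
  have h3 := cnt_le_of_sub h.sub d'
  unfold win; omega

theorem win_add_le {i j : ℕ} (h : D.Pair i j) (d t : ℕ) :
    D.win i j (d + t) ≤ D.win i j d + t := by
  have h1 := cnt_mono (D := D) i (Nat.le_add_right d t)
  have h2 := cnt_add_le (D := D) j d t
  have h3 := cnt_le_of_sub h.sub d
  unfold win; omega

theorem cutSum_shift {A : Type} [AddCommMonoid A] (f : ℕ → A) {z z' c d : ℕ} (hcd : c ≤ d)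
    (h : ∀ r, c ≤ r → r < d → r < D.n → (D.InCut z r ↔ D.InCut z' r)) :
    D.cutSum f z d + D.cutSum f z' c = D.cutSum f z' d + D.cutSum f z c := by
  induction d, hcd using Nat.le_induction with
  | base => exact add_comm _ _
  | succ e he ih =>
    have h1 := ih fun r hr hr' => h r hr (by omega)
    have h2 : (e < D.n ∧ D.InCut z e) ↔ (e < D.n ∧ D.InCut z' e) :=
      and_congr_right fun hn => h e he (by omega) hn
    rw [cutSum_succ, cutSum_succ, add_right_comm, h1, add_right_comm]
    by_cases hh : e < D.n ∧ D.InCut z e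
    · rw [if_pos hh, if_pos (h2.1 hh)]
    · rw [if_neg hh, if_neg fun hh' => hh (h2.2 hh')]

/-- A point of the larger cut outside the smaller one, in a row from `c` to `d - 1`, would make the
larger count there strictly bigger. -/
theorem inCut_iff_of_cnt {z z' c d r : ℕ} (hs : ∀ r, D.InCut z r → D.InCut z' r)
    (h : D.cnt z' d + D.cnt z c ≤ D.cnt z d + D.cnt z' c) (hc : c ≤ r) (hd : r < d)
    (hn : r < D.n) : D.InCut z r ↔ D.InCut z' r := by
  refine ⟨hs r, fun hr => ?_⟩
  by_contra hr'
  have h1 := cnt_sub hs hc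
  have h2 := cnt_sub hs (show r + 1 ≤ d from hd)
  rw [cnt_succ, cnt_succ, if_pos ⟨hn, hr⟩, if_neg fun hh => hr' hh.2] at h2
  omega

/-- By nestedness each block contributes at least as much to the larger cut. Equality of the sums
therefore forces equality in each block. -/
theorem inCut_iff_of_act {s u v z z' : ℕ} (h : D.act s u v z = D.act s u v z') (r : ℕ)
    (hr : (u * s ≤ r ∧ r < u * s + s) ∨ (v * s ≤ r ∧ r < v * s + s)) (hn : r < D.n) :
    D.InCut z r ↔ D.InCut z' r := by
  wlog hs : ∀ r, D.InCut z r → D.InCut z' r generalizing z z'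
  · exact (this h.symm ((D.inCut_total z z').resolve_left hs)).symm
  have h1 := cnt_sub hs (Nat.le_add_right (u * s) s)
  have h2 := cnt_sub hs (Nat.le_add_right (v * s) s)
  have h3 := cnt_mono (D := D) z (Nat.le_add_right (u * s) s)
  have h4 := cnt_mono (D := D) z (Nat.le_add_right (v * s) s)
  have h5 := cnt_mono (D := D) z' (Nat.le_add_right (u * s) s)
  have h6 := cnt_mono (D := D) z' (Nat.le_add_right (v * s) s)
  unfold act at h
  rcases hr with ⟨ha, hb⟩ | ⟨ha, hb⟩
  · exact inCut_iff_of_cnt hs (by omega) ha hb hn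
  · exact inCut_iff_of_cnt hs (by omega) ha hb hn

/-- Prefix sums of the two cuts differ by a constant along each block, since the cuts agree there.
The common form serves both counts and weights. -/
theorem cutSum_shift_of_act {A : Type} [AddCommMonoid A] (f : ℕ → A) {s u v z z' : ℕ}
    (h : D.act s u v z = D.act s u v z') {d : ℕ} :
    (u * s ≤ d → d ≤ u * s + s →
      D.cutSum f z d + D.cutSum f z' (u * s) = D.cutSum f z' d + D.cutSum f z (u * s)) ∧
    (v * s ≤ d → d ≤ v * s + s →
      D.cutSum f z d + D.cutSum f z' (v * s) = D.cutSum f z' d + D.cutSum f z (v * s)) :=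
  ⟨fun h1 h2 => cutSum_shift f h1 fun r _ _ hn => inCut_iff_of_act h r (by omega) hn,
    fun h1 h2 => cutSum_shift f h1 fun r _ _ hn => inCut_iff_of_act h r (by omega) hn⟩

theorem cnt_shift_of_act {s u v z z' : ℕ} (h : D.act s u v z = D.act s u v z') {d : ℕ} :
    (u * s ≤ d → d ≤ u * s + s →
      D.cnt z d + D.cnt z' (u * s) = D.cnt z' d + D.cnt z (u * s)) ∧
    (v * s ≤ d → d ≤ v * s + s →
      D.cnt z d + D.cnt z' (v * s) = D.cnt z' d + D.cnt z (v * s)) :=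
  cutSum_shift_of_act (fun _ => 1) h

theorem cw_shift_of_act {s u v z z' : ℕ} (h : D.act s u v z = D.act s u v z') {d : ℕ} :
    (u * s ≤ d → d ≤ u * s + s →
      D.cw z d + D.cw z' (u * s) = D.cw z' d + D.cw z (u * s)) ∧
    (v * s ≤ d → d ≤ v * s + s →
      D.cw z d + D.cw z' (v * s) = D.cw z' d + D.cw z (v * s)) :=
  cutSum_shift_of_act (D.W) h

/-- The blocks `u'`, `v'` of size `s'` lie in the blocks `u`, `v` of size `s`. -/
structure Child (s u v s' u' v' : ℕ) : Prop where
  le_left : u * s ≤ u' * s'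
  left_le : u' * s' + s' ≤ u * s + s
  le_right : v * s ≤ v' * s'
  right_le : v' * s' + s' ≤ v * s + s

theorem Child.refl (s u v : ℕ) : Child s u v s u v := ⟨le_rfl, le_rfl, le_rfl, le_rfl⟩

theorem Child.half (s u v : ℕ) : Child (2 * s) (u / 2) (v / 2) s u v := by
  have h : ∀ u : ℕ, u / 2 * (2 * s) ≤ u * s ∧ u * s + s ≤ u / 2 * (2 * s) + 2 * s := by
    intro u
    constructor
    · calc u / 2 * (2 * s) = (u / 2 * 2) * s := by ring
        _ ≤ u * s := Nat.mul_le_mul_right _ (Nat.div_mul_le_self u 2)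
    · calc u * s + s = (u + 1) * s := by ring
        _ ≤ (u / 2 * 2 + 2) * s := Nat.mul_le_mul_right _ (by omega)
        _ = _ := by ring
  exact ⟨(h u).1, (h u).2, (h v).1, (h v).2⟩

theorem block_le {s u v : ℕ} (h : u < v) : u * s + s ≤ v * s := by
  calc u * s + s = (u + 1) * s := by ring
    _ ≤ v * s := Nat.mul_le_mul_right _ h

/-- The rows from `d` to `e` split into a piece of block `u`, the rows between the blocks, and a
piece of block `v`. The outer pieces agree because the cuts do, the middle one because `lo` does. If
`u = v`, there is no middle piece and both rows lie in one block. -/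
theorem SameKey.win_eq {s u v i j i' j' : ℕ} (h : D.SameKey s u v i j i' j') (hp : D.Pair i j)
    (hp' : D.Pair i' j') (huv : u ≤ v) {d e : ℕ} (hd : u * s ≤ d) (hd' : d ≤ u * s + s)
    (he : v * s ≤ e) (he' : e ≤ v * s + s) :
    D.win i j e + D.win i' j' d = D.win i' j' e + D.win i j d := by
  have a1 := (cnt_shift_of_act h.left).1 hd hd'
  have a2 := (cnt_shift_of_act h.right).1 hd hd'
  have a3 := (cnt_shift_of_act h.left).2 he he'
  have a4 := (cnt_shift_of_act h.right).2 he he'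
  have a5 := (cnt_shift_of_act h.left).1 (Nat.le_add_right (u * s) s) le_rfl
  have a6 := (cnt_shift_of_act h.right).1 (Nat.le_add_right (u * s) s) le_rfl
  have b := fun d => cnt_le_of_sub hp.sub d
  have b' := fun d => cnt_le_of_sub hp'.sub d
  have b1 := b d
  have b2 := b e
  have b3 := b' d
  have b4 := b' e
  have b5 := b (v * s)
  have b6 := b' (v * s)
  have b7 := b (u * s + s)
  have b8 := b' (u * s + s)
  have hl := h.lo
  rcases huv.eq_or_lt with rfl | huv
  · unfold win; omega
  · have c1 := win_mono hp (block_le (s := s) huv)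
    have c2 := win_mono hp' (block_le (s := s) huv)
    unfold Grid.lo at hl
    unfold win at *
    omega

/-- After subtraction of `val`, only sums over rows inside the blocks remain. Over the reals no case
distinction on `u = v` is needed. -/
theorem SameKey.wwin_eq {s u v i j i' j' : ℕ} (h : D.SameKey s u v i j i' j') {d e : ℕ}
    (hd : u * s ≤ d) (hd' : d ≤ u * s + s) (he : v * s ≤ e) (he' : e ≤ v * s + s) :
    D.wwin i j e - D.wwin i j d - D.val s u v i j =
      D.wwin i' j' e - D.wwin i' j' d - D.val s u v i' j' := by
  have a1 := (cw_shift_of_act h.left).1 hd hd'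
  have a2 := (cw_shift_of_act h.right).1 hd hd'
  have a3 := (cw_shift_of_act h.left).2 he he'
  have a4 := (cw_shift_of_act h.right).2 he he'
  have a5 := (cw_shift_of_act h.left).1 (Nat.le_add_right (u * s) s) le_rfl
  have a6 := (cw_shift_of_act h.right).1 (Nat.le_add_right (u * s) s) le_rfl
  unfold val wwin
  linarith

/-- The exchange argument: interchangeable tuples remain interchangeable in all smaller blocks, and
the order of their weights is decided by `val` at the ancestor. -/
theorem SameKey.child {s u v s' u' v' i j i' j' : ℕ} (h : D.SameKey s u v i j i' j')
    (hp : D.Pair i j) (hp' : D.Pair i' j') (huv : u ≤ v) (hc : Child s u v s' u' v') :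
    D.SameKey s' u' v' i j i' j' ∧ D.up s' u' v' i j = D.up s' u' v' i' j' ∧
      D.val s' u' v' i j - D.val s u v i j = D.val s' u' v' i' j' - D.val s u v i' j' ∧
      D.tot s' u' v' i j - D.val s u v i j = D.tot s' u' v' i' j' - D.val s u v i' j' := by
  obtain ⟨h1, h2, h3, h4⟩ := hc
  have hact : ∀ {z z'}, D.act s u v z = D.act s u v z' →
      D.act s' u' v' z = D.act s' u' v' z' := by
    intro z z' hz
    have a1 := (cnt_shift_of_act hz).1 h1 (by omega)
    have a2 := (cnt_shift_of_act hz).1 (show u * s ≤ u' * s' + s' by omega) h2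
    have a3 := (cnt_shift_of_act hz).2 h3 (by omega)
    have a4 := (cnt_shift_of_act hz).2 (show v * s ≤ v' * s' + s' by omega) h4
    have b1 := cnt_mono (D := D) z (Nat.le_add_right (u' * s') s')
    have b2 := cnt_mono (D := D) z' (Nat.le_add_right (u' * s') s')
    have b3 := cnt_mono (D := D) z (Nat.le_add_right (v' * s') s')
    have b4 := cnt_mono (D := D) z' (Nat.le_add_right (v' * s') s')
    unfold act; omega
  refine ⟨⟨hact h.left, hact h.right, ?_⟩, ?_, ?_, ?_⟩
  · have := h.win_eq hp hp' huv (show u * s ≤ u' * s' + s' by omega) h2 h3 (by omega)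
    unfold Grid.lo; omega
  · have := h.win_eq hp hp' huv h1 (by omega) (show v * s ≤ v' * s' + s' by omega) h4
    unfold up; omega
  · exact h.wwin_eq (by omega) h2 h3 (by omega)
  · exact h.wwin_eq h1 (by omega) (by omega) h4

/-- The rectangle may have a descendant with exactly `k` points. -/
def Feasible (D : Grid) (s u v i j : ℕ) : Prop := D.lo s u v i j ≤ D.k ∧ D.k ≤ D.up s u v i j

/-- Shrinking the blocks can only raise `lo` and lower `up`, so pruning infeasible tuples loses no
feasible descendant. -/
theorem Feasible.parent {s u v s' u' v' i j : ℕ} (h : D.Feasible s' u' v' i j)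
    (hp : D.Pair i j) (hc : Child s u v s' u' v') : D.Feasible s u v i j := by
  obtain ⟨h1, h2, h3, h4⟩ := hc
  have a1 := win_mono hp h1
  have a2 := win_mono hp h2
  have a3 := win_mono hp h3
  have a4 := win_mono hp h4
  obtain ⟨g1, g2⟩ := h
  unfold Feasible
  unfold lo up at *
  omega

end Grid
end MinWeightRect

/-! ### Quadratically many feasible classes at a node. -/

namespace MinWeightRect
namespace Grid
variable {D : Grid}

/-- The number of points of a cut strictly between two blocks. -/
noncomputable def mid (D : Grid) (s u v z : ℕ) : ℕ := D.cnt z (v * s) - D.cnt z (u * s + s)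

theorem mid_le (s u v z : ℕ) : D.mid s u v z ≤ D.n := (Nat.sub_le _ _).trans (cnt_le _ _)

theorem mid_le_of_sub {s u v z z' : ℕ} (h : ∀ r, D.InCut z r → D.InCut z' r) (huv : u ≤ v) :
    D.mid s u v z ≤ D.mid s u v z' := by
  unfold mid
  rcases huv.eq_or_lt with rfl | huv
  · have := cnt_mono (D := D) z (Nat.le_add_right (u * s) s)
    omega
  · have := cnt_sub h (block_le (s := s) huv)
    omega

theorem act_le_of_sub {s u v z z' : ℕ} (h : ∀ r, D.InCut z r → D.InCut z' r) :
    D.act s u v z ≤ D.act s u v z' := by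
  have h1 := cnt_sub h (Nat.le_add_right (u * s) s)
  have h2 := cnt_sub h (Nat.le_add_right (v * s) s)
  unfold act
  omega

theorem act_le (s u v z : ℕ) : D.act s u v z ≤ 2 * s := by
  have h1 := cnt_add_le (D := D) z (u * s) s
  have h2 := cnt_add_le (D := D) z (v * s) s
  unfold act
  omega

theorem act_le_two_mul (s u v z : ℕ) : D.act s u v z ≤ 2 * D.n := by
  have h1 := cnt_le (D := D) z (u * s + s)
  have h2 := cnt_le (D := D) z (v * s + s)
  unfold act
  omega

theorem lo_le (s u v i j : ℕ) : D.lo s u v i j ≤ D.n :=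
  (Nat.sub_le _ _).trans ((Nat.sub_le _ _).trans (cnt_le _ _))

theorem up_le (s u v i j : ℕ) : D.up s u v i j ≤ D.n :=
  (Nat.sub_le _ _).trans ((Nat.sub_le _ _).trans (cnt_le _ _))

theorem lo_add_mid {s u v i j : ℕ} (h : D.Pair i j) (huv : u ≤ v) :
    D.lo s u v i j + D.mid s u v i = D.mid s u v j := by
  have h1 := cnt_le_of_sub h.sub (v * s)
  have h2 := cnt_le_of_sub h.sub (u * s + s)
  unfold lo mid win
  rcases huv.eq_or_lt with rfl | huv
  · have := cnt_mono (D := D) i (Nat.le_add_right (u * s) s)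
    have := cnt_mono (D := D) j (Nat.le_add_right (u * s) s)
    have := cnt_sub h.sub (Nat.le_add_right (u * s) s)
    omega
  · have := cnt_mono (D := D) i (block_le (s := s) huv)
    have := cnt_mono (D := D) j (block_le (s := s) huv)
    have := cnt_sub h.sub (block_le (s := s) huv)
    omega

theorem up_le_lo_add {s u v i j : ℕ} (h : D.Pair i j) :
    D.up s u v i j ≤ D.lo s u v i j + 2 * s := by
  have h1 := win_add_le h (v * s) s
  have h2 := win_add_le h (u * s) s
  unfold lo up
  omega

/-- A monotone function separating the values of `mid` of the cuts with `a` active points. -/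
noncomputable def sep (D : Grid) (s u v a : ℕ) : ℕ :=
  sInf {t | t = D.n ∨ ∃ z, a ≤ D.act s u v z ∧ t = D.mid s u v z}

theorem sep_mono (s u v : ℕ) {a b : ℕ} (h : a ≤ b) : D.sep s u v a ≤ D.sep s u v b := by
  refine Nat.sInf_le ?_
  have hb : D.sep s u v b ∈ {t | t = D.n ∨ ∃ z, b ≤ D.act s u v z ∧ t = D.mid s u v z} :=
    Nat.sInf_mem ⟨D.n, .inl rfl⟩
  rcases hb with hb | ⟨z, hz, hb⟩
  · exact .inl hb
  · exact .inr ⟨z, h.trans hz, hb⟩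

theorem sep_le (s u v z : ℕ) : D.sep s u v (D.act s u v z) ≤ D.mid s u v z :=
  Nat.sInf_le (.inr ⟨z, le_rfl, rfl⟩)

/-- A cut with more points in the blocks contains `z`, by the chain property, and so has at least as
many points between them. With `sep_le`, the values of `mid` on cuts with `a` active points lie
between `sep a` and `sep (a + 1)`. -/
theorem le_sep {s u v : ℕ} (huv : u ≤ v) (z : ℕ) :
    D.mid s u v z ≤ D.sep s u v (D.act s u v z + 1) := by
  have hb : D.sep s u v (D.act s u v z + 1) ∈
      {t | t = D.n ∨ ∃ z', D.act s u v z + 1 ≤ D.act s u v z' ∧ t = D.mid s u v z'} :=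
    Nat.sInf_mem ⟨D.n, .inl rfl⟩
  rcases hb with hb | ⟨z', hz, hb⟩
  · rw [hb]; exact mid_le _ _ _ _
  · rw [hb]
    rcases D.inCut_total z z' with h | h
    · exact mid_le_of_sub h huv
    · have := act_le_of_sub (s := s) (u := u) (v := v) h
      omega

/-- An injective encoding of the classes of feasible pairs at a node. -/
noncomputable def code (D : Grid) (s u v i j : ℕ) : Bool × ℕ × ℕ :=
  if D.sep s u v (D.act s u v j) ≤ D.lo s u v i j + D.sep s u v (D.act s u v i) then
    (true, D.act s u v i, D.act s u v j + D.lo s u v i j + 2 * s - D.k)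
  else (false, D.act s u v j, D.act s u v i + D.k - D.lo s u v i j)

/-- Write `a`, `b` for the active numbers of the left and right cut, so that `lo = mid j - mid i`.
Suppose two classes share the code `true`, `a` and `b + lo`, with `b < b'`. Then `lo > lo'`. But `lo
≤ sep (b + 1) - sep a ≤ sep b' - sep a ≤ lo'`, the last step by the test defining the code, a
contradiction. The code `false`, with `b` and `a - lo`, is symmetric: if `a < a'`, then `lo < lo'`,
while `lo ≥ sep b - sep (a + 1) ≥ sep b - sep a' > lo'`. -/
theorem sameKey_of_code {s u v i j i' j' : ℕ} (hp : D.Pair i j) (hp' : D.Pair i' j')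
    (huv : u ≤ v) (hf : D.Feasible s u v i j) (hf' : D.Feasible s u v i' j')
    (h : D.code s u v i j = D.code s u v i' j') : D.SameKey s u v i j i' j' := by
  have a1 := lo_add_mid (s := s) hp huv
  have a2 := lo_add_mid (s := s) hp' huv
  have b1 := up_le_lo_add (s := s) (u := u) (v := v) hp
  have b2 := up_le_lo_add (s := s) (u := u) (v := v) hp'
  obtain ⟨f1, f2⟩ := hf
  obtain ⟨f3, f4⟩ := hf'
  have c1 := sep_le (D := D) s u v i
  have c2 := sep_le (D := D) s u v j
  have c3 := sep_le (D := D) s u v i'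
  have c4 := sep_le (D := D) s u v j'
  have d1 := le_sep (D := D) (s := s) huv i
  have d2 := le_sep (D := D) (s := s) huv j
  have d3 := le_sep (D := D) (s := s) huv i'
  have d4 := le_sep (D := D) (s := s) huv j'
  have m := fun a b (h : a ≤ b) => sep_mono (D := D) s u v h
  unfold code at h
  split_ifs at h with t1 t2 t2
  · simp only [Prod.mk.injEq, true_and] at h
    obtain ⟨h1, h2⟩ := h
    rw [h1] at t1 c1 d1
    rcases lt_trichotomy (D.act s u v j) (D.act s u v j') with hlt | heq | hlt
    · have := m _ _ (Nat.succ_le_of_lt hlt)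
      simp only [Nat.succ_eq_add_one] at this
      omega
    · exact ⟨h1, heq, by omega⟩
    · have := m _ _ (Nat.succ_le_of_lt hlt)
      simp only [Nat.succ_eq_add_one] at this
      omega
  · simp at h
  · simp at h
  · simp only [Prod.mk.injEq, true_and] at h
    obtain ⟨h1, h2⟩ := h
    rw [h1] at t1 c2 d2
    rcases lt_trichotomy (D.act s u v i) (D.act s u v i') with hlt | heq | hlt
    · have := m _ _ (Nat.succ_le_of_lt hlt)
      simp only [Nat.succ_eq_add_one] at this
      omega
    · exact ⟨heq, h1, by omega⟩
    · have := m _ _ (Nat.succ_le_of_lt hlt)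
      simp only [Nat.succ_eq_add_one] at this
      omega

/-- Active numbers are at most `2 s`, and feasibility together with `up ≤ lo + 2 s` puts `k - lo`
between `0` and `2 s`. So both coded combinations are at most `4 s`, and no subtraction is
truncated. -/
theorem code_mem {s u v i j : ℕ} (hs : 1 ≤ s) (hp : D.Pair i j)
    (hf : D.Feasible s u v i j) :
    D.code s u v i j ∈ Finset.univ ×ˢ (Finset.range (3 * s) ×ˢ Finset.range (5 * s)) := by
  have b1 := up_le_lo_add (s := s) (u := u) (v := v) hp
  obtain ⟨f1, f2⟩ := hf
  have c1 := act_le (D := D) s u v i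
  have c2 := act_le (D := D) s u v j
  unfold code
  split_ifs <;> simp <;> omega

/-! ### Keys as six-digit numbers, and the queue of class representatives. -/

/-- The base of the encodings of tuples of machine words. -/
def M (D : Grid) : ℕ := 4 * (D.n + 1)

noncomputable def key (D : Grid) (s u v i j : ℕ) : ℕ :=
  ((((s * D.M + u) * D.M + v) * D.M + D.act s u v i) * D.M + D.act s u v j) * D.M + D.lo s u v i j

theorem eq_of_base {m a b a' b' : ℕ} (hb : b < m) (hb' : b' < m) (h : a * m + b = a' * m + b') :
    a = a' ∧ b = b' := by
  have h1 : (a * m + b) / m = (a' * m + b') / m := by rw [h]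
  have h2 : (a * m + b) % m = (a' * m + b') % m := by rw [h]
  have hm : 0 < m := by omega
  rw [mul_comm a, mul_comm a', Nat.mul_add_div hm, Nat.mul_add_div hm, Nat.div_eq_of_lt hb,
    Nat.div_eq_of_lt hb'] at h1
  rw [mul_comm a, mul_comm a', Nat.mul_add_mod, Nat.mul_add_mod, Nat.mod_eq_of_lt hb,
    Nat.mod_eq_of_lt hb'] at h2
  exact ⟨by simpa using h1, h2⟩

theorem base_lt {m a b c : ℕ} (hb : b < m) (h : a < c) : a * m + b < c * m := by
  calc a * m + b < a * m + m := by omega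
    _ = (a + 1) * m := by ring
    _ ≤ c * m := Nat.mul_le_mul_right _ h

theorem Node.lt {s u v : ℕ} (h : D.Node s u v) (hs : 1 ≤ s) : v < D.N := by
  have : v * 1 ≤ v * s := Nat.mul_le_mul_left _ hs
  have := h.bound
  omega

theorem act_lt (s u v z : ℕ) : D.act s u v z < D.M := by
  have := act_le_two_mul (D := D) s u v z
  unfold M; omega

theorem lo_lt (s u v i j : ℕ) : D.lo s u v i j < D.M := by
  have := lo_le (D := D) s u v i j
  unfold M; omega

/-- Every digit after the leading `s` is smaller than the base, so the digits can be read off one at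
a time. -/
theorem sameKey_of_key {s u v i j u' v' i' j' : ℕ} (hN : D.N < D.M) (hs : 1 ≤ s)
    (hn : D.Node s u v) (hn' : D.Node s u' v') (h : D.key s u v i j = D.key s u' v' i' j') :
    u = u' ∧ v = v' ∧ D.SameKey s u v i j i' j' := by
  have hv := hn.lt hs
  have hv' := hn'.lt hs
  have hu := hn.le
  have hu' := hn'.le
  unfold key at h
  obtain ⟨h, h1⟩ := eq_of_base (lo_lt ..) (lo_lt ..) h
  obtain ⟨h, h2⟩ := eq_of_base (act_lt ..) (act_lt ..) h
  obtain ⟨h, h3⟩ := eq_of_base (act_lt ..) (act_lt ..) h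
  obtain ⟨h, h4⟩ := eq_of_base (by omega) (by omega) h
  obtain ⟨h, h5⟩ := eq_of_base (by omega) (by omega) h
  subst h4 h5
  exact ⟨rfl, rfl, h3, h2, h1⟩

theorem SameKey.key_eq {s u v i j i' j' : ℕ} (h : D.SameKey s u v i j i' j') :
    D.key s u v i j = D.key s u v i' j' := by
  unfold key
  rw [h.left, h.right, h.lo]

/-- The leading digit separates the levels: with `key_lt`, keys of size `s` stay below those of size
`2 s`. Hence the address array never has to be cleared. -/
theorem le_key (s u v i j : ℕ) : s * D.M ^ 5 ≤ D.key s u v i j := by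
  unfold key
  have h : ∀ {a b : ℕ} (c m : ℕ), a ≤ b → a * m ≤ b * m + c := fun c m hab =>
    (Nat.mul_le_mul_right m hab).trans (Nat.le_add_right _ c)
  calc s * D.M ^ 5 = ((((s * D.M) * D.M) * D.M) * D.M) * D.M := by ring
    _ ≤ _ := h _ _ (h _ _ (h _ _ (h _ _ (h _ _ le_rfl))))

theorem key_lt {s u v i j : ℕ} (hN : D.N < D.M) (hs : 1 ≤ s) (hn : D.Node s u v) :
    D.key s u v i j < (s + 1) * D.M ^ 5 := by
  have hv := hn.lt hs
  have hu := hn.le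
  calc D.key s u v i j < (((((s + 1) * D.M) * D.M) * D.M) * D.M) * D.M :=
        base_lt (lo_lt ..) (base_lt (act_lt ..) (base_lt (act_lt ..)
          (base_lt (by omega) (base_lt (by omega) (by omega)))))
    _ = _ := by ring

/-- The entries `lo, …, tail - 1` of the queue represent the node of size `s`: `H` finds an entry by
its key, and every feasible tuple in `G` is dominated by an entry with the same key. -/
structure Queue (D : Grid) (s lo tail : ℕ) (H U V I J : ℕ → ℕ) (R : ℕ → ℝ)
    (G : Set (ℕ × ℕ × ℕ × ℕ)) : Prop where
  le : lo ≤ tail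
  node : ∀ e, lo ≤ e → e < tail → D.Node s (U e) (V e)
  pair : ∀ e, lo ≤ e → e < tail → D.Pair (I e) (J e)
  feasible : ∀ e, lo ≤ e → e < tail → D.Feasible s (U e) (V e) (I e) (J e)
  val : ∀ e, lo ≤ e → e < tail → R e = D.val s (U e) (V e) (I e) (J e)
  find : ∀ e, lo ≤ e → e < tail → H (D.key s (U e) (V e) (I e) (J e)) = e + 1
  hash : ∀ κ, H κ = 0 ∨ (∃ e, lo ≤ e ∧ e < tail ∧ H κ = e + 1 ∧
    D.key s (U e) (V e) (I e) (J e) = κ) ∨ 2 * s * D.M ^ 5 ≤ κ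
  mem : ∀ u v i j, (u, v, i, j) ∈ G → D.Feasible s u v i j → ∃ e, lo ≤ e ∧ e < tail ∧
    U e = u ∧ V e = v ∧ D.SameKey s u v (I e) (J e) i j ∧ R e ≤ D.val s u v i j

section Queue
variable {s lo tail : ℕ} {H U V I J : ℕ → ℕ} {R : ℕ → ℝ} {G : Set (ℕ × ℕ × ℕ × ℕ)}

/-- An entry is determined by its node and its code, because equal codes give equal keys and `H`
finds only one entry per key. There are at most `(N / s)²` nodes and `2 · 3 s · 5 s = 30 s²` codes.
-/
theorem Queue.length_le (q : D.Queue s lo tail H U V I J R G) (hs : 1 ≤ s) :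
    tail ≤ lo + 30 * D.N ^ 2 := by
  classical
  let T : Finset ((ℕ × ℕ) × (Bool × ℕ × ℕ)) :=
    (Finset.range (D.N / s) ×ˢ Finset.range (D.N / s)) ×ˢ
      (Finset.univ ×ˢ (Finset.range (3 * s) ×ˢ Finset.range (5 * s)))
  have h1 : (Finset.Ico lo tail).card ≤ T.card := by
    refine Finset.card_le_card_of_injOn
      (fun e => ((U e, V e), D.code s (U e) (V e) (I e) (J e))) ?_ ?_
    · intro e he
      obtain ⟨h1, h2⟩ := Finset.mem_Ico.1 (Finset.mem_coe.1 he)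
      have hn := q.node e h1 h2
      have hv : V e + 1 ≤ D.N / s := by
        rw [Nat.le_div_iff_mul_le (by omega)]
        linarith [hn.bound]
      have hu := hn.le
      refine Finset.mem_coe.2 (Finset.mem_product.2 ⟨?_, ?_⟩)
      · simp; omega
      · exact code_mem hs (q.pair e h1 h2) (q.feasible e h1 h2)
    · intro e he e' he' h
      obtain ⟨h1, h2⟩ := Finset.mem_Ico.1 (Finset.mem_coe.1 he)
      obtain ⟨h3, h4⟩ := Finset.mem_Ico.1 (Finset.mem_coe.1 he')
      simp only [Prod.mk.injEq] at h
      obtain ⟨⟨h5, h6⟩, h7⟩ := h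
      have f1 := q.find e h1 h2
      have f2 := q.find e' h3 h4
      have f3 := q.feasible e' h3 h4
      rw [← h5, ← h6] at h7 f2 f3
      have := (sameKey_of_code (q.pair e h1 h2) (q.pair e' h3 h4) (q.node e h1 h2).le
        (q.feasible e h1 h2) f3 h7).key_eq
      rw [this, f2] at f1
      omega
  have h2 : T.card = 30 * (D.N / s * s) ^ 2 := by
    simp only [T, Finset.card_product, Finset.card_range, Finset.card_univ, Fintype.card_bool]
    ring
  have h3 : (D.N / s * s) ^ 2 ≤ D.N ^ 2 := Nat.pow_le_pow_left (Nat.div_mul_le_self _ _) 2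
  rw [Nat.card_Ico, h2] at h1
  omega

/-- A lookup never meets an entry of an earlier level, since those keys are at least `2 s * M ^ 5`.
-/
theorem Queue.hash_key (q : D.Queue s lo tail H U V I J R G) (hN : D.N < D.M) (hs : 1 ≤ s)
    {u v i j : ℕ} (hn : D.Node s u v) :
    H (D.key s u v i j) = 0 ∨ ∃ e, lo ≤ e ∧ e < tail ∧ H (D.key s u v i j) = e + 1 ∧
      U e = u ∧ V e = v ∧ D.SameKey s u v (I e) (J e) i j := by
  rcases q.hash (D.key s u v i j) with h | ⟨e, h1, h2, h3, h4⟩ | h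
  · exact .inl h
  · obtain ⟨h5, h6, h7⟩ := sameKey_of_key hN hs (q.node e h1 h2) hn h4
    rw [h5, h6] at h7
    exact .inr ⟨e, h1, h2, h3, h5, h6, h7⟩
  · have h1 := key_lt (i := i) (j := j) hN hs hn
    have h2 : (s + 1) * D.M ^ 5 ≤ 2 * s * D.M ^ 5 := Nat.mul_le_mul_right _ (by omega)
    omega

theorem Queue.skip (q : D.Queue s lo tail H U V I J R G) {u v i j : ℕ}
    (h : ¬ D.Feasible s u v i j) :
    D.Queue s lo tail H U V I J R (insert (u, v, i, j) G) :=
  { q with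
    mem := by
      rintro u' v' i' j' (hm | hm) hf
      · simp only [Prod.mk.injEq] at hm
        obtain ⟨rfl, rfl, rfl, rfl⟩ := hm
        exact absurd hf h
      · exact q.mem u' v' i' j' hm hf }

theorem Queue.keep (q : D.Queue s lo tail H U V I J R G) {u v i j e : ℕ}
    (h1 : lo ≤ e) (h2 : e < tail) (hu : U e = u) (hv : V e = v)
    (hk : D.SameKey s u v (I e) (J e) i j) (hr : R e ≤ D.val s u v i j) :
    D.Queue s lo tail H U V I J R (insert (u, v, i, j) G) :=
  { q with
    mem := by
      rintro u' v' i' j' (hm | hm) hf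
      · simp only [Prod.mk.injEq] at hm
        obtain ⟨rfl, rfl, rfl, rfl⟩ := hm
        exact ⟨e, h1, h2, hu, hv, hk, hr⟩
      · exact q.mem u' v' i' j' hm hf }

theorem Queue.push (q : D.Queue s lo tail H U V I J R G) {u v i j : ℕ} (hn : D.Node s u v)
    (hp : D.Pair i j) (hf : D.Feasible s u v i j) (hh : H (D.key s u v i j) = 0) :
    D.Queue s lo (tail + 1) (Function.update H (D.key s u v i j) (tail + 1))
      (Function.update U tail u) (Function.update V tail v) (Function.update I tail i)
      (Function.update J tail j) (Function.update R tail (D.val s u v i j))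
      (insert (u, v, i, j) G) := by
  have hle := q.le
  have hcase : ∀ e, e < tail + 1 → e = tail ∨ (e ≠ tail ∧ e < tail) := by omega
  constructor
  · omega
  · intro e h1 h2
    rcases hcase e h2 with rfl | ⟨h3, h4⟩
    · simpa using hn
    · simpa [h3] using q.node e h1 h4
  · intro e h1 h2
    rcases hcase e h2 with rfl | ⟨h3, h4⟩
    · simpa using hp
    · simpa [h3] using q.pair e h1 h4
  · intro e h1 h2
    rcases hcase e h2 with rfl | ⟨h3, h4⟩
    · simpa using hf
    · simpa [h3] using q.feasible e h1 h4
  · intro e h1 h2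
    rcases hcase e h2 with rfl | ⟨h3, h4⟩
    · simp
    · simpa [h3] using q.val e h1 h4
  · intro e h1 h2
    rcases hcase e h2 with rfl | ⟨h3, h4⟩
    · simp
    -- The new key differs from all old ones because its cell was zero, while the cell of an old key
    -- holds a position plus one.
    · have := q.find e h1 h4
      simp only [Function.update_of_ne h3]
      rw [Function.update_of_ne, this]
      intro h
      rw [h, hh] at this
      omega
  · intro κ
    by_cases hκ : κ = D.key s u v i j
    · subst hκ
      exact .inr (.inl ⟨tail, hle, by omega, by simp, by simp⟩)
    · rw [Function.update_of_ne hκ]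
      rcases q.hash κ with h | ⟨e, h1, h2, h3, h4⟩ | h
      · exact .inl h
      · refine .inr (.inl ⟨e, h1, by omega, h3, ?_⟩)
        have : e ≠ tail := by omega
        simpa [this] using h4
      · exact .inr (.inr h)
  · rintro u' v' i' j' (hm | hm) hf'
    · simp only [Prod.mk.injEq] at hm
      obtain ⟨rfl, rfl, rfl, rfl⟩ := hm
      exact ⟨tail, hle, by omega, by simp, by simp, by simpa using ⟨rfl, rfl, rfl⟩, by simp⟩
    · obtain ⟨e, h1, h2, h3, h4, h5, h6⟩ := q.mem u' v' i' j' hm hf'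
      have : e ≠ tail := by omega
      exact ⟨e, h1, by omega, by simpa [this] using h3, by simpa [this] using h4,
        by simpa [this] using h5, by simpa [this] using h6⟩

theorem SameKey.symm {s u v i j i' j' : ℕ} (h : D.SameKey s u v i j i' j') :
    D.SameKey s u v i' j' i j := ⟨h.left.symm, h.right.symm, h.lo.symm⟩

theorem SameKey.trans {s u v i j i' j' i'' j'' : ℕ} (h : D.SameKey s u v i j i' j')
    (h' : D.SameKey s u v i' j' i'' j'') : D.SameKey s u v i j i'' j'' :=
  ⟨h.left.trans h'.left, h.right.trans h'.right, h.lo.trans h'.lo⟩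

theorem Queue.replace (q : D.Queue s lo tail H U V I J R G) {u v i j e : ℕ}
    (hp : D.Pair i j) (hf : D.Feasible s u v i j) (h1 : lo ≤ e) (h2 : e < tail) (hu : U e = u)
    (hv : V e = v) (hk : D.SameKey s u v (I e) (J e) i j) (hr : D.val s u v i j ≤ R e) :
    D.Queue s lo tail H U V (Function.update I e i) (Function.update J e j)
      (Function.update R e (D.val s u v i j)) (insert (u, v, i, j) G) := by
  subst hu hv
  -- The new pair belongs to the class of the old one, so all keys, and hence `H`, stay valid.
  have hkey : ∀ e', D.key s (U e') (V e') (Function.update I e i e') (Function.update J e j e') =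
      D.key s (U e') (V e') (I e') (J e') := by
    intro e'
    by_cases h : e' = e
    · subst h; simpa using hk.symm.key_eq
    · simp [h]
  constructor
  · exact q.le
  · exact q.node
  · intro e' h3 h4
    by_cases h : e' = e
    · subst h; simpa using hp
    · simpa [h] using q.pair e' h3 h4
  · intro e' h3 h4
    by_cases h : e' = e
    · subst h; simpa using hf
    · simpa [h] using q.feasible e' h3 h4
  · intro e' h3 h4
    by_cases h : e' = e
    · subst h; simp
    · simpa [h] using q.val e' h3 h4
  · intro e' h3 h4
    rw [hkey]
    exact q.find e' h3 h4
  · intro κ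
    simp only [hkey]
    exact q.hash κ
  · rintro u' v' i' j' (hm | hm) hf'
    · simp only [Prod.mk.injEq] at hm
      obtain ⟨rfl, rfl, rfl, rfl⟩ := hm
      exact ⟨e, h1, h2, rfl, rfl, by simpa using ⟨rfl, rfl, rfl⟩, by simp⟩
    · obtain ⟨e', h3, h4, h5, h6, h7, h8⟩ := q.mem u' v' i' j' hm hf'
      refine ⟨e', h3, h4, h5, h6, ?_, ?_⟩
      · by_cases h : e' = e
        · subst h h5 h6; simpa using hk.symm.trans h7
        · simpa [h] using h7
      · by_cases h : e' = e
        · subst h; simpa using hr.trans h8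
        · simpa [h] using h8

/-- The new level starts empty at the end of the old one. Cells left over from the old level fall
under the last alternative of `hash`. -/
theorem Queue.next (q : D.Queue (2 * s) lo tail H U V I J R G) :
    D.Queue s tail tail H U V I J R ∅ := by
  refine ⟨le_rfl, ?_, ?_, ?_, ?_, ?_, fun κ => ?_, ?_⟩
  any_goals intros; omega
  · rcases q.hash κ with h | ⟨e, -, -, -, rfl⟩ | h
    · exact .inl h
    · exact .inr (.inr (le_key ..))
    · refine .inr (.inr (le_trans (Nat.mul_le_mul_right _ (by omega)) h))
  · simp

theorem Queue.mono (q : D.Queue s lo tail H U V I J R G) {G' : Set (ℕ × ℕ × ℕ × ℕ)}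
    (h : G' ⊆ G) : D.Queue s lo tail H U V I J R G' :=
  { q with mem := fun u v i j hm hf => q.mem u v i j (h hm) hf }

/-- All tuples at the level `s`. -/
def level (D : Grid) (s : ℕ) : Set (ℕ × ℕ × ℕ × ℕ) :=
  {x | D.Node s x.1 x.2.1 ∧ D.Pair x.2.2.1 x.2.2.2}

/-- The next level is complete when it contains the children of all entries. -/
theorem Queue.complete {s' : ℕ} (q : D.Queue (2 * s) lo tail H U V I J R (D.level (2 * s)))
    {U' V' I' J' : ℕ → ℕ} {R' : ℕ → ℝ} {H' : ℕ → ℕ} {lo' : ℕ}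
    (hN : ∃ c, D.N = c * (2 * s))
    (q' : D.Queue s lo' s' H' U' V' I' J' R' G)
    (hG : ∀ e, lo ≤ e → e < tail → ∀ u v, u / 2 = U e → v / 2 = V e → u ≤ v →
      (u, v, I e, J e) ∈ G) : D.Queue s lo' s' H' U' V' I' J' R' (D.level s) :=
  { q' with
    mem := by
      rintro u v i j ⟨hn, hp⟩ hf
      dsimp only at hn hp
      have hc := Child.half s u v
      have huv : u / 2 ≤ v / 2 := Nat.div_le_div_right hn.le
      have hnode : D.Node (2 * s) (u / 2) (v / 2) := by
        refine ⟨huv, ?_⟩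
        obtain ⟨c, hcN⟩ := hN
        have h1 := hc.le_right
        have h2 := hn.bound
        rcases Nat.eq_zero_or_pos s with rfl | hs
        · simp
        · have h3 : v / 2 * (2 * s) < c * (2 * s) := by rw [← hcN]; omega
          have h4 := lt_of_mul_lt_mul_right h3 (Nat.zero_le _)
          rw [hcN]
          calc v / 2 * (2 * s) + 2 * s = (v / 2 + 1) * (2 * s) := by ring
            _ ≤ c * (2 * s) := Nat.mul_le_mul_right _ h4
      -- Domination is transported through the parent: an entry dominates the parent tuple, its
      -- child has the same key and no larger `val`, and that child is dominated by an entry of the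
      -- new level.
      obtain ⟨e, h1, h2, h3, h4, h5, h6⟩ := q.mem (u / 2) (v / 2) i j ⟨hnode, hp⟩
        (hf.parent hp hc)
      have hpe := q.pair e h1 h2
      obtain ⟨h7, h8, h9, -⟩ := h5.child hpe hp huv hc
      have hfe : D.Feasible s u v (I e) (J e) := by
        unfold Feasible
        rw [h7.lo, h8]
        exact hf
      obtain ⟨e', g1, g2, g3, g4, g5, g6⟩ := q'.mem u v (I e) (J e)
        (hG e h1 h2 u v h3.symm h4.symm hn.le) hfe
      refine ⟨e', g1, g2, g3, g4, g5.trans h7, g6.trans ?_⟩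
      have h10 := q.val e h1 h2
      rw [h3, h4] at h10
      linarith }

end Queue
end Grid
end MinWeightRect

/-! ### Evaluating counts, weights and keys on the machine. -/

namespace MinWeightRect
open RealRAM
namespace Grid
variable {D : Grid}

/-- The word bound `B` is large enough for the grid `D`. -/
structure Fits (D : Grid) (B : ℕ) : Prop where
  base : D.M ^ 6 ≤ B
  k : D.k ≤ B
  N : D.N < D.M

/-- The memory holds the parameters of the grid and the tables of its prefix sums. -/
structure Env (D : Grid) (st : State) : Prop where
  n : st.word 0 0 = D.n
  k : st.word 0 1 = D.k
  N : st.word 2 0 = D.N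
  M : st.word 7 0 = D.M
  table : ∀ z < 2 * D.n, ∀ d ≤ D.N, st.word 6 (z * D.M + d) = D.cnt z d
  weights : ∀ z < 2 * D.n, ∀ d ≤ D.N, st.real 7 (z * D.M + d) = D.cw z d
  X : st.real 4 = D.X

theorem Env.congr {st st' : State} (h : D.Env st) (h0 : st'.word 0 = st.word 0)
    (h2 : st'.word 2 = st.word 2) (h7 : st'.word 7 = st.word 7) (h6 : st'.word 6 = st.word 6)
    (hr7 : st'.real 7 = st.real 7) (hr4 : st'.real 4 = st.real 4) : D.Env st' := by
  obtain ⟨a, b, c, d, e, f, g⟩ := h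
  constructor <;> simpa only [h0, h2, h6, h7, hr7, hr4]

theorem Env.frame {st st' : State} {P : Program} (h : D.Env st) (hf : Frame P st st')
    (h0 : 0 ∉ P.wordMods ∧ 2 ∉ P.wordMods ∧ 7 ∉ P.wordMods ∧ 6 ∉ P.wordMods)
    (h1 : 7 ∉ P.realMods ∧ 4 ∉ P.realMods) : D.Env st' :=
  h.congr (hf.word _ h0.1) (hf.word _ h0.2.1) (hf.word _ h0.2.2.1) (hf.word _ h0.2.2.2)
    (hf.real _ h1.1) (hf.real _ h1.2)

theorem Fits.pow_le {B : ℕ} (h : D.Fits B) {t : ℕ} (ht : t ≤ 6) : D.M ^ t ≤ B :=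
  (Nat.pow_le_pow_right (by unfold M; omega) ht).trans h.base

theorem Fits.M_le {B : ℕ} (h : D.Fits B) : D.M ≤ B := by simpa using h.pow_le (t := 1) (by omega)

theorem Fits.four_le {B : ℕ} (h : D.Fits B) : 4 ≤ B := by
  have := h.M_le
  unfold M at this; omega

theorem Fits.N_le {B : ℕ} (h : D.Fits B) : D.N ≤ B := h.N.le.trans h.M_le

theorem Fits.two_n_le {B : ℕ} (h : D.Fits B) : 2 * D.n ≤ B := by
  have := h.M_le
  unfold M at this; omega

/-- Appending a digit keeps a number with at most six digits within the word bound. -/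
theorem Fits.step {B t x c : ℕ} (h : D.Fits B) (ht : t < 6) (hx : x < D.M ^ t) (hc : c < D.M) :
    x * D.M ≤ B ∧ x * D.M + c ≤ B ∧ x * D.M + c < D.M ^ (t + 1) := by
  have h1 := base_lt hc hx
  rw [← pow_succ] at h1
  have h2 := h.pow_le (t := t + 1) (by omega)
  omega

/-- The entry of the table of numbers of points for a cut and a row. -/
def tableE (z d : WExpr) : WExpr := .get 6 (.add (.mul z (var 7)) d)

def weightE (z d : WExpr) : RExpr := .get 7 (.add (.mul z (var 7)) d)

theorem index_ok {B : ℕ} {st : State} (hB : D.Fits B) (hE : D.Env st) {z d : WExpr}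
    (hz : z.Ok B st) (hd : d.Ok B st) (hz' : z.eval st < 2 * D.n) (hd' : d.eval st ≤ D.N) :
    (WExpr.add (.mul z (var 7)) d).Ok B st := by
  have h : z.eval st < D.M ^ 1 := by rw [pow_one]; unfold M; omega
  obtain ⟨h1, h2, -⟩ := hB.step (by omega) h (hd'.trans_lt hB.N)
  simp [WExpr.Ok, WExpr.eval, hE.M, hz, hd, h1, h2, hB.M_le]

theorem tableE_ok {B : ℕ} {st : State} (hB : D.Fits B) (hE : D.Env st) {z d : WExpr}
    (hz : z.Ok B st) (hd : d.Ok B st) (hz' : z.eval st < 2 * D.n) (hd' : d.eval st ≤ D.N) :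
    (tableE z d).Ok B st ∧ (tableE z d).eval st = D.cnt (z.eval st) (d.eval st) := by
  have h1 := hE.table _ hz' _ hd'
  have h2 := index_ok hB hE hz hd hz' hd'
  have h3 : (tableE z d).eval st = D.cnt (z.eval st) (d.eval st) := by
    simp [tableE, WExpr.eval, hE.M, h1]
  refine ⟨⟨h2, ?_⟩, h3⟩
  have h4 := cnt_le (D := D) (z.eval st) (d.eval st)
  have h5 := hB.two_n_le
  simp only [tableE, WExpr.eval] at h3 ⊢
  omega

theorem weightE_ok {B : ℕ} {st : State} (hB : D.Fits B) (hE : D.Env st) {z d : WExpr}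
    (hz : z.Ok B st) (hd : d.Ok B st) (hz' : z.eval st < 2 * D.n) (hd' : d.eval st ≤ D.N) :
    (weightE z d).Ok B st ∧ (weightE z d).eval st = D.cw (z.eval st) (d.eval st) := by
  have h1 := hE.weights _ hz' _ hd'
  exact ⟨index_ok hB hE hz hd hz' hd', by simp [weightE, RExpr.eval, WExpr.eval, hE.M, h1]⟩

/-- The variables that describe a node and a pair of cuts. -/
structure Args (s u v i j : ℕ) (st : State) : Prop where
  s : st.word 16 0 = s
  u : st.word 17 0 = u
  v : st.word 18 0 = v
  i : st.word 19 0 = i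
  j : st.word 20 0 = j

theorem Args.congr {s u v i j : ℕ} {st st' : State} (h : Args s u v i j st)
    (h16 : st'.word 16 = st.word 16) (h17 : st'.word 17 = st.word 17)
    (h18 : st'.word 18 = st.word 18) (h19 : st'.word 19 = st.word 19)
    (h20 : st'.word 20 = st.word 20) : Args s u v i j st' := by
  obtain ⟨a, b, c, d, e⟩ := h
  constructor <;> simpa only [h16, h17, h18, h19, h20]

/-- The first row of the block stored in the variable `a`. -/
def bot (a : ℕ) : WExpr := .mul (var a) (var 16)

/-- The row after the last row of the block stored in the variable `a`. -/
def top (a : ℕ) : WExpr := .add (bot a) (var 16)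

/-- The assumptions under which a node and a pair of cuts are processed. -/
structure Ready (D : Grid) (B s u v i j : ℕ) (st : State) : Prop where
  fits : D.Fits B
  env : D.Env st
  args : Args s u v i j st
  pos : 1 ≤ s
  node : D.Node s u v
  pair : D.Pair i j

section Ready
variable {B s u v i j : ℕ} {st : State}

theorem Ready.u_bound (h : D.Ready B s u v i j st) : u * s + s ≤ D.N := by
  have := Nat.mul_le_mul_right s h.node.le
  have := h.node.bound
  omega

theorem Ready.s_le (h : D.Ready B s u v i j st) : s ≤ D.N := by
  have := h.node.bound
  omega

theorem Ready.u_lt (h : D.Ready B s u v i j st) : u < D.N :=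
  h.node.le.trans_lt (h.node.lt h.pos)

theorem Ready.rows (h : D.Ready B s u v i j st) :
    ((bot 17).Ok B st ∧ (bot 17).eval st = u * s ∧ (bot 17).eval st ≤ D.N) ∧
    ((top 17).Ok B st ∧ (top 17).eval st = u * s + s ∧ (top 17).eval st ≤ D.N) ∧
    ((bot 18).Ok B st ∧ (bot 18).eval st = v * s ∧ (bot 18).eval st ≤ D.N) ∧
    ((top 18).Ok B st ∧ (top 18).eval st = v * s + s ∧ (top 18).eval st ≤ D.N) := by
  have h1 := h.u_bound
  have h2 := h.node.bound
  have h3 := h.u_lt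
  have h4 := h.node.lt h.pos
  have h5 := h.s_le
  have h6 := h.fits.N_le
  simp only [bot, top, WExpr.Ok, WExpr.eval, h.args.s, h.args.u, h.args.v]
  refine ⟨⟨?_, trivial, ?_⟩, ⟨?_, trivial, ?_⟩, ⟨?_, trivial, ?_⟩, ⟨?_, trivial, ?_⟩⟩ <;> omega

theorem Ready.cut (h : D.Ready B s u v i j st) :
    ((var 19).Ok B st ∧ (var 19).eval st = i ∧ (var 19).eval st < 2 * D.n) ∧
    ((var 20).Ok B st ∧ (var 20).eval st = j ∧ (var 20).eval st < 2 * D.n) := by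
  have h1 := h.pair.left
  have h2 := h.pair.lt
  have h3 := h.fits.two_n_le
  simp only [WExpr.Ok, WExpr.eval, h.args.i, h.args.j, true_and]
  omega

/-- The number of points between the two cuts below a row. -/
def winE (d : WExpr) : WExpr := .sub (tableE (var 20) d) (tableE (var 19) d)

def wwinE (d : WExpr) : RExpr := .sub (weightE (var 20) d) (weightE (var 19) d)

theorem Ready.winE_ok (h : D.Ready B s u v i j st) {d : WExpr} (hd : d.Ok B st)
    (hd' : d.eval st ≤ D.N) :
    (winE d).Ok B st ∧ (winE d).eval st = D.win i j (d.eval st) := by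
  obtain ⟨⟨h1, h2, h3⟩, h4, h5, h6⟩ := h.cut
  have h7 := tableE_ok h.fits h.env h1 hd h3 hd'
  have h8 := tableE_ok h.fits h.env h4 hd h6 hd'
  rw [h2] at h7
  rw [h5] at h8
  exact ⟨⟨h8.1, h7.1⟩, by simp only [winE, WExpr.eval, h7.2, h8.2, win]⟩

theorem Ready.wwinE_ok (h : D.Ready B s u v i j st) {d : WExpr} (hd : d.Ok B st)
    (hd' : d.eval st ≤ D.N) :
    (wwinE d).Ok B st ∧ (wwinE d).eval st = D.wwin i j (d.eval st) := by
  obtain ⟨⟨h1, h2, h3⟩, h4, h5, h6⟩ := h.cut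
  have h7 := weightE_ok h.fits h.env h1 hd h3 hd'
  have h8 := weightE_ok h.fits h.env h4 hd h6 hd'
  rw [h2] at h7
  rw [h5] at h8
  exact ⟨⟨h8.1, h7.1⟩, by simp only [wwinE, RExpr.eval, h7.2, h8.2, wwin]⟩

def actE (z : WExpr) : WExpr :=
  .add (.sub (tableE z (top 17)) (tableE z (bot 17))) (.sub (tableE z (top 18)) (tableE z (bot 18)))

theorem Ready.actE_ok (h : D.Ready B s u v i j st) {z : WExpr} (hz : z.Ok B st)
    (hz' : z.eval st < 2 * D.n) :
    (actE z).Ok B st ∧ (actE z).eval st = D.act s u v (z.eval st) := by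
  obtain ⟨⟨a1, a2, a3⟩, ⟨b1, b2, b3⟩, ⟨c1, c2, c3⟩, ⟨d1, d2, d3⟩⟩ := h.rows
  have ha := tableE_ok h.fits h.env hz a1 hz' a3
  have hb := tableE_ok h.fits h.env hz b1 hz' b3
  have hc := tableE_ok h.fits h.env hz c1 hz' c3
  have hd := tableE_ok h.fits h.env hz d1 hz' d3
  rw [a2] at ha
  rw [b2] at hb
  rw [c2] at hc
  rw [d2] at hd
  have h1 := act_le_two_mul (D := D) s u v (z.eval st)
  have h2 := h.fits.two_n_le
  unfold act at h1
  refine ⟨⟨⟨hb.1, ha.1⟩, ⟨hd.1, hc.1⟩, ?_⟩, ?_⟩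
  · simp only [WExpr.eval, ha.2, hb.2, hc.2, hd.2]
    omega
  · simp only [actE, WExpr.eval, ha.2, hb.2, hc.2, hd.2, act]

def loE : WExpr := .sub (winE (bot 18)) (winE (top 17))

def upE : WExpr := .sub (winE (top 18)) (winE (bot 17))

def valE : RExpr := .sub (wwinE (bot 18)) (wwinE (top 17))

def totE : RExpr := .sub (wwinE (top 18)) (wwinE (bot 17))

theorem Ready.loE_ok (h : D.Ready B s u v i j st) :
    loE.Ok B st ∧ loE.eval st = D.lo s u v i j := by
  obtain ⟨-, ⟨b1, b2, b3⟩, ⟨c1, c2, c3⟩, -⟩ := h.rows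
  have hb := h.winE_ok b1 b3
  have hc := h.winE_ok c1 c3
  exact ⟨⟨hc.1, hb.1⟩, by simp only [loE, WExpr.eval, hb.2, hc.2, b2, c2, lo]⟩

theorem Ready.upE_ok (h : D.Ready B s u v i j st) :
    upE.Ok B st ∧ upE.eval st = D.up s u v i j := by
  obtain ⟨⟨b1, b2, b3⟩, -, -, ⟨c1, c2, c3⟩⟩ := h.rows
  have hb := h.winE_ok b1 b3
  have hc := h.winE_ok c1 c3
  exact ⟨⟨hc.1, hb.1⟩, by simp only [upE, WExpr.eval, hb.2, hc.2, b2, c2, up]⟩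

theorem Ready.valE_ok (h : D.Ready B s u v i j st) :
    valE.Ok B st ∧ valE.eval st = D.val s u v i j := by
  obtain ⟨-, ⟨b1, b2, b3⟩, ⟨c1, c2, c3⟩, -⟩ := h.rows
  have hb := h.wwinE_ok b1 b3
  have hc := h.wwinE_ok c1 c3
  exact ⟨⟨hc.1, hb.1⟩, by simp only [valE, RExpr.eval, hb.2, hc.2, b2, c2, val]⟩

theorem Ready.totE_ok (h : D.Ready B s u v i j st) :
    totE.Ok B st ∧ totE.eval st = D.tot s u v i j := by
  obtain ⟨⟨b1, b2, b3⟩, -, -, ⟨c1, c2, c3⟩⟩ := h.rows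
  have hb := h.wwinE_ok b1 b3
  have hc := h.wwinE_ok c1 c3
  exact ⟨⟨hc.1, hb.1⟩, by simp only [totE, RExpr.eval, hb.2, hc.2, b2, c2, tot]⟩

/-- One step of the evaluation of a key. -/
def digitE (e : WExpr) (a : ℕ) : WExpr := .add (.mul e (var 7)) (var a)

def keyE : WExpr :=
  digitE (digitE (digitE (digitE (digitE (var 16) 17) 18) 21) 22) 23

theorem digitE_ok (hB : D.Fits B) (hE : D.Env st) {e : WExpr} {a t : ℕ} (ht : t < 6)
    (he : e.Ok B st) (he' : e.eval st < D.M ^ t) (ha : st.word a 0 < D.M) :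
    (digitE e a).Ok B st ∧ (digitE e a).eval st = e.eval st * D.M + st.word a 0 ∧
      (digitE e a).eval st < D.M ^ (t + 1) := by
  obtain ⟨h1, h2, h3⟩ := hB.step ht he' ha
  have h4 := hB.M_le
  simp only [digitE, WExpr.Ok, WExpr.eval, hE.M]
  refine ⟨⟨⟨he, ⟨by omega, h4⟩, h1⟩, ⟨by omega, by omega⟩, h2⟩, trivial, h3⟩

theorem Ready.keyE_ok (h : D.Ready B s u v i j st) (ha : st.word 21 0 = D.act s u v i)
    (hb : st.word 22 0 = D.act s u v j) (hc : st.word 23 0 = D.lo s u v i j) :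
    keyE.Ok B st ∧ keyE.eval st = D.key s u v i j := by
  have hN := h.fits.N
  have hu := h.u_lt
  have hv := h.node.lt h.pos
  have hs := h.s_le
  have hM := h.fits.M_le
  have e0 : (var 16).Ok B st ∧ (var 16).eval st = s := by
    simp only [WExpr.Ok, WExpr.eval, h.args.s, and_true]
    omega
  obtain ⟨o1, e1, l1⟩ := digitE_ok (a := 17) (t := 1) h.fits h.env (by omega) e0.1
    (by rw [e0.2, pow_one]; omega) (by rw [h.args.u]; omega)
  obtain ⟨o2, e2, l2⟩ := digitE_ok (a := 18) h.fits h.env (by omega) o1 l1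
    (by rw [h.args.v]; omega)
  obtain ⟨o3, e3, l3⟩ := digitE_ok (a := 21) h.fits h.env (by omega) o2 l2
    (by rw [ha]; exact act_lt ..)
  obtain ⟨o4, e4, l4⟩ := digitE_ok (a := 22) h.fits h.env (by omega) o3 l3
    (by rw [hb]; exact act_lt ..)
  obtain ⟨o5, e5, l5⟩ := digitE_ok (a := 23) h.fits h.env (by omega) o4 l4
    (by rw [hc]; exact lo_lt ..)
  refine ⟨o5, ?_⟩
  unfold keyE key
  rw [e5, e4, e3, e2, e1, e0.2, h.args.u, h.args.v, ha, hb, hc]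

theorem Ready.congr (h : D.Ready B s u v i j st) {st' : State} (hE : D.Env st')
    (hA : Args s u v i j st') : D.Ready B s u v i j st' :=
  { h with env := hE, args := hA }

/-- Compute the key, the bounds and the value of a node and a pair of cuts. -/
def measureP : Program :=
  .seq (assign 21 (actE (var 19))) <| .seq (assign 22 (actE (var 20))) <|
  .seq (assign 23 loE) <| .seq (assign 24 upE) <| .setReal 10 (.const 0) valE

theorem Ready.runs_measure (h : D.Ready B s u v i j st) :
    Runs B measureP st measureP.maxCost fun st' => D.Ready B s u v i j st' ∧
      st'.word 21 0 = D.act s u v i ∧ st'.word 22 0 = D.act s u v j ∧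
      st'.word 23 0 = D.lo s u v i j ∧ st'.word 24 0 = D.up s u v i j ∧
      st'.real 10 0 = D.val s u v i j := by
  have h1 := h.cut.1
  have a1 := h.actE_ok h1.1 h1.2.2
  rw [h1.2.1] at a1
  have r1 : D.Ready B s u v i j (st.setWord 21 0 (D.act s u v i)) :=
    h.congr (h.env.congr (by simp) (by simp) (by simp) (by simp) (by simp) (by simp))
      (h.args.congr (by simp) (by simp) (by simp) (by simp) (by simp))
  have h2 := r1.cut.2
  have a2 := r1.actE_ok h2.1 h2.2.2
  rw [h2.2.1] at a2
  have r2 : D.Ready B s u v i j ((st.setWord 21 0 (D.act s u v i)).setWord 22 0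
      (D.act s u v j)) :=
    h.congr (h.env.congr (by simp) (by simp) (by simp) (by simp) (by simp) (by simp))
      (h.args.congr (by simp) (by simp) (by simp) (by simp) (by simp))
  have a3 := r2.loE_ok
  have r3 : D.Ready B s u v i j (((st.setWord 21 0 (D.act s u v i)).setWord 22 0
      (D.act s u v j)).setWord 23 0 (D.lo s u v i j)) :=
    h.congr (h.env.congr (by simp) (by simp) (by simp) (by simp) (by simp) (by simp))
      (h.args.congr (by simp) (by simp) (by simp) (by simp) (by simp))
  have a4 := r3.upE_ok
  have r4 : D.Ready B s u v i j ((((st.setWord 21 0 (D.act s u v i)).setWord 22 0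
      (D.act s u v j)).setWord 23 0 (D.lo s u v i j)).setWord 24 0 (D.up s u v i j)) :=
    h.congr (h.env.congr (by simp) (by simp) (by simp) (by simp) (by simp) (by simp))
      (h.args.congr (by simp) (by simp) (by simp) (by simp) (by simp))
  have a5 := r4.valE_ok
  refine Runs.of_wp ?_
  refine ⟨Nat.zero_le _, a1.1, ?_⟩
  rw [a1.2]
  refine ⟨Nat.zero_le _, a2.1, ?_⟩
  simp only [WExpr.eval] at a2 ⊢
  rw [a2.2]
  refine ⟨Nat.zero_le _, a3.1, ?_⟩
  simp only [WExpr.eval]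
  rw [a3.2]
  refine ⟨Nat.zero_le _, a4.1, ?_⟩
  simp only [WExpr.eval]
  rw [a4.2]
  refine ⟨Nat.zero_le _, a5.1, ?_⟩
  simp only [WExpr.eval]
  rw [a5.2]
  refine ⟨h.congr (h.env.congr (by simp) (by simp) (by simp) (by simp) (by simp) (by simp))
      (h.args.congr (by simp) (by simp) (by simp) (by simp) (by simp)), ?_, ?_, ?_, ?_, ?_⟩ <;>
    simp

end Ready
end Grid
end MinWeightRect

/-! ### Inserting a tuple into the queue. -/

namespace MinWeightRect
open RealRAM
namespace Grid
variable {D : Grid}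

/-- The queue stored in the memory. -/
def QueueAt (D : Grid) (s lo : ℕ) (G : Set (ℕ × ℕ × ℕ × ℕ)) (st : State) : Prop :=
  D.Queue s lo (st.word 13 0) (st.word 12) (st.word 8) (st.word 9) (st.word 10) (st.word 11)
    (st.real 8) G

/-- The entries of the queue before the position `lo` agree. -/
structure Prefix (lo : ℕ) (st st' : State) : Prop where
  U : ∀ e < lo, st'.word 8 e = st.word 8 e
  V : ∀ e < lo, st'.word 9 e = st.word 9 e
  I : ∀ e < lo, st'.word 10 e = st.word 10 e
  J : ∀ e < lo, st'.word 11 e = st.word 11 e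

theorem Prefix.refl (lo : ℕ) (st : State) : Prefix lo st st :=
  ⟨fun _ _ => rfl, fun _ _ => rfl, fun _ _ => rfl, fun _ _ => rfl⟩

theorem Prefix.trans {lo : ℕ} {st st' st'' : State} (h : Prefix lo st st')
    (h' : Prefix lo st' st'') : Prefix lo st st'' :=
  ⟨fun e he => (h'.U e he).trans (h.U e he), fun e he => (h'.V e he).trans (h.V e he),
    fun e he => (h'.I e he).trans (h.I e he), fun e he => (h'.J e he).trans (h.J e he)⟩

/-- Append a new entry to the queue. -/
def pushP : Program :=
  .seq (.setWord 12 (var 25) (.add (var 13) (.const 1))) <|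
  .seq (.setWord 8 (var 13) (var 17)) <| .seq (.setWord 9 (var 13) (var 18)) <|
  .seq (.setWord 10 (var 13) (var 19)) <| .seq (.setWord 11 (var 13) (var 20)) <|
  .seq (.setReal 8 (var 13) (.get 10 (.const 0))) (incr 13)

/-- Replace the pair of an entry by a better one. -/
def replaceP : Program :=
  .seq (assign 26 (.sub (.get 12 (var 25)) (.const 1))) <|
  .ite (.realLt (.get 10 (.const 0)) (.get 8 (var 26)))
    (.seq (.setWord 10 (var 26) (var 19)) <| .seq (.setWord 11 (var 26) (var 20))
      (.setReal 8 (var 26) (.get 10 (.const 0)))) .skip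

/-- Insert a node and a pair of cuts into the queue. -/
def insertP : Program :=
  .seq measureP <|
  .ite (.and (.not (.wordLt (.get 0 (.const 1)) (var 23)))
      (.not (.wordLt (var 24) (.get 0 (.const 1)))))
    (.seq (assign 25 keyE) <| .ite (.wordEq (.get 12 (var 25)) (.const 0)) pushP replaceP) .skip

/-- Four outcomes match four operations on the abstract queue: an infeasible tuple is skipped, a new
class is appended, and in a known class the representative of smaller `val` wins. Word arrays
`8`–`11` hold the tuples, `12` the addresses by key and `13` the tail; real array `8` holds the
values. Only positions from `lo` on are written, so the previous level remains readable. -/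
theorem Ready.runs_insertP {B s u v i j lo : ℕ} {G : Set (ℕ × ℕ × ℕ × ℕ)} {st : State}
    (h : D.Ready B s u v i j st) (hlo : lo + 30 * D.N ^ 2 < B) (hq : D.QueueAt s lo G st) :
    Runs B insertP st insertP.maxCost fun st' =>
      D.QueueAt s lo (insert (u, v, i, j) G) st' ∧ Prefix lo st st' := by
  refine h.runs_measure.seq ?_
  rintro st₁ hf ⟨h, ha, hb, hc, hd, hr⟩
  have hw : ∀ a, a ∉ measureP.wordMods → st₁.word a = st.word a := hf.word
  have hq : D.QueueAt s lo G st₁ := by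
    unfold QueueAt
    rw [hw 13 (by decide), hw 12 (by decide), hw 8 (by decide), hw 9 (by decide),
      hw 10 (by decide), hw 11 (by decide), hf.real 8 (by decide)]
    exact hq
  have hpre : Prefix lo st st₁ :=
    ⟨fun e _ => by rw [hw 8 (by decide)], fun e _ => by rw [hw 9 (by decide)],
      fun e _ => by rw [hw 10 (by decide)], fun e _ => by rw [hw 11 (by decide)]⟩
  suffices hs : Runs B _ st₁ _ fun st' =>
      D.QueueAt s lo (insert (u, v, i, j) G) st' ∧ Prefix lo st₁ st' from
    hs.mono le_rfl fun _ _ hs => ⟨hs.1, hpre.trans hs.2⟩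
  clear hpre hw hf
  have b1 := D.lo_le s u v i j
  have b2 := D.up_le s u v i j
  have b3 := h.fits.two_n_le
  have b4 := h.fits.four_le
  have b5 := h.fits.k
  have b6 := h.env.k
  refine Runs.of_wp ⟨?_, fun hh => ?_, fun hh => ?_⟩
  · simp only [Test.Ok, WExpr.Ok, WExpr.eval, hc, hd, b6]
    omega
  · simp only [Test.Holds, WExpr.eval, hc, hd, b6, not_lt] at hh
    have hfeas : D.Feasible s u v i j := hh
    obtain ⟨hk, hk'⟩ := h.keyE_ok ha hb hc
    refine ⟨Nat.zero_le _, hk, ?_⟩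
    rw [hk']
    -- Since `s < M`, the whole key has six digits in base `M`.
    have hkey : D.key s u v i j < B :=
      (key_lt h.fits.N h.pos h.node).trans_le (le_trans (by
        calc (s + 1) * D.M ^ 5 ≤ D.M * D.M ^ 5 :=
              Nat.mul_le_mul_right _ (h.s_le.trans_lt h.fits.N)
          _ = D.M ^ 6 := by ring) h.fits.base)
    have htail := hq.length_le h.pos
    have hu := h.u_lt
    have hv := h.node.lt h.pos
    have hN := h.fits.N_le
    have hi := h.pair.left
    have hj := h.pair.lt
    obtain ⟨-, e2, e3, e4, e5⟩ := h.args
    have t1 : st₁.word 13 0 < B := by omega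
    have t2 : st₁.word 13 0 ≤ B := by omega
    have t3 : u ≤ B := by omega
    have t4 : v ≤ B := by omega
    have t5 : i ≤ B := by omega
    have t6 : j ≤ B := by omega
    have t7 : D.key s u v i j ≤ B := by omega
    have t8 : 1 ≤ B := by omega
    have hcase := hq.hash_key h.fits.N h.pos (i := i) (j := j) h.node
    refine ⟨?_, fun hz => ?_, fun hz => ?_⟩
    · simp [Test.Ok, WExpr.Ok, WExpr.eval]
      omega
    · simp [Test.Holds, WExpr.eval] at hz
      have hnew := hq.push h.node h.pair hfeas hz
      simp [pushP, Program.wp, WExpr.Ok, WExpr.eval, RExpr.Ok, RExpr.eval, e2, e3, e4, e5, hr,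
        t1, t2, t3, t4, t5, t6, t7, t8]
      constructor
      · simpa [QueueAt] using hnew
      · have hle := hq.le
        constructor <;> intro e he <;>
          simp [Function.update_of_ne (show e ≠ st₁.word 13 0 by omega)]
    · simp [Test.Holds, WExpr.eval] at hz
      obtain ⟨e, h1, h2, h3, h4, h5, h6⟩ := hcase.resolve_left hz
      simp [replaceP, Program.wp, WExpr.Ok, WExpr.eval, RExpr.Ok, RExpr.eval, Test.Ok,
        Test.Holds, e4, e5, hr, h3, t5, t6, t7, t8, show e ≤ B by omega, show e < B by omega]
      refine ⟨fun hlt => ?_, fun hge => ?_⟩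
      · refine ⟨?_, ?_⟩
        · simpa [QueueAt] using hq.replace h.pair hfeas h1 h2 h4 h5 h6 hlt.le
        · constructor <;> intro e' he <;>
            simp [Function.update_of_ne (show e' ≠ e by omega)]
      · refine ⟨?_, ?_⟩
        · simpa [QueueAt] using hq.keep h1 h2 h4 h5 h6 hge
        · constructor <;> intro e' he <;> simp
  · simp only [Test.Holds, WExpr.eval, hc, hd, b6, not_lt] at hh
    exact ⟨hq.skip hh, Prefix.refl _ _⟩

end Grid
end MinWeightRect

/-! ### Inserting the children of an entry. -/

namespace MinWeightRect
open RealRAM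
namespace Grid
variable {D : Grid}

theorem QueueAt.congr {s lo : ℕ} {G : Set (ℕ × ℕ × ℕ × ℕ)} {st st' : State}
    (h : D.QueueAt s lo G st) (h13 : st'.word 13 = st.word 13) (h12 : st'.word 12 = st.word 12)
    (h8 : st'.word 8 = st.word 8) (h9 : st'.word 9 = st.word 9) (h10 : st'.word 10 = st.word 10)
    (h11 : st'.word 11 = st.word 11) (hr : st'.real 8 = st.real 8) : D.QueueAt s lo G st' := by
  unfold QueueAt
  rw [h13, h12, h8, h9, h10, h11, hr]
  exact h

/-- Load the entry at the head of the queue, with the blocks `2 u + g`, `2 v + h`. -/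
def fetchP (g h : ℕ) : Program :=
  .seq (assign 17 (.add (.mul (.const 2) (.get 8 (var 14))) (.const g))) <|
  .seq (assign 18 (.add (.mul (.const 2) (.get 9 (var 14))) (.const h))) <|
  .seq (assign 19 (.get 10 (var 14))) (assign 20 (.get 11 (var 14)))

/-- Insert the child of the entry at the head of the queue in the blocks `2 u + g`, `2 v + h`. -/
def childP (g h : ℕ) : Program :=
  .seq (fetchP g h) (.ite (.wordLt (var 18) (var 17)) .skip insertP)

/-- The head of the queue is the entry `e` of the previous level. -/
structure Parent (D : Grid) (B s lo e u v i j : ℕ) (st : State) : Prop where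
  fits : D.Fits B
  env : D.Env st
  pos : 1 ≤ s
  node : D.Node (2 * s) u v
  pair : D.Pair i j
  size : st.word 16 0 = s
  head : st.word 14 0 = e
  lt : e < lo
  bound : lo + 30 * D.N ^ 2 < B
  u : st.word 8 e = u
  v : st.word 9 e = v
  i : st.word 10 e = i
  j : st.word 11 e = j

theorem Node.half {s u v g h : ℕ} (hn : D.Node (2 * s) u v) (hh : h ≤ 1)
    (hle : 2 * u + g ≤ 2 * v + h) : D.Node s (2 * u + g) (2 * v + h) := by
  refine ⟨hle, ?_⟩
  have h1 := hn.bound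
  have h2 : (2 * v + h) * s ≤ (2 * v + 1) * s := Nat.mul_le_mul_right _ (by omega)
  have h3 : (2 * v + 1) * s + s = v * (2 * s) + 2 * s := by ring
  omega

theorem Parent.runs_childP {B s lo e u v i j g h : ℕ} {G : Set (ℕ × ℕ × ℕ × ℕ)} {st : State}
    (p : D.Parent B s lo e u v i j st) (hq : D.QueueAt s lo G st) (hg : g ≤ 1) (hh : h ≤ 1) :
    Runs B (childP g h) st (childP g h).maxCost fun st' => D.Parent B s lo e u v i j st' ∧
      Prefix lo st st' ∧ ∃ G', G ⊆ G' ∧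
        (2 * u + g ≤ 2 * v + h → (2 * u + g, 2 * v + h, i, j) ∈ G') ∧ D.QueueAt s lo G' st' := by
  suffices hs : Runs B (childP g h) st (childP g h).maxCost fun st' =>
      Prefix lo st st' ∧ ∃ G', G ⊆ G' ∧
        (2 * u + g ≤ 2 * v + h → (2 * u + g, 2 * v + h, i, j) ∈ G') ∧ D.QueueAt s lo G' st' by
    refine hs.mono le_rfl fun st' hf hs => ⟨?_, hs⟩
    -- The modified arrays do not depend on `g` and `h`. With closed arguments `decide` can evaluate
    -- them.
    replace hf : Frame (childP 0 0) st st' := ⟨hf.word, hf.real⟩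
    have hp := hs.1
    exact
      { fits := p.fits
        env := p.env.frame hf (by decide) (by decide)
        pos := p.pos
        size := by rw [hf.word 16 (by decide), p.size]
        head := by rw [hf.word 14 (by decide), p.head]
        lt := p.lt
        bound := p.bound
        u := by rw [hp.U e p.lt, p.u]
        v := by rw [hp.V e p.lt, p.v]
        i := by rw [hp.I e p.lt, p.i]
        j := by rw [hp.J e p.lt, p.j]
        node := p.node
        pair := p.pair }
  have hv : 2 * v + 2 ≤ D.N := by
    have := p.node.bound
    have h1 := p.pos
    -- This gives `2 v + 2 ≤ N`, so the block numbers of the children fit into a word.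
    have : v * 2 ≤ v * (2 * s) := Nat.mul_le_mul_left _ (by omega)
    omega
  have hu := p.node.le
  have hN := p.fits.N_le
  have hn := p.fits.two_n_le
  have h1 := p.pair.left
  have h2 := p.pair.lt
  have h3 := p.bound
  have h4 := p.lt
  have t1 : e ≤ B := by omega
  have t2 : 2 * u + g ≤ B := by omega
  have t3 : 2 * v + h ≤ B := by omega
  have t4 : i ≤ B := by omega
  have t5 : j ≤ B := by omega
  have t6 : 2 * u ≤ B := by omega
  have t7 : 2 * v ≤ B := by omega
  have t8 : u ≤ B := by omega
  have t9 : v ≤ B := by omega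
  have t10 : 2 ≤ B := by omega
  have t11 : g ≤ B := by omega
  have t12 : h ≤ B := by omega
  have key : Runs B (fetchP g h) st (fetchP g h).maxCost
      fun st' => st'.word 17 0 = 2 * u + g ∧ st'.word 18 0 = 2 * v + h ∧ st'.word 19 0 = i ∧
        st'.word 20 0 = j := by
    refine Runs.of_wp ?_
    simp [fetchP, Program.wp, WExpr.Ok, WExpr.eval, p.head, p.u, p.v, p.i, p.j, t1, t2, t3, t4,
      t5, t6, t7, t8, t9, t10, t11, t12]
  refine (key.seq (T' := (Test.wordLt (var 18) (var 17)).cost + 1 + (1 + insertP.maxCost))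
    fun st₁ hf hs => ?_).mono (by simp [childP, Program.maxCost]) fun _ _ hs => hs
  replace hf : Frame (fetchP 0 0) st st₁ := ⟨hf.word, hf.real⟩
  obtain ⟨e1, e2, e3, e4⟩ := hs
  have hq₁ : D.QueueAt s lo G st₁ := hq.congr (hf.word _ (by decide)) (hf.word _ (by decide))
    (hf.word _ (by decide)) (hf.word _ (by decide)) (hf.word _ (by decide))
    (hf.word _ (by decide)) (hf.real _ (by decide))
  have hpre : Prefix lo st st₁ :=
    ⟨fun e _ => by rw [hf.word 8 (by decide)], fun e _ => by rw [hf.word 9 (by decide)],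
      fun e _ => by rw [hf.word 10 (by decide)], fun e _ => by rw [hf.word 11 (by decide)]⟩
  refine Runs.ite ?_ (fun hlt => ?_) fun hlt => ?_
  · simp [Test.Ok, WExpr.Ok, WExpr.eval, e1, e2, t2, t3]
  · refine ⟨1, st₁, .skip _, by omega, hpre, G, subset_rfl, fun hle => ?_, hq₁⟩
    simp only [Test.Holds, WExpr.eval, e1, e2] at hlt
    omega
  · simp only [Test.Holds, WExpr.eval, e1, e2, not_lt] at hlt
    have hready : D.Ready B s (2 * u + g) (2 * v + h) i j st₁ :=
      { fits := p.fits
        env := p.env.frame hf (by decide) (by decide)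
        args := ⟨by rw [hf.word 16 (by decide), p.size], e1, e2, e3, e4⟩
        pos := p.pos
        node := p.node.half hh hlt
        pair := p.pair }
    exact (hready.runs_insertP p.bound hq₁).mono (by omega) fun st' _ hs =>
      ⟨hpre.trans hs.2, _, Set.subset_insert _ _, fun _ => Set.mem_insert _ _, hs.1⟩

end Grid
end MinWeightRect

/-! ### One level of the refinement. -/

namespace MinWeightRect
open RealRAM
namespace Grid
variable {D : Grid}

/-- Insert all children of the entry at the head of the queue, and remove it. -/
def expandP : Program :=
  .seq (childP 0 0) <| .seq (childP 0 1) <| .seq (childP 1 0) <| .seq (childP 1 1) (incr 14)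

theorem Parent.runs_expandP {B s lo e u v i j : ℕ} {G : Set (ℕ × ℕ × ℕ × ℕ)} {st : State}
    (p : D.Parent B s lo e u v i j st) (hq : D.QueueAt s lo G st) :
    Runs B expandP st expandP.maxCost fun st' => st'.word 14 0 = e + 1 ∧ Prefix lo st st' ∧
      ∃ G', G ⊆ G' ∧ (∀ u' v', u' / 2 = u → v' / 2 = v → u' ≤ v' → (u', v', i, j) ∈ G') ∧
        D.QueueAt s lo G' st' := by
  refine (p.runs_childP hq (by omega) (by omega)).seq ?_
  rintro st₁ - ⟨p₁, f₁, G₁, s₁, m₁, q₁⟩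
  refine (p₁.runs_childP q₁ (by omega) (by omega)).seq ?_
  rintro st₂ - ⟨p₂, f₂, G₂, s₂, m₂, q₂⟩
  refine (p₂.runs_childP q₂ (by omega) (by omega)).seq ?_
  rintro st₃ - ⟨p₃, f₃, G₃, s₃, m₃, q₃⟩
  refine (p₃.runs_childP q₃ (by omega) (by omega)).seq ?_
  rintro st₄ - ⟨p₄, f₄, G₄, s₄, m₄, q₄⟩
  have h1 := p.fits.four_le
  have h2 := p.bound
  have h3 := p.lt
  refine Runs.of_wp ⟨Nat.zero_le _, ?_, ?_⟩
  · simp [WExpr.Ok, WExpr.eval, p₄.head]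
    omega
  · refine ⟨by simp [WExpr.eval, p₄.head], ?_, G₄,
      s₁.trans (s₂.trans (s₃.trans s₄)), ?_, ?_⟩
    · refine f₁.trans (f₂.trans (f₃.trans (f₄.trans ?_)))
      constructor <;> intros <;> simp
    · intro u' v' hu hv hle
      -- Each of the two blocks has two halves, which gives the four calls.
      have hu' : u' = 2 * u + 0 ∨ u' = 2 * u + 1 := by omega
      have hv' : v' = 2 * v + 0 ∨ v' = 2 * v + 1 := by omega
      rcases hu' with rfl | rfl <;> rcases hv' with rfl | rfl
      · exact s₄ (s₃ (s₂ (m₁ hle)))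
      · exact s₄ (s₃ (m₂ hle))
      · exact s₄ (m₃ hle)
      · exact m₄ hle
    · exact q₄.congr (by simp) (by simp) (by simp) (by simp) (by simp) (by simp) (by simp)

/-- Build the next level of the queue. -/
def levelP : Program :=
  .seq (.seq (assign 15 (var 13)) (assign 16 (.div (var 16) (.const 2)))) <|
  .while (.wordLt (var 14) (var 15)) expandP

/-- The room of `60 N²` is for two levels: the one being read and the one being written. -/
theorem runs_levelP {B s lo : ℕ} {st : State} (hB : D.Fits B) (hE : D.Env st) (hs : 1 ≤ s)
    (hN : ∃ c, D.N = c * (2 * s)) (h0 : 0 < D.N) (h16 : st.word 16 0 = 2 * s)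
    (h14 : st.word 14 0 = lo) (hq : D.QueueAt (2 * s) lo (D.level (2 * s)) st)
    (hlo : lo + 60 * D.N ^ 2 < B) :
    Runs B levelP st (10 + (30 * D.N ^ 2 * (6 + expandP.maxCost) + 6))
      fun st' => st'.word 16 0 = s ∧ ∃ lo', lo' ≤ lo + 30 * D.N ^ 2 ∧ st'.word 14 0 = lo' ∧
        D.QueueAt s lo' (D.level s) st' := by
  have hlen := Queue.length_le hq (by omega)
  have hsN : 2 * s ≤ D.N := by
    obtain ⟨c, hc⟩ := hN
    rcases Nat.eq_zero_or_pos c with rfl | hc'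
    · omega
    · rw [hc]; exact Nat.le_mul_of_pos_left _ hc'
  have hNB := hB.N_le
  have h4 := hB.four_le
  have t1 : st.word 13 0 ≤ B := by omega
  have t2 : 2 * s ≤ B := by omega
  have t3 : 2 ≤ B := by omega
  have hstart : Runs B (.seq (assign 15 (var 13)) (assign 16 (.div (var 16) (.const 2)))) st 10
      fun st' => st'.word 15 0 = st.word 13 0 ∧ st'.word 16 0 = s := by
    refine (Runs.of_wp ?_).mono (by decide) fun _ _ h => h
    simp [Program.wp, WExpr.Ok, WExpr.eval, h16, t1, t2, t3]
  refine hstart.seq ?_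
  rintro st₁ hf₁ ⟨e15, e16⟩
  have hq₁ : D.QueueAt (2 * s) lo (D.level (2 * s)) st₁ :=
    hq.congr (hf₁.word _ (by decide)) (hf₁.word _ (by decide))
      (hf₁.word _ (by decide)) (hf₁.word _ (by decide)) (hf₁.word _ (by decide))
      (hf₁.word _ (by decide)) (hf₁.real _ (by decide))
  have hE₁ := hE.frame hf₁ (by decide) (by decide)
  have e14 : st₁.word 14 0 = lo := by rw [hf₁.word 14 (by decide), h14]
  have e13 : st₁.word 13 0 = st.word 13 0 := by rw [hf₁.word 13 (by decide)]
  rw [← e13] at e15 hlen t1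
  set tail := st₁.word 13 0 with htail
  -- The children of the first `t` entries of the old level, the tuples handled after `t`
  -- iterations. The old level is read from the state before the loop, which `Prefix` preserves.
  let Gen : ℕ → Set (ℕ × ℕ × ℕ × ℕ) := fun t => {x | ∃ e, lo ≤ e ∧ e < lo + t ∧
    x.1 / 2 = st₁.word 8 e ∧ x.2.1 / 2 = st₁.word 9 e ∧ x.1 ≤ x.2.1 ∧
    x.2.2.1 = st₁.word 10 e ∧ x.2.2.2 = st₁.word 11 e}
  have hle : lo ≤ tail := hq₁.le
  have hloop := Runs.while (B := B) (b := .wordLt (var 14) (var 15)) (P := expandP) (s := st₁)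
    (tail - lo) expandP.maxCost
    (I := fun t st' => st'.word 14 0 = lo + t ∧ st'.word 15 0 = tail ∧ st'.word 16 0 = s ∧
      Prefix tail st₁ st' ∧ D.QueueAt s tail (Gen t) st')
    ⟨e14, e15, e16, Prefix.refl _ _, by
      have := Queue.next hq₁
      refine this.mono ?_
      rintro x ⟨e, h1, h2, -⟩
      omega⟩ ?_ ?_
  · refine hloop.mono ?_ ?_
    · exact Nat.add_le_add_right (Nat.mul_le_mul_right _ (by omega)) _
    · rintro st' - ⟨g14, g15, g16, hp, hq'⟩
      refine ⟨g16, tail, hlen, by omega, ?_⟩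
      refine Queue.complete hq₁ hN hq' ?_
      intro e h1 h2 u v hu hv huv
      exact ⟨e, h1, by omega, hu, hv, huv, rfl, rfl⟩
  · rintro t ht st' hf ⟨g14, g15, g16, hp, hq'⟩
    refine ⟨?_, ?_, ?_⟩
    · simp [Test.Ok, WExpr.Ok, WExpr.eval, g14, g15]
      omega
    · simp [Test.Holds, WExpr.eval, g14, g15]
      omega
    · have hp' : D.Parent B s tail (lo + t) (st₁.word 8 (lo + t)) (st₁.word 9 (lo + t))
          (st₁.word 10 (lo + t)) (st₁.word 11 (lo + t)) st' :=
        { fits := hB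
          env := hE₁.frame hf (by decide) (by decide)
          pos := hs
          node := hq₁.node _ (by omega) (by omega)
          pair := hq₁.pair _ (by omega) (by omega)
          size := g16
          head := g14
          lt := by omega
          bound := by omega
          u := hp.U _ (by omega)
          v := hp.V _ (by omega)
          i := hp.I _ (by omega)
          j := hp.J _ (by omega) }
      refine (hp'.runs_expandP hq').mono le_rfl ?_
      rintro st'' hf' ⟨k14, kp, G', hG, hG', kq⟩
      refine ⟨by omega, by rw [hf'.word 15 (by decide), g15], by rw [hf'.word 16 (by decide), g16],
        hp.trans kp, Queue.mono kq ?_⟩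
      rintro ⟨u, v, i, j⟩ ⟨e, h1, h2, h3, h4, h5, h6, h7⟩
      dsimp only at h3 h4 h5 h6 h7
      by_cases he : e < lo + t
      · exact hG ⟨e, h1, he, h3, h4, h5, h6, h7⟩
      · obtain rfl : e = lo + t := by omega
        rw [h6, h7]
        exact hG' u v h3 h4 h5
  · rintro st' - ⟨g14, g15, -⟩
    simp [Test.Ok, Test.Holds, WExpr.Ok, WExpr.eval, g14, g15]
    omega

end Grid
end MinWeightRect

/-! ### Descent to single rows and the final scan. -/

namespace MinWeightRect
open RealRAM
namespace Grid
variable {D : Grid}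

/-- Refine the queue down to blocks of size one. -/
def descendP : Program := .while (.wordLt (.const 1) (var 16)) levelP

theorem runs_descendP {B L : ℕ} {st : State} (hB : D.Fits B) (hE : D.Env st) (hN : D.N = 2 ^ L)
    (h16 : st.word 16 0 = D.N) (h14 : st.word 14 0 = 0) (hq : D.QueueAt D.N 0 (D.level D.N) st)
    (hL : (L + 2) * (30 * D.N ^ 2) < B) :
    Runs B descendP st (L * (5 + (10 + (30 * D.N ^ 2 * (6 + expandP.maxCost) + 6))) + 5)
      fun st' => st'.word 16 0 = 1 ∧ ∃ lo, lo ≤ L * (30 * D.N ^ 2) ∧ st'.word 14 0 = lo ∧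
        D.QueueAt 1 lo (D.level 1) st' := by
  have h4 := hB.four_le
  have hNB := hB.N_le
  have hloop := Runs.while (B := B) (b := .wordLt (.const 1) (var 16)) (P := levelP) (s := st)
    L (10 + (30 * D.N ^ 2 * (6 + expandP.maxCost) + 6))
    (I := fun t st' => st'.word 16 0 = 2 ^ (L - t) ∧ ∃ lo, lo ≤ t * (30 * D.N ^ 2) ∧
      st'.word 14 0 = lo ∧ D.QueueAt (2 ^ (L - t)) lo (D.level (2 ^ (L - t))) st')
    ⟨by simp [h16, hN], 0, by simp, h14, by simpa [← hN] using hq⟩ ?_ ?_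
  · refine hloop.mono le_rfl ?_
    rintro st' - ⟨h1, h2⟩
    simpa using And.intro h1 h2
  · rintro t ht st' hf ⟨g16, lo, glo, g14, gq⟩
    obtain ⟨r, rfl⟩ : ∃ r, L = t + (r + 1) := ⟨L - t - 1, by omega⟩
    have h1 : t + (r + 1) - t = r + 1 := by omega
    have h2 : t + (r + 1) - (t + 1) = r := by omega
    rw [h1, pow_succ, mul_comm] at g16 gq
    rw [h2]
    have hpow : 2 * 2 ^ r ≤ D.N := by
      rw [hN, mul_comm, ← pow_succ]; exact Nat.pow_le_pow_right (by omega) (by omega)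
    have hpos : 1 ≤ 2 ^ r := Nat.one_le_two_pow
    refine ⟨?_, ?_, ?_⟩
    · simp [Test.Ok, WExpr.Ok, WExpr.eval, g16]
      omega
    · simp [Test.Holds, WExpr.eval, g16]
      omega
    · have hEe := hE.frame hf (by decide) (by decide)
      -- The `t` levels already consumed occupy at most `t * 30 N²` positions, and two more levels
      -- are in use.
      have h3 : (t + 2) * (30 * D.N ^ 2) ≤ (t + (r + 1) + 2) * (30 * D.N ^ 2) :=
        Nat.mul_le_mul_right _ (by omega)
      rw [Nat.add_mul] at h3
      refine (runs_levelP hB hEe hpos ⟨2 ^ t, ?_⟩ (by omega) g16 g14 gq (by omega)).mono le_rfl ?_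
      · rw [hN]; ring
      · rintro st'' - ⟨k16, lo', k1, k2, k3⟩
        refine ⟨k16, lo', ?_, k2, k3⟩
        rw [Nat.add_mul]
        omega
  · rintro st' - ⟨g16, -⟩
    simp at g16
    simp [Test.Ok, Test.Holds, WExpr.Ok, WExpr.eval, g16]
    omega

/-- Load the entry at the head of the queue and compute its number of points and its weight. -/
def loadP : Program :=
  .seq (.seq (assign 17 (.get 8 (var 14))) <| .seq (assign 18 (.get 9 (var 14))) <|
    .seq (assign 19 (.get 10 (var 14))) (assign 20 (.get 11 (var 14)))) <|
  .seq (assign 24 upE) (.setReal 10 (.const 0) totE)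

theorem runs_loadP {B e u v i j : ℕ} {st : State} (hB : D.Fits B) (hE : D.Env st)
    (hs : st.word 16 0 = 1) (he : st.word 14 0 = e) (heB : e ≤ B) (hu : st.word 8 e = u)
    (hv : st.word 9 e = v) (hi : st.word 10 e = i) (hj : st.word 11 e = j)
    (hn : D.Node 1 u v) (hp : D.Pair i j) :
    Runs B loadP st loadP.maxCost fun st' => D.Ready B 1 u v i j st' ∧
      st'.word 24 0 = D.up 1 u v i j ∧ st'.real 10 0 = D.tot 1 u v i j := by
  have hNB := hB.N_le
  have hnB := hB.two_n_le
  have h1 := hn.lt le_rfl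
  have h2 := hn.le
  have h3 := hp.left
  have h4 := hp.lt
  have t1 : u ≤ B := by omega
  have t2 : v ≤ B := by omega
  have t3 : i ≤ B := by omega
  have t4 : j ≤ B := by omega
  have key : Runs B (.seq (assign 17 (.get 8 (var 14))) <| .seq (assign 18 (.get 9 (var 14))) <|
    .seq (assign 19 (.get 10 (var 14))) (assign 20 (.get 11 (var 14)))) st 20
      fun st' => Args 1 u v i j st' := by
    refine (Runs.of_wp (Q := fun st' => st'.word 16 0 = 1 ∧ st'.word 17 0 = u ∧
      st'.word 18 0 = v ∧ st'.word 19 0 = i ∧ st'.word 20 0 = j) ?_).mono (by decide)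
        fun _ _ ⟨a, b, c, d, e⟩ => ⟨a, b, c, d, e⟩
    simp [Program.wp, WExpr.Ok, WExpr.eval, hs, he, hu, hv, hi, hj, t1, t2, t3, t4, heB]
  refine (key.seq (T' := (Program.seq (assign 24 upE)
    (.setReal 10 (.const 0) totE)).maxCost) ?_).mono (by decide) fun _ _ h => h
  rintro st₁ hf hA
  have h : D.Ready B 1 u v i j st₁ :=
    ⟨hB, hE.frame hf (by decide) (by decide), hA, le_rfl, hn, hp⟩
  have a1 := h.upE_ok
  have r1 : D.Ready B 1 u v i j (st₁.setWord 24 0 (D.up 1 u v i j)) :=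
    h.congr (h.env.congr (by simp) (by simp) (by simp) (by simp) (by simp) (by simp))
      (h.args.congr (by simp) (by simp) (by simp) (by simp) (by simp))
  have a2 := r1.totE_ok
  refine Runs.of_wp ⟨Nat.zero_le _, a1.1, ?_⟩
  rw [a1.2]
  refine ⟨Nat.zero_le _, a2.1, ?_⟩
  simp only [WExpr.eval]
  rw [a2.2]
  refine ⟨h.congr (h.env.congr (by simp) (by simp) (by simp) (by simp) (by simp) (by simp))
      (h.args.congr (by simp) (by simp) (by simp) (by simp) (by simp)), ?_, ?_⟩ <;> simp

/-- The rows from `u` to `v` contain all points with an ordinate between those of the points `u` and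
`v`, when the ordinates `Y` are sorted. -/
def Full (n : ℕ) (Y : ℕ → ℝ) (u v : ℕ) : Prop :=
  v < n ∧ (u = 0 ∨ Y (u - 1) < Y u) ∧ (v + 1 = n ∨ Y v < Y (v + 1))

/-- A rectangle with `k` points. -/
structure Cand (D : Grid) (Y : ℕ → ℝ) (u v i j : ℕ) : Prop where
  le : u ≤ v
  full : Full D.n Y u v
  pair : D.Pair i j
  count : D.up 1 u v i j = D.k

/-- Record the rectangle at hand if it is the best one so far. -/
def recordP : Program :=
  .ite (.and (.and (.wordLt (var 18) (.get 0 (.const 0))) (.wordEq (var 24) (.get 0 (.const 1))))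
      (.and (.or (.wordEq (var 17) (.const 0))
          (.realLt (.get 5 (.sub (var 17) (.const 1))) (.get 5 (var 17))))
        (.or (.wordEq (.add (var 18) (.const 1)) (.get 0 (.const 0)))
          (.realLt (.get 5 (var 18)) (.get 5 (.add (var 18) (.const 1)))))))
    (.ite (.or (.wordEq (var 1) (.const 0))
        (.realLt (.get 10 (.const 0)) (.get 9 (.const 0))))
      (.seq (assign 1 (.const 1)) <| .seq (.setReal 9 (.const 0) (.get 10 (.const 0))) <|
        .seq (.setReal 3 (.const 0) (.get 4 (var 19))) <|
        .seq (.setReal 3 (.const 1) (.get 5 (var 17))) <|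
        .seq (.setReal 3 (.const 2) (.get 4 (.sub (var 20) (.get 0 (.const 0))))) <|
        .setReal 3 (.const 3) (.get 5 (var 18)))
      .skip)
    .skip

/-- The output is the best of the candidates in `G`. -/
def Best (D : Grid) (Y : ℕ → ℝ) (G : Set (ℕ × ℕ × ℕ × ℕ)) (st : State) : Prop :=
  (st.word 1 0 = 0 ∧ ∀ u v i j, (u, v, i, j) ∈ G → ¬ D.Cand Y u v i j) ∨
  (st.word 1 0 = 1 ∧ ∃ u v i j, D.Cand Y u v i j ∧ st.real 9 0 = D.tot 1 u v i j ∧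
    st.real 3 0 = D.X i ∧ st.real 3 1 = Y u ∧ st.real 3 2 = D.X (j - D.n) ∧ st.real 3 3 = Y v ∧
    ∀ u' v' i' j', (u', v', i', j') ∈ G → D.Cand Y u' v' i' j' →
      D.tot 1 u v i j ≤ D.tot 1 u' v' i' j')

theorem Ready.runs_recordP {B u v i j : ℕ} {G : Set (ℕ × ℕ × ℕ × ℕ)} {st : State} {Y : ℕ → ℝ}
    (h : D.Ready B 1 u v i j st) (hY : st.real 5 = Y) (hup : st.word 24 0 = D.up 1 u v i j)
    (htot : st.real 10 0 = D.tot 1 u v i j) (hb : D.Best Y G st) :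
    Runs B recordP st recordP.maxCost (D.Best Y (insert (u, v, i, j) G)) := by
  have h1 := h.fits.four_le
  have h2 := h.fits.two_n_le
  have h3 := h.fits.N_le
  have h4 := h.u_lt
  have h5 := h.node.lt h.pos
  have h6 := h.fits.k
  have h7 := h.pair.left
  have h8 := h.pair.lt
  have h9 := D.up_le 1 u v i j
  have h10 := h.fits.N
  have h11 := h.fits.M_le
  have ek := h.env.k
  have en := h.env.n
  have eX := h.env.X
  obtain ⟨-, e1, e2, e3, e4⟩ := h.args
  have t1 : u ≤ B := by omega
  have t2 : v ≤ B := by omega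
  have t3 : v < B := by omega
  have t4 : i ≤ B := by omega
  have t5 : j ≤ B := by omega
  have t6 : D.n ≤ B := by omega
  have t7 : D.up 1 u v i j ≤ B := by omega
  have t8 : 1 ≤ B := by omega
  have t9 : 2 ≤ B := by omega
  have t10 : 3 ≤ B := by omega
  have hskip : ¬ D.Cand Y u v i j → D.Best Y (insert (u, v, i, j) G) st := by
    intro hc
    rcases hb with ⟨b1, b2⟩ | ⟨b1, u₀, v₀, i₀, j₀, b2, b3, b4, b5, b6, b7, b8⟩
    · refine .inl ⟨b1, ?_⟩
      rintro u' v' i' j' (hm | hm)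
      · simp only [Prod.mk.injEq] at hm
        obtain ⟨rfl, rfl, rfl, rfl⟩ := hm
        exact hc
      · exact b2 _ _ _ _ hm
    · refine .inr ⟨b1, u₀, v₀, i₀, j₀, b2, b3, b4, b5, b6, b7, ?_⟩
      rintro u' v' i' j' (hm | hm) hc'
      · simp only [Prod.mk.injEq] at hm
        obtain ⟨rfl, rfl, rfl, rfl⟩ := hm
        exact absurd hc' hc
      · exact b8 _ _ _ _ hm hc'
  refine Runs.of_wp ⟨?_, fun hh => ⟨?_, fun hh' => ?_, fun hh' => ?_⟩, fun hh => ?_⟩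
  -- Both sides of a disjunction are evaluated, so the neighbouring rows are read even at the ends:
  -- `u - 1` is truncated at `u = 0`, and `v + 1` must fit into a word.
  · simp [Test.Ok, WExpr.Ok, RExpr.Ok, WExpr.eval, e1, e2, ek, en, hup, t1, t2, t3, t6, t7, t8, h6]
  · rcases hb with ⟨b1, -⟩ | ⟨b1, -⟩ <;>
      simp [Test.Ok, WExpr.Ok, RExpr.Ok, WExpr.eval, b1, t8]
  · have hc : D.Cand Y u v i j := by
      simp [Test.Holds, WExpr.eval, RExpr.eval, e1, e2, ek, en, hup, hY] at hh
      exact ⟨h.node.le, ⟨hh.1.1, hh.2⟩, h.pair, hh.1.2⟩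
    simp [Test.Holds, WExpr.eval, RExpr.eval, htot] at hh'
    simp [Program.wp, WExpr.Ok, RExpr.Ok, WExpr.eval, RExpr.eval, e1, e2, e3, e4, en, hY, eX,
      htot, t1, t2, t4, t5, t6, t8, t9, t10]
    refine .inr ⟨by simp, u, v, i, j, hc, by simp, by simp, by simp, by simp, by simp, ?_⟩
    rintro u' v' i' j' (hm | hm) hc'
    · simp only [Prod.mk.injEq] at hm
      obtain ⟨rfl, rfl, rfl, rfl⟩ := hm
      exact le_rfl
    · rcases hb with ⟨b1, b2⟩ | ⟨b1, u₀, v₀, i₀, j₀, b2, b3, b4, b5, b6, b7, b8⟩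
      · exact absurd hc' (b2 _ _ _ _ hm)
      · have := b8 _ _ _ _ hm hc'
        rcases hh' with hh' | hh'
        · omega
        · linarith
  · simp [Test.Holds, WExpr.eval, RExpr.eval, htot] at hh'
    rcases hb with ⟨b1, b2⟩ | ⟨b1, u₀, v₀, i₀, j₀, b2, b3, b4, b5, b6, b7, b8⟩
    · exact absurd b1 hh'.1
    · refine .inr ⟨b1, u₀, v₀, i₀, j₀, b2, b3, b4, b5, b6, b7, ?_⟩
      rintro u' v' i' j' (hm | hm) hc'
      · simp only [Prod.mk.injEq] at hm
        obtain ⟨rfl, rfl, rfl, rfl⟩ := hm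
        linarith [hh'.2]
      · exact b8 _ _ _ _ hm hc'
  · refine hskip fun hc => hh ?_
    obtain ⟨c1, ⟨c2, c3, c4⟩, c5, c6⟩ := hc
    simp [Test.Holds, WExpr.eval, RExpr.eval, e1, e2, ek, en, hup, hY]
    exact ⟨⟨c2, c6⟩, c3, c4⟩

/-- Scan the queue for the best rectangle. -/
def scanP : Program :=
  .while (.wordLt (var 14) (var 13)) (.seq loadP (.seq recordP (incr 14)))

theorem runs_scanP {B lo : ℕ} {st : State} {Y : ℕ → ℝ} (hB : D.Fits B) (hE : D.Env st)
    (hnN : D.n ≤ D.N) (h16 : st.word 16 0 = 1) (h14 : st.word 14 0 = lo)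
    (hq : D.QueueAt 1 lo (D.level 1) st) (hlo : lo + 30 * D.N ^ 2 < B) (hY : st.real 5 = Y)
    (h1 : st.word 1 0 = 0) :
    Runs B scanP st (30 * D.N ^ 2 * (6 + (Program.seq loadP (.seq recordP (incr 14))).maxCost) + 6)
      (D.Best Y Set.univ) := by
  have hlen := Queue.length_le hq (by omega)
  have hle : lo ≤ st.word 13 0 := Queue.le hq
  let Gen : ℕ → Set (ℕ × ℕ × ℕ × ℕ) := fun t => {x | ∃ e, lo ≤ e ∧ e < lo + t ∧
    x = (st.word 8 e, st.word 9 e, st.word 10 e, st.word 11 e)}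
  have hloop := Runs.while (B := B) (b := .wordLt (var 14) (var 13))
    (P := (Program.seq loadP (.seq recordP (incr 14)))) (s := st)
    (st.word 13 0 - lo) (Program.seq loadP (.seq recordP (incr 14))).maxCost
    (I := fun t st' => st'.word 14 0 = lo + t ∧ D.Best Y (Gen t) st')
    ⟨h14, .inl ⟨h1, by rintro u v i j ⟨e, h1, h2, -⟩; omega⟩⟩ ?_ ?_
  · refine hloop.mono (Nat.add_le_add_right (Nat.mul_le_mul_right _ (by omega)) _) ?_
    rintro st' - ⟨-, hb⟩
    -- The loop compares only the entries of the queue. They suffice because every candidate is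
    -- dominated by an entry with the same rows and the same count, hence again a candidate.
    have hdom : ∀ u v i j, D.Cand Y u v i j → ∃ u' v' i' j',
        (u', v', i', j') ∈ Gen (st.word 13 0 - lo) ∧ D.Cand Y u' v' i' j' ∧
          D.tot 1 u' v' i' j' ≤ D.tot 1 u v i j := by
      rintro u v i j ⟨c1, c2, c3, c4⟩
      have hf : D.Feasible 1 u v i j := by
        refine ⟨?_, c4.ge⟩
        rw [← c4]
        have w1 := win_mono c3 (Nat.le_add_right (u * 1) 1)
        have w2 := win_mono c3 (Nat.le_add_right (v * 1) 1)
        unfold Grid.lo up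
        omega
      obtain ⟨e, g1, g2, g3, g4, g5, g6⟩ := Queue.mem hq u v i j
        ⟨⟨c1, by have := c2.1; dsimp only; omega⟩, c3⟩ hf
      have hp := Queue.pair hq e g1 g2
      have hv := Queue.val hq e g1 g2
      rw [g3, g4] at hv
      -- The blocks as their own children: equal keys give equal `up`, and `tot - val` is constant
      -- on the class.
      obtain ⟨-, k1, -, k2⟩ := g5.child hp c3 c1 (Child.refl _ _ _)
      refine ⟨_, _, _, _, ⟨e, g1, by omega, rfl⟩, ?_, ?_⟩
      · rw [g3, g4]
        exact ⟨c1, c2, hp, by rw [k1, c4]⟩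
      · rw [g3, g4]
        linarith
    rcases hb with ⟨b1, b2⟩ | ⟨b1, u₀, v₀, i₀, j₀, b2, b3, b4, b5, b6, b7, b8⟩
    · refine .inl ⟨b1, fun u v i j _ hc => ?_⟩
      obtain ⟨u', v', i', j', d1, d2, -⟩ := hdom u v i j hc
      exact b2 _ _ _ _ d1 d2
    · refine .inr ⟨b1, u₀, v₀, i₀, j₀, b2, b3, b4, b5, b6, b7, fun u v i j _ hc => ?_⟩
      obtain ⟨u', v', i', j', d1, d2, d3⟩ := hdom u v i j hc
      exact (b8 _ _ _ _ d1 d2).trans d3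
  · rintro t ht st₁ hf ⟨g14, gb⟩
    refine ⟨?_, ?_, ?_⟩
    · simp [Test.Ok, WExpr.Ok, WExpr.eval, g14, hf.word 13 (by decide)]
      omega
    · simp [Test.Holds, WExpr.eval, g14, hf.word 13 (by decide)]
      omega
    · have hn := Queue.node hq (lo + t) (by omega) (by omega)
      have hp := Queue.pair hq (lo + t) (by omega) (by omega)
      refine (runs_loadP hB (hE.frame hf (by decide) (by decide))
        (by rw [hf.word 16 (by decide), h16]) g14 (by omega) (by rw [hf.word 8 (by decide)])
        (by rw [hf.word 9 (by decide)]) (by rw [hf.word 10 (by decide)])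
        (by rw [hf.word 11 (by decide)]) hn hp).seq ?_
      rintro st₂ hf₂ ⟨hr, hup, htot⟩
      have gb₂ : D.Best Y (Gen t) st₂ := by
        unfold Best
        rw [hf₂.word 1 (by decide), hf₂.real 9 (by decide), hf₂.real 3 (by decide)]
        exact gb
      refine (hr.runs_recordP (by rw [hf₂.real 5 (by decide), hf.real 5 (by decide), hY])
        hup htot gb₂).seq ?_
      intro st₃ hf₃ gb₃
      have e14 : st₃.word 14 0 = lo + t := by
        rw [hf₃.word 14 (by decide), hf₂.word 14 (by decide), g14]
      refine Runs.of_wp ⟨Nat.zero_le _, ?_, ?_, ?_⟩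
      · simp [WExpr.Ok, WExpr.eval, e14]
        omega
      · simp [WExpr.eval, e14]
        omega
      · have hG : Gen (t + 1) ⊆ insert (st.word 8 (lo + t), st.word 9 (lo + t),
            st.word 10 (lo + t), st.word 11 (lo + t)) (Gen t) := by
          rintro x ⟨e, d1, d2, rfl⟩
          by_cases he : e < lo + t
          · exact .inr ⟨e, d1, he, rfl⟩
          · obtain rfl : e = lo + t := by omega
            exact .inl rfl
        rcases gb₃ with ⟨b1, b2⟩ | ⟨b1, u₀, v₀, i₀, j₀, b2, b3, b4, b5, b6, b7, b8⟩
        · exact .inl ⟨by simpa using b1, fun u v i j hm => b2 u v i j (hG hm)⟩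
        · exact .inr ⟨by simpa using b1, u₀, v₀, i₀, j₀, b2, by simpa using b3,
            by simpa using b4, by simpa using b5, by simpa using b6, by simpa using b7,
            fun u v i j hm => b8 u v i j (hG hm)⟩
  · rintro st' hf ⟨g14, -⟩
    simp [Test.Ok, Test.Holds, WExpr.Ok, WExpr.eval, g14, hf.word 13 (by decide)]
    omega

end Grid
end MinWeightRect

/-! ### The root level: all slabs, with all rows in one block. -/

namespace MinWeightRect
open RealRAM
namespace Grid
variable {D : Grid}

/-- Insert the pair of cuts given by the points in the variables `3` and `4`. -/
def pairP : Program :=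
  .ite (.realLt (.get 4 (var 4)) (.get 4 (var 3))) .skip <|
    .seq (.seq (assign 19 (var 3)) (assign 20 (.add (.get 0 (.const 0)) (var 4)))) insertP

/-- Insert all pairs of cuts whose left cut is given by the variable `3`. -/
def rowP : Program :=
  .seq (assign 4 (.const 0)) <| .seq
    (.while (.wordLt (var 4) (.get 0 (.const 0))) (.seq pairP (incr 4))) (incr 3)

/-- Insert all pairs of cuts at the root. -/
def rootP : Program :=
  .seq (.seq (assign 16 (var 2)) <| .seq (assign 17 (.const 0)) <| .seq (assign 18 (.const 0))
    (assign 3 (.const 0))) <|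
  .while (.wordLt (var 3) (.get 0 (.const 0))) rowP

/-- The pairs of cuts inserted before the pair given by the points `a` and `b`. -/
def before (D : Grid) (a b : ℕ) : Set (ℕ × ℕ × ℕ × ℕ) :=
  {x | x.1 = 0 ∧ x.2.1 = 0 ∧ D.Pair x.2.2.1 x.2.2.2 ∧
    (x.2.2.1 < a ∨ x.2.2.1 = a ∧ x.2.2.2 < D.n + b)}

/-- The memory while the root is filled. -/
structure RootAt (D : Grid) (B a b : ℕ) (st : State) : Prop where
  fits : D.Fits B
  env : D.Env st
  pos : 1 ≤ D.N
  bound : 30 * D.N ^ 2 < B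
  size : st.word 16 0 = D.N
  u : st.word 17 0 = 0
  v : st.word 18 0 = 0
  queue : D.QueueAt D.N 0 (D.before a b) st
  a : st.word 3 0 = a

theorem RootAt.runs_pairP {B a b : ℕ} {st : State} (h : D.RootAt B a b st) (ha : a < D.n)
    (hb : b < D.n) (h4 : st.word 4 0 = b) :
    Runs B (.seq pairP (incr 4)) st (Program.seq pairP (incr 4)).maxCost fun st' =>
      D.RootAt B a (b + 1) st' ∧ st'.word 4 0 = b + 1 := by
  have h1 := h.fits.four_le
  have h2 := h.fits.two_n_le
  have t1 : a ≤ B := by omega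
  have t2 : b ≤ B := by omega
  have t3 : D.n ≤ B := by omega
  have t4 : D.n + b ≤ B := by omega
  have t5 : 1 ≤ B := by omega
  have t6 : b < B := by omega
  have key : Runs B pairP st pairP.maxCost fun st' => D.QueueAt D.N 0 (D.before a (b + 1)) st' := by
    refine (Runs.ite (T := 1 + (11 + insertP.maxCost)) ?_ (fun hlt => ?_) fun hlt => ?_).mono
      (by simp [pairP, Program.maxCost, WExpr.cost]) fun _ _ h => h
    · simp [Test.Ok, RExpr.Ok, WExpr.Ok, WExpr.eval, h4, h.a, t1, t2]
    · simp [Test.Holds, RExpr.eval, WExpr.eval, h4, h.a, h.env.X] at hlt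
      refine ⟨1, st, .skip _, by omega, Queue.mono h.queue ?_⟩
      rintro ⟨u, v, i, j⟩ ⟨rfl, rfl, hp, hc⟩
      refine ⟨rfl, rfl, hp, ?_⟩
      dsimp only at hp hc ⊢
      rcases hc with hc | ⟨rfl, hc⟩
      · exact .inl hc
      · refine .inr ⟨rfl, ?_⟩
        -- The only tuple not yet covered is the one of the points `a` and `b`, which is no slab
        -- since `b` lies strictly to the left of `a`.
        by_contra hcon
        obtain rfl : j = D.n + b := by omega
        have := hp.le
        rw [Nat.add_sub_cancel_left] at this
        linarith
    · simp [Test.Holds, RExpr.eval, WExpr.eval, h4, h.a, h.env.X] at hlt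
      have hstep : Runs B (.seq (assign 19 (var 3)) (assign 20 (.add (.get 0 (.const 0)) (var 4))))
          st 11 fun st' => st'.word 19 0 = a ∧ st'.word 20 0 = D.n + b := by
        refine (Runs.of_wp ?_).mono (by decide) fun _ _ h => h
        simp [Program.wp, WExpr.Ok, WExpr.eval, h4, h.a, h.env.n, t1, t2, t3, t4]
      refine (hstep.seq (T' := insertP.maxCost) ?_).mono (by omega) fun _ _ h => h
      rintro st₁ hf ⟨e19, e20⟩
      have hr : D.Ready B D.N 0 0 a (D.n + b) st₁ :=
        { fits := h.fits
          env := h.env.frame hf (by decide) (by decide)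
          args := ⟨by rw [hf.word 16 (by decide), h.size], by rw [hf.word 17 (by decide), h.u],
            by rw [hf.word 18 (by decide), h.v], e19, e20⟩
          pos := h.pos
          node := ⟨le_rfl, by omega⟩
          pair := ⟨ha, by omega, by omega, by rwa [Nat.add_sub_cancel_left]⟩ }
      have hq : D.QueueAt D.N 0 (D.before a b) st₁ :=
        h.queue.congr (hf.word _ (by decide)) (hf.word _ (by decide))
          (hf.word _ (by decide)) (hf.word _ (by decide)) (hf.word _ (by decide))
          (hf.word _ (by decide)) (hf.real _ (by decide))
      refine (hr.runs_insertP (by have := h.bound; omega) hq).mono le_rfl ?_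
      rintro st₂ - ⟨hq₂, -⟩
      refine Queue.mono hq₂ ?_
      rintro ⟨u, v, i, j⟩ ⟨rfl, rfl, hp, hc⟩
      dsimp only at hp hc
      by_cases he : i = a ∧ j = D.n + b
      · obtain ⟨rfl, rfl⟩ := he
        exact .inl rfl
      · exact .inr ⟨rfl, rfl, hp, by dsimp only; omega⟩
  refine key.seq ?_
  intro st₁ hf hq
  have e4 : st₁.word 4 0 = b := by rw [hf.word 4 (by decide), h4]
  refine Runs.of_wp ⟨Nat.zero_le _, by simp [WExpr.Ok, WExpr.eval, e4, t2, t5, t6], ?_, ?_⟩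
  · exact
      { fits := h.fits
        env := (h.env.frame hf (by decide) (by decide)).congr (by simp) (by simp) (by simp)
          (by simp) (by simp) (by simp)
        pos := h.pos
        bound := h.bound
        size := by simp [hf.word 16 (by decide), h.size]
        u := by simp [hf.word 17 (by decide), h.u]
        v := by simp [hf.word 18 (by decide), h.v]
        a := by simp [hf.word 3 (by decide), h.a]
        queue := hq.congr (by simp) (by simp) (by simp) (by simp) (by simp) (by simp) (by simp) }
  · simp [WExpr.eval, e4]

/-- Changes to the loop counters alone are harmless; this serves both the start of a row and the
passage to the next one. -/
theorem RootAt.congr {B a b : ℕ} {st st' : State} (h : D.RootAt B a b st) {c : ℕ}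
    (hc : D.before c 0 ⊆ D.before a b)
    (hw : ∀ x, x ≠ 3 → x ≠ 4 → st'.word x = st.word x) (hr : st'.real = st.real)
    (h3 : st'.word 3 0 = c) : D.RootAt B c 0 st' :=
  { fits := h.fits
    env := h.env.congr (hw _ (by decide) (by decide)) (hw _ (by decide) (by decide))
      (hw _ (by decide) (by decide)) (hw _ (by decide) (by decide)) (by rw [hr]) (by rw [hr])
    pos := h.pos
    bound := h.bound
    size := by rw [hw _ (by decide) (by decide), h.size]
    u := by rw [hw _ (by decide) (by decide), h.u]
    v := by rw [hw _ (by decide) (by decide), h.v]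
    a := h3
    queue := Queue.mono (h.queue.congr (hw _ (by decide) (by decide)) (hw _ (by decide) (by decide))
      (hw _ (by decide) (by decide)) (hw _ (by decide) (by decide)) (hw _ (by decide) (by decide))
      (hw _ (by decide) (by decide)) (by rw [hr])) hc }

theorem RootAt.runs_rowP {B a : ℕ} {st : State} (h : D.RootAt B a 0 st) (ha : a < D.n) :
    Runs B rowP st (3 + ((D.n * (6 + (Program.seq pairP (incr 4)).maxCost) + 6) + 6))
      (D.RootAt B (a + 1) 0) := by
  have h1 := h.fits.four_le
  have h2 := h.fits.two_n_le
  have h0 : Runs B (assign 4 (.const 0)) st 3 fun st' => D.RootAt B a 0 st' ∧ st'.word 4 0 = 0 := by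
    refine Runs.of_wp ⟨Nat.zero_le _, Nat.zero_le _, ?_, by simp [WExpr.eval]⟩
    exact h.congr subset_rfl (fun x _ h4 => by simp [h4]) rfl (by simp [h.a])
  refine h0.seq ?_
  rintro st₁ hf₁ ⟨hr₁, e4⟩
  have hloop := Runs.while (B := B) (b := .wordLt (var 4) (.get 0 (.const 0)))
    (P := .seq pairP (incr 4)) (s := st₁) D.n (Program.seq pairP (incr 4)).maxCost
    (I := fun t st' => D.RootAt B a t st' ∧ st'.word 4 0 = t) ⟨hr₁, e4⟩ ?_ ?_
  · refine hloop.seq ?_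
    rintro st₂ hf₂ ⟨hr₂, -⟩
    refine Runs.of_wp ⟨Nat.zero_le _, ?_, ?_⟩
    · simp [WExpr.Ok, WExpr.eval, hr₂.a]
      omega
    · refine hr₂.congr ?_ (fun x h3 _ => by simp [h3]) rfl
        (by simp [WExpr.eval, hr₂.a])
      rintro ⟨u, v, i, j⟩ ⟨rfl, rfl, hp, hc⟩
      refine ⟨rfl, rfl, hp, ?_⟩
      have := hp.right
      have := hp.lt
      dsimp only at *
      omega
  · rintro t ht st₂ hf₂ ⟨hr₂, e4'⟩
    refine ⟨?_, ?_, hr₂.runs_pairP ha ht e4'⟩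
    · simp [Test.Ok, WExpr.Ok, WExpr.eval, e4', hr₂.env.n]
      omega
    · simpa [Test.Holds, WExpr.eval, e4', hr₂.env.n]
  · rintro st₂ hf₂ ⟨hr₂, e4'⟩
    simp [Test.Ok, Test.Holds, WExpr.Ok, WExpr.eval, e4', hr₂.env.n]
    omega

theorem runs_rootP {B : ℕ} {st : State} (hB : D.Fits B) (hE : D.Env st) (hN : 1 ≤ D.N)
    (hbound : 30 * D.N ^ 2 < B) (h12 : ∀ κ, st.word 12 κ = 0) (h13 : st.word 13 0 = 0) :
    Runs B rootP st (20 + (D.n * (6 + (3 + ((D.n * (6 + (Program.seq pairP (incr 4)).maxCost)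
      + 6) + 6))) + 6)) fun st' => st'.word 16 0 = D.N ∧ D.QueueAt D.N 0 (D.level D.N) st' := by
  have hNB := hB.N_le
  have hn := hB.two_n_le
  have h0 : Runs B (.seq (assign 16 (var 2)) <| .seq (assign 17 (.const 0)) <|
      .seq (assign 18 (.const 0)) (assign 3 (.const 0))) st 20 fun st' =>
      st'.word 16 0 = D.N ∧ st'.word 17 0 = 0 ∧ st'.word 18 0 = 0 ∧ st'.word 3 0 = 0 := by
    refine (Runs.of_wp ?_).mono (by decide) fun _ _ h => h
    simp [Program.wp, WExpr.Ok, WExpr.eval, hE.N, hNB]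
  refine h0.seq ?_
  rintro st₁ hf ⟨e16, e17, e18, e3⟩
  have hr₁ : D.RootAt B 0 0 st₁ :=
    { fits := hB
      env := hE.frame hf (by decide) (by decide)
      pos := hN
      bound := hbound
      size := e16
      u := e17
      v := e18
      a := e3
      queue := by
        unfold QueueAt
        rw [hf.word 13 (by decide), hf.word 12 (by decide), h13]
        refine ⟨le_rfl, ?_, ?_, ?_, ?_, ?_, fun κ => .inl (h12 κ), ?_⟩
        any_goals intros; omega
        rintro u v i j ⟨-, -, hp, hc⟩ -
        have := hp.right
        dsimp only at hc this
        omega }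
  have hloop := Runs.while (B := B) (b := .wordLt (var 3) (.get 0 (.const 0)))
    (P := rowP) (s := st₁) D.n (3 + ((D.n * (6 + (Program.seq pairP (incr 4)).maxCost) + 6) + 6))
    (I := fun t st' => D.RootAt B t 0 st') hr₁ ?_ ?_
  · refine hloop.mono le_rfl ?_
    intro st₂ _ hr₂
    refine ⟨hr₂.size, Queue.mono hr₂.queue ?_⟩
    rintro ⟨u, v, i, j⟩ ⟨hn, hp⟩
    dsimp only at hn hp
    have h1 := hn.lt hN
    have h2 := hn.bound
    have h3 := hn.le
    -- A block of size `N` fills all rows, so the root is the only node of its size.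
    obtain rfl : v = 0 := by
      by_contra hv
      have : 1 * D.N ≤ v * D.N := Nat.mul_le_mul_right _ (by omega)
      omega
    obtain rfl : u = 0 := by omega
    exact ⟨rfl, rfl, hp, .inl hp.left⟩
  · intro t ht st₂ _ hr₂
    refine ⟨?_, ?_, hr₂.runs_rowP ht⟩
    · simp [Test.Ok, WExpr.Ok, WExpr.eval, hr₂.a, hr₂.env.n]
      omega
    · simpa [Test.Holds, WExpr.eval, hr₂.a, hr₂.env.n]
  · intro st₂ _ hr₂
    simp [Test.Ok, Test.Holds, WExpr.Ok, WExpr.eval, hr₂.a, hr₂.env.n]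
    omega

end Grid
end MinWeightRect

/-! ### Sorting by ordinates and choosing the padded size. -/

namespace MinWeightRect
open RealRAM

/-- The order by ordinates, ties being broken by the index. -/
def Below (y : ℕ → ℝ) (r q : ℕ) : Prop := y r < y q ∨ y r = y q ∧ r < q

open Classical in
/-- The number of points among the first `t` ones that are below the point `q`. -/
noncomputable def rank (y : ℕ → ℝ) (q t : ℕ) : ℕ := ((Finset.range t).filter (Below y · q)).card

open Classical in
theorem rank_succ (y : ℕ → ℝ) (q t : ℕ) :
    rank y q (t + 1) = rank y q t + if Below y t q then 1 else 0 := by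
  unfold rank
  rw [Finset.range_add_one, Finset.filter_insert]
  split_ifs <;> simp

theorem rank_lt_rank {y : ℕ → ℝ} {q q' n : ℕ} (h : Below y q q') (hq : q < n) :
    rank y q n < rank y q' n := by
  classical
  refine Finset.card_lt_card (Finset.ssubset_iff_subset_ne.2 ⟨fun r hr => ?_, fun he => ?_⟩)
  · simp only [Finset.mem_filter] at hr ⊢
    refine ⟨hr.1, ?_⟩
    rcases h with h | ⟨h, h'⟩ <;> rcases hr.2 with g | ⟨g, g'⟩
    · exact .inl (g.trans h)
    · exact .inl (g.trans_lt h)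
    · exact .inl (h ▸ g)
    · exact .inr ⟨g.trans h, g'.trans h'⟩
  -- The inclusion is strict: `q` itself is below `q'` but not below `q`.
  · have h1 : q ∈ (Finset.range n).filter (Below y · q') := by simp [hq, h]
    rw [← he] at h1
    simpa [Below] using (Finset.mem_filter.1 h1).2

theorem rank_lt {y : ℕ → ℝ} {q n : ℕ} (hq : q < n) : rank y q n < n := by
  classical
  calc rank y q n < (Finset.range n).card := by
        refine Finset.card_lt_card (Finset.ssubset_iff_subset_ne.2
          ⟨Finset.filter_subset _ _, fun he => ?_⟩)
        have h1 : q ∈ Finset.range n := by simpa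
        rw [← he] at h1
        simpa [Below] using (Finset.mem_filter.1 h1).2
    _ = n := Finset.card_range n

theorem below_or (y : ℕ → ℝ) {q q' : ℕ} (h : q ≠ q') : Below y q q' ∨ Below y q' q := by
  unfold Below
  rcases lt_trichotomy (y q) (y q') with g | g | g
  · exact .inl (.inl g)
  · rcases lt_or_gt_of_ne h with h | h
    · exact .inl (.inr ⟨g, h⟩)
    · exact .inr (.inr ⟨g.symm, h⟩)
  · exact .inr (.inl g)

theorem rank_inj {y : ℕ → ℝ} {q q' n : ℕ} (hq : q < n) (hq' : q' < n)
    (h : rank y q n = rank y q' n) : q = q' := by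
  by_contra hne
  rcases below_or y hne with g | g
  · have := rank_lt_rank g hq; omega
  · have := rank_lt_rank g hq'; omega

theorem le_of_rank_le {y : ℕ → ℝ} {q q' n : ℕ} (hq' : q' < n)
    (h : rank y q n ≤ rank y q' n) : y q ≤ y q' := by
  by_contra hlt
  have := rank_lt_rank (y := y) (q := q') (q' := q) (.inl (not_le.1 hlt)) hq'
  omega

/-- The points can be renumbered such that the ordinates are sorted. -/
theorem exists_sort (y : ℕ → ℝ) (n : ℕ) :
    ∃ e : Equiv.Perm (Fin n), (∀ q : Fin n, (e q : ℕ) = rank y q n) ∧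
      ∀ q q' : Fin n, e q ≤ e q' → y q ≤ y q' := by
  let f : Fin n → Fin n := fun q => ⟨rank y q n, rank_lt q.2⟩
  have hf : Function.Injective f := fun q q' h =>
    Fin.ext (rank_inj q.2 q'.2 (congrArg Fin.val h))
  refine ⟨Equiv.ofBijective f (Finite.injective_iff_bijective.1 hf), fun q => rfl, ?_⟩
  intro q q' h
  exact le_of_rank_le q'.2 h

/-- Count the points below the point in the variable `3`. -/
def rankP : Program :=
  .seq (.seq (assign 5 (.const 0)) (assign 4 (.const 0))) <|
  .while (.wordLt (var 4) (.get 0 (.const 0)))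
    (.seq (.ite (.or (.realLt (.get 1 (var 4)) (.get 1 (var 3)))
      (.and (.realEq (.get 1 (var 4)) (.get 1 (var 3))) (.wordLt (var 4) (var 3))))
      (incr 5) .skip) (incr 4))

theorem runs_rankP {B n q : ℕ} {y : ℕ → ℝ} {st : State} (hB : 4 ≤ B) (hn : n < B)
    (h0 : st.word 0 0 = n) (h3 : st.word 3 0 = q) (hq : q < n) (hy : st.real 1 = y) :
    Runs B rankP st (10 + (n * (6 + 40) + 6)) fun st' => st'.word 5 0 = rank y q n := by
  classical
  have hinit : Runs B (.seq (assign 5 (.const 0)) (assign 4 (.const 0))) st 10 fun st' =>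
      st'.word 5 0 = 0 ∧ st'.word 4 0 = 0 := by
    refine (Runs.of_wp ?_).mono (by decide) fun _ _ h => h
    simp [Program.wp, WExpr.Ok, WExpr.eval]
  refine hinit.seq ?_
  rintro st₁ hf ⟨e5, e4⟩
  refine (Runs.while n 40 (I := fun t st' => st'.word 4 0 = t ∧ st'.word 5 0 = rank y q t)
    ⟨e4, by simp [e5, rank]⟩ ?_ ?_).mono le_rfl fun _ _ h => h.2
  · rintro t ht st₂ hf₂ ⟨e4, e5⟩
    have g0 : st₂.word 0 0 = n := by rw [hf₂.word 0 (by decide), hf.word 0 (by decide), h0]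
    have g3 : st₂.word 3 0 = q := by rw [hf₂.word 3 (by decide), hf.word 3 (by decide), h3]
    have gy : st₂.real 1 = y := by rw [hf₂.real 1 (by decide), hf.real 1 (by decide), hy]
    have hrk : rank y q t ≤ t := by
      simpa [rank] using Finset.card_filter_le (Finset.range t) (Below y · q)
    have t1 : t ≤ B := by omega
    have t2 : n ≤ B := by omega
    have t3 : q ≤ B := by omega
    have t4 : rank y q t ≤ B := by omega
    have t5 : 1 ≤ B := by omega
    have t6 : rank y q t < B := by omega
    have t7 : t < B := by omega
    refine ⟨by simp [Test.Ok, WExpr.Ok, WExpr.eval, e4, g0, t1, t2],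
      by simpa [Test.Holds, WExpr.eval, e4, g0], (Runs.of_wp ?_).mono (by decide) fun _ _ h => h⟩
    have hs := rank_succ y q t
    refine ⟨?_, fun hh => ?_, fun hh => ?_⟩
    · simp [Test.Ok, RExpr.Ok, WExpr.Ok, WExpr.eval, e4, g3, t1, t3]
    · have hb : Below y t q := by
        simpa [Test.Holds, RExpr.eval, WExpr.eval, e4, g3, gy, Below] using hh
      rw [if_pos hb] at hs
      simp [Program.wp, WExpr.Ok, WExpr.eval, e4, e5, t1, t4, t5, t6, t7, hs]
    · have hb : ¬ Below y t q := by
        simpa [Test.Holds, RExpr.eval, WExpr.eval, e4, g3, gy, Below] using hh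
      rw [if_neg hb] at hs
      simp [Program.wp, WExpr.Ok, WExpr.eval, e4, e5, t1, t5, t7, hs]
  · rintro st₂ hf₂ ⟨e4, -⟩
    have g0 : st₂.word 0 0 = n := by rw [hf₂.word 0 (by decide), hf.word 0 (by decide), h0]
    simp [Test.Ok, Test.Holds, WExpr.Ok, WExpr.eval, e4, g0]
    omega

/-- Copy the point in the variable `3` to its place in the sorted arrays. -/
def placeP : Program :=
  .seq (.setReal 4 (var 5) (.get 0 (var 3))) <| .seq (.setReal 5 (var 5) (.get 1 (var 3))) <|
  .seq (.setReal 6 (var 5) (.get 2 (var 3))) (incr 3)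

/-- Sort the points by their ordinates. -/
def sortP : Program :=
  .seq (assign 3 (.const 0)) <|
  .while (.wordLt (var 3) (.get 0 (.const 0))) (.seq rankP placeP)

/-- Computing each rank by comparing with all points takes quadratic time, within the overall bound.
Distinct points have distinct ranks, so no stored value is overwritten. -/
theorem runs_sortP {B n : ℕ} {x y w : ℕ → ℝ} {st : State} (hB : 4 ≤ B) (hn : n < B)
    (h0 : st.word 0 0 = n) (hx : st.real 0 = x) (hy : st.real 1 = y) (hw : st.real 2 = w) :
    Runs B sortP st (3 + (n * (6 + ((10 + (n * (6 + 40) + 6)) + 40)) + 6)) fun st' =>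
      ∀ q < n, st'.real 4 (rank y q n) = x q ∧ st'.real 5 (rank y q n) = y q ∧
        st'.real 6 (rank y q n) = w q := by
  have hinit : Runs B (assign 3 (.const 0)) st 3 fun st' => st'.word 3 0 = 0 := by
    refine (Runs.of_wp ?_).mono (by decide) fun _ _ h => h
    simp [Program.wp, WExpr.Ok, WExpr.eval]
  refine hinit.seq ?_
  rintro st₁ hf e3
  refine (Runs.while n ((10 + (n * (6 + 40) + 6)) + 40)
    (I := fun t st' => st'.word 3 0 = t ∧ ∀ q < t, st'.real 4 (rank y q n) = x q ∧
      st'.real 5 (rank y q n) = y q ∧ st'.real 6 (rank y q n) = w q)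
    ⟨e3, by omega⟩ ?_ ?_).mono le_rfl fun _ _ h => h.2
  · rintro t ht st₂ hf₂ ⟨e3, hI⟩
    have g0 : st₂.word 0 0 = n := by rw [hf₂.word 0 (by decide), hf.word 0 (by decide), h0]
    have gy : st₂.real 1 = y := by rw [hf₂.real 1 (by decide), hf.real 1 (by decide), hy]
    refine ⟨?_, by simpa [Test.Holds, WExpr.eval, e3, g0], ?_⟩
    · simp [Test.Ok, WExpr.Ok, WExpr.eval, e3, g0]
      omega
    refine (runs_rankP hB hn g0 e3 ht gy).seq ?_
    intro st₃ hf₃ e5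
    have k3 : st₃.word 3 0 = t := by rw [hf₃.word 3 (by decide), e3]
    have kx : st₃.real 0 = x := by
      rw [hf₃.real 0 (by decide), hf₂.real 0 (by decide), hf.real 0 (by decide), hx]
    have ky : st₃.real 1 = y := by rw [hf₃.real 1 (by decide), gy]
    have kw : st₃.real 2 = w := by
      rw [hf₃.real 2 (by decide), hf₂.real 2 (by decide), hf.real 2 (by decide), hw]
    have hrk := rank_lt (y := y) ht
    have t1 : t ≤ B := by omega
    have t2 : t < B := by omega
    have t3 : rank y t n ≤ B := by omega
    have t4 : 1 ≤ B := by omega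
    refine (Runs.of_wp ?_).mono (T' := 40) (by decide) fun _ _ h => h
    simp [placeP, Program.wp, WExpr.Ok, RExpr.Ok, WExpr.eval, RExpr.eval, k3, e5, kx, ky, kw, t1,
      t2, t3, t4, hf₃.real 4 (by decide), hf₃.real 5 (by decide), hf₃.real 6 (by decide)]
    intro q hq
    by_cases he : q = t
    · subst he; simp
    · have hne : rank y q n ≠ rank y t n := fun h => he (rank_inj (by omega) ht h)
      simpa [Function.update_of_ne hne] using hI q (by omega)
  · rintro st₂ hf₂ ⟨e3, -⟩
    have g0 : st₂.word 0 0 = n := by rw [hf₂.word 0 (by decide), hf.word 0 (by decide), h0]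
    simp [Test.Ok, Test.Holds, WExpr.Ok, WExpr.eval, e3, g0]
    omega

/-- Compute a power of two that is at least `n`, and the base of the encodings. -/
def sizeP : Program :=
  .seq (assign 2 (.const 1)) <|
  .seq (.while (.wordLt (var 2) (.get 0 (.const 0))) (assign 2 (.mul (.const 2) (var 2)))) <|
  assign 7 (.mul (.const 4) (.add (.get 0 (.const 0)) (.const 1)))

theorem runs_sizeP {B n : ℕ} {st : State} (hB : 4 * (n + 1) ≤ B) (h0 : st.word 0 0 = n) :
    Runs B sizeP st (3 + ((Nat.clog 2 n * 12 + 6) + 10)) fun st' =>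
      st'.word 2 0 = 2 ^ Nat.clog 2 n ∧ st'.word 7 0 = 4 * (n + 1) := by
  have hinit : Runs B (assign 2 (.const 1)) st 3 fun st' => st'.word 2 0 = 1 := by
    refine (Runs.of_wp ?_).mono (by decide) fun _ _ h => h
    simp [Program.wp, WExpr.Ok, WExpr.eval]
    omega
  refine hinit.seq ?_
  rintro st₁ hf e2
  refine (Runs.while (Nat.clog 2 n) 6 (I := fun t st' => st'.word 2 0 = 2 ^ t)
    (by simpa using e2) ?_ ?_).seq ?_
  · rintro t ht st₂ hf₂ e2
    have g0 : st₂.word 0 0 = n := by rw [hf₂.word 0 (by decide), hf.word 0 (by decide), h0]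
    have h1 : 2 ^ t < n := (Nat.lt_clog_iff_pow_lt (by omega)).1 ht
    refine ⟨?_, by simpa [Test.Holds, WExpr.eval, e2, g0], (Runs.of_wp ?_).mono (by decide)
      fun _ _ h => h⟩
    · simp [Test.Ok, WExpr.Ok, WExpr.eval, e2, g0]
      omega
    · simp [Program.wp, WExpr.Ok, WExpr.eval, e2, pow_succ, mul_comm]
      omega
  · rintro st₂ hf₂ e2
    have g0 : st₂.word 0 0 = n := by rw [hf₂.word 0 (by decide), hf.word 0 (by decide), h0]
    have h1 : n ≤ 2 ^ Nat.clog 2 n := Nat.le_pow_clog (by omega) n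
    have h2 : 2 ^ Nat.clog 2 n ≤ B := by
      -- The last power of two before the final doubling is below `n`, so the result stays below `2
      -- n`.
      rcases Nat.eq_zero_or_pos (Nat.clog 2 n) with h | h
      · rw [h]; omega
      · obtain ⟨r, hr⟩ : ∃ r, Nat.clog 2 n = r + 1 := ⟨_, (Nat.succ_pred_eq_of_pos h).symm⟩
        have h3 : 2 ^ r < n := (Nat.lt_clog_iff_pow_lt (by omega)).1 (by omega)
        rw [hr, pow_succ]
        omega
    simp [Test.Ok, Test.Holds, WExpr.Ok, WExpr.eval, e2, g0, h2, h1]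
    omega
  · intro st₂ hf₂ e2
    have g0 : st₂.word 0 0 = n := by rw [hf₂.word 0 (by decide), hf.word 0 (by decide), h0]
    refine (Runs.of_wp ?_).mono (by decide) fun _ _ h => h
    simp [Program.wp, WExpr.Ok, WExpr.eval, e2, g0]
    omega

end MinWeightRect

/-! ### Tables of prefix sums for all cuts. -/

namespace MinWeightRect
open RealRAM
namespace Grid
variable {D : Grid}

/-- The entry of the tables for the cut in the variable `3` and the row in the variable `4`. -/
def cellE : WExpr := .add (.mul (var 3) (var 7)) (var 4)

def nextE : WExpr := .add (.mul (var 3) (var 7)) (.add (var 4) (.const 1))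

/-- Add a row to the prefix sums of a cut. -/
def stepP : Program :=
  .seq (.ite (.and (.wordLt (var 4) (.get 0 (.const 0)))
      (.or (.and (.wordLt (var 3) (.get 0 (.const 0))) (.realLt (.get 4 (var 4)) (.get 4 (var 3))))
        (.and (.not (.wordLt (var 3) (.get 0 (.const 0))))
          (.not (.realLt (.get 4 (.sub (var 3) (.get 0 (.const 0)))) (.get 4 (var 4)))))))
    (.seq (.setWord 6 nextE (.add (.get 6 cellE) (.const 1)))
      (.setReal 7 nextE (.add (.get 7 cellE) (.get 6 (var 4)))))
    (.seq (.setWord 6 nextE (.get 6 cellE)) (.setReal 7 nextE (.get 7 cellE)))) <|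
  incr 4

/-- Compute the prefix sums of a cut. -/
def cutP : Program :=
  .seq (.seq (.setWord 6 (.mul (var 3) (var 7)) (.const 0)) <|
    .seq (.setReal 7 (.mul (var 3) (var 7)) (.const 0)) (assign 4 (.const 0))) <|
  .seq (.while (.wordLt (var 4) (var 2)) stepP) (incr 3)

/-- Compute the prefix sums of all cuts. -/
def fillP : Program :=
  .seq (assign 3 (.const 0)) <|
  .while (.wordLt (var 3) (.mul (.const 2) (.get 0 (.const 0)))) cutP

/-- The tables are correct for the cuts before `z` and for the first `d` rows of the cut `z`. -/
def Filled (D : Grid) (z d : ℕ) (st : State) : Prop :=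
  ∀ z' d', d' ≤ D.N → (z' < z ∨ z' = z ∧ d' < d) →
    st.word 6 (z' * D.M + d') = D.cnt z' d' ∧ st.real 7 (z' * D.M + d') = D.cw z' d'

/-- The memory while the tables are filled. -/
structure Base (D : Grid) (B : ℕ) (st : State) : Prop where
  fits : D.Fits B
  n : st.word 0 0 = D.n
  k : st.word 0 1 = D.k
  N : st.word 2 0 = D.N
  M : st.word 7 0 = D.M
  X : st.real 4 = D.X
  W : st.real 6 = D.W

theorem Base.frame {B : ℕ} {st st' : State} {P : Program} (h : D.Base B st) (hf : Frame P st st')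
    (h0 : 0 ∉ P.wordMods ∧ 2 ∉ P.wordMods ∧ 7 ∉ P.wordMods)
    (h1 : 4 ∉ P.realMods ∧ 6 ∉ P.realMods) : D.Base B st' :=
  { fits := h.fits
    n := by rw [hf.word _ h0.1, h.n]
    k := by rw [hf.word _ h0.1, h.k]
    N := by rw [hf.word _ h0.2.1, h.N]
    M := by rw [hf.word _ h0.2.2, h.M]
    X := by rw [hf.real _ h1.1, h.X]
    W := by rw [hf.real _ h1.2, h.W] }

theorem Filled.of_update {z d : ℕ} {st st' : State} (hN : D.N < D.M)
    (h : D.Filled z d st) (hd : d ≤ D.N)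
    (hT : st'.word 6 = Function.update (st.word 6) (z * D.M + d) (D.cnt z d))
    (hR : st'.real 7 = Function.update (st.real 7) (z * D.M + d) (D.cw z d)) :
    D.Filled z (d + 1) st' := by
  intro z' d' hd' hz
  by_cases he : z' = z ∧ d' = d
  · obtain ⟨rfl, rfl⟩ := he
    simp [hT, hR]
  -- Rows are at most `N < M`, so an address determines its cut and its row.
  · have hne : z' * D.M + d' ≠ z * D.M + d := by
      intro h
      obtain ⟨h1, h2⟩ := eq_of_base (by omega) (by omega) h
      exact he ⟨h1, h2⟩
    rw [hT, hR, Function.update_of_ne hne, Function.update_of_ne hne]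
    exact h z' d' hd' (by omega)

theorem Base.runs_stepP {B z d : ℕ} {st : State} (h : D.Base B st) (h3 : st.word 3 0 = z)
    (h4 : st.word 4 0 = d) (hz : z < 2 * D.n) (hd : d < D.N) (hF : D.Filled z (d + 1) st) :
    Runs B stepP st stepP.maxCost fun st' => D.Filled z (d + 1 + 1) st' ∧ st'.word 4 0 = d + 1 := by
  have hM := h.fits.M_le
  have hN := h.fits.N
  have hn := h.fits.two_n_le
  have h44 := h.fits.four_le
  have hzM : z < D.M ^ 1 := by rw [pow_one]; unfold Grid.M; omega
  obtain ⟨u1, u2, -⟩ := h.fits.step (c := d) (by omega) hzM (by omega)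
  obtain ⟨-, u3, -⟩ := h.fits.step (c := d + 1) (by omega) hzM (by omega)
  obtain ⟨v1, v2⟩ := hF z d (by omega) (by omega)
  have hc := cnt_le (D := D) z d
  have t1 : z ≤ B := by omega
  have t2 : d ≤ B := by omega
  have t3 : D.n ≤ B := by omega
  have t4 : D.cnt z d ≤ B := by omega
  have t5 : 1 ≤ B := by omega
  have t6 : D.cnt z d < B := by omega
  have t7 : d < B := by omega
  have s1 := D.cutSum_succ (fun _ => 1) z d
  have s2 := D.cutSum_succ D.W z d
  rw [← cnt.eq_def, ← cnt.eq_def] at s1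
  rw [← cw.eq_def, ← cw.eq_def] at s2
  refine Runs.of_wp ⟨?_, fun hh => ?_, fun hh => ?_⟩
  · simp [Test.Ok, RExpr.Ok, WExpr.Ok, WExpr.eval, h3, h4, h.n, t1, t2, t3]
  · have hin : d < D.n ∧ D.InCut z d := by
      simp [Test.Holds, RExpr.eval, WExpr.eval, h3, h4, h.n, h.X] at hh
      refine ⟨hh.1, ?_⟩
      unfold InCut
      split_ifs with hlt
      · rcases hh.2 with g | g
        · exact g.2
        · omega
      · rcases hh.2 with g | g
        · omega
        · exact g.2
    rw [if_pos hin] at s1 s2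
    simp [Program.wp, WExpr.Ok, RExpr.Ok, WExpr.eval, RExpr.eval, nextE, cellE, h3, h4, h.M, h.W,
      v1, v2, t1, t2, t4, t5, t6, t7, u1, u2, u3, hM]
    exact hF.of_update hN hd (by simp [s1]) (by simp [s2])
  · have hin : ¬ (d < D.n ∧ D.InCut z d) := by
      rintro ⟨g1, g2⟩
      refine hh ?_
      simp [Test.Holds, RExpr.eval, WExpr.eval, h3, h4, h.n, h.X]
      refine ⟨g1, ?_⟩
      unfold InCut at g2
      split_ifs at g2 with hlt
      · exact .inl ⟨hlt, g2⟩
      · exact .inr ⟨by omega, g2⟩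
    rw [if_neg hin] at s1 s2
    simp [Program.wp, WExpr.Ok, RExpr.Ok, WExpr.eval, RExpr.eval, nextE, cellE, h3, h4, h.M,
      v1, v2, t1, t2, t4, t5, t7, u1, u2, u3, hM]
    exact hF.of_update hN hd (by simp [s1]) (by simp [s2])

theorem Base.runs_cutP {B z : ℕ} {st : State} (h : D.Base B st) (h3 : st.word 3 0 = z)
    (hz : z < 2 * D.n) (hF : D.Filled z 0 st) :
    Runs B cutP st (20 + ((D.N * (6 + stepP.maxCost) + 6) + 10)) fun st' =>
      D.Filled (z + 1) 0 st' ∧ st'.word 3 0 = z + 1 := by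
  have hM := h.fits.M_le
  have hN := h.fits.N
  have hNB := h.fits.N_le
  have hn := h.fits.two_n_le
  have h44 := h.fits.four_le
  have hzM : z < D.M ^ 1 := by rw [pow_one]; unfold Grid.M; omega
  obtain ⟨u1, -, -⟩ := h.fits.step (c := 0) (by omega) hzM (by unfold Grid.M; omega)
  have t1 : z ≤ B := by omega
  have t2 : z < B := by omega
  have t3 : 1 ≤ B := by omega
  have hinit : Runs B (.seq (.setWord 6 (.mul (var 3) (var 7)) (.const 0)) <|
      .seq (.setReal 7 (.mul (var 3) (var 7)) (.const 0)) (assign 4 (.const 0))) st 20 fun st' =>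
      D.Filled z 1 st' ∧ st'.word 4 0 = 0 := by
    refine (Runs.of_wp ?_).mono (by decide) fun _ _ h => h
    simp [Program.wp, WExpr.Ok, RExpr.Ok, WExpr.eval, RExpr.eval, h3, h.M, t1, u1, hM]
    have c1 : D.cnt z 0 = 0 := cnt_zero z
    have c2 : D.cw z 0 = 0 := D.cutSum_zero _ z
    exact hF.of_update hN (Nat.zero_le _) (by simp [c1]) (by simp [c2])
  refine hinit.seq ?_
  rintro st₁ hf₁ ⟨hF₁, e4⟩
  have b₁ := h.frame hf₁ (by decide) (by decide)
  have e3 : st₁.word 3 0 = z := by rw [hf₁.word 3 (by decide), h3]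
  refine (Runs.while D.N stepP.maxCost (I := fun t st' => D.Filled z (t + 1) st' ∧
    st'.word 4 0 = t) ⟨hF₁, e4⟩ ?_ ?_).seq ?_
  · rintro t ht st₂ hf₂ ⟨hF₂, e4⟩
    have b₂ := b₁.frame hf₂ (by decide) (by decide)
    refine ⟨?_, by simpa [Test.Holds, WExpr.eval, e4, b₂.N],
      b₂.runs_stepP (by rw [hf₂.word 3 (by decide), e3]) e4 hz ht hF₂⟩
    simp [Test.Ok, WExpr.Ok, WExpr.eval, e4, b₂.N]
    omega
  · rintro st₂ hf₂ ⟨-, e4⟩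
    have b₂ := b₁.frame hf₂ (by decide) (by decide)
    simp [Test.Ok, Test.Holds, WExpr.Ok, WExpr.eval, e4, b₂.N]
    omega
  · rintro st₂ hf₂ ⟨hF₂, -⟩
    have g3 : st₂.word 3 0 = z := by rw [hf₂.word 3 (by decide), e3]
    refine (Runs.of_wp ?_).mono (by decide) fun _ _ h => h
    simp [Program.wp, WExpr.Ok, WExpr.eval, g3, t1, t2, t3]
    intro z' d' hd' hc
    simpa using hF₂ z' d' hd' (by omega)

theorem Base.runs_fillP {B : ℕ} {st : State} (h : D.Base B st) :
    Runs B fillP st (3 + (2 * D.n * (8 + (20 + ((D.N * (6 + stepP.maxCost) + 6) + 10))) + 8))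
      D.Env := by
  have hn := h.fits.two_n_le
  have h44 := h.fits.four_le
  have hinit : Runs B (assign 3 (.const 0)) st 3 fun st' => st'.word 3 0 = 0 := by
    refine (Runs.of_wp ?_).mono (by decide) fun _ _ h => h
    simp [Program.wp, WExpr.Ok, WExpr.eval]
  refine hinit.seq ?_
  intro st₁ hf₁ e3
  have b₁ := h.frame hf₁ (by decide) (by decide)
  refine (Runs.while (2 * D.n) (20 + ((D.N * (6 + stepP.maxCost) + 6) + 10))
    (I := fun t st' => D.Filled t 0 st' ∧ st'.word 3 0 = t)
    ⟨fun z d _ hz => by omega, e3⟩ ?_ ?_).mono le_rfl ?_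
  · rintro t ht st₂ hf₂ ⟨hF₂, e3⟩
    have b₂ := b₁.frame hf₂ (by decide) (by decide)
    refine ⟨?_, by simpa [Test.Holds, WExpr.eval, e3, b₂.n], b₂.runs_cutP e3 ht hF₂⟩
    simp [Test.Ok, WExpr.Ok, WExpr.eval, e3, b₂.n]
    omega
  · rintro st₂ hf₂ ⟨-, e3⟩
    have b₂ := b₁.frame hf₂ (by decide) (by decide)
    simp [Test.Ok, Test.Holds, WExpr.Ok, WExpr.eval, e3, b₂.n]
    omega
  · rintro st₂ hf₂ ⟨hF₂, -⟩
    have b₂ := b₁.frame hf₂ (by decide) (by decide)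
    exact
      { n := b₂.n
        k := b₂.k
        N := b₂.N
        M := b₂.M
        X := b₂.X
        table := fun z hz d hd => (hF₂ z d hd (.inl hz)).1
        weights := fun z hz d hd => (hF₂ z d hd (.inl hz)).2 }

end Grid
end MinWeightRect

/-! ### Rectangles in the plane versus boxes in the grid. -/

namespace MinWeightRect
namespace Grid
variable {D : Grid}

open Classical in
/-- The points between two cuts in the rows from `u` to `v`. -/
noncomputable def box (D : Grid) (u v i j : ℕ) : Finset ℕ :=
  (Finset.range D.n).filter fun r => (D.X i ≤ D.X r ∧ D.X r ≤ D.X (j - D.n)) ∧ u ≤ r ∧ r ≤ v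

open Classical in
-- The right cut is the disjoint union of the left cut and the closed slab.
theorem cutSum_pair {A : Type} [AddCommMonoid A] (f : ℕ → A) {i j : ℕ} (h : D.Pair i j) (d : ℕ) :
    D.cutSum f j d = D.cutSum f i d +
      ∑ r ∈ Finset.range d, if r < D.n ∧ D.X i ≤ D.X r ∧ D.X r ≤ D.X (j - D.n) then f r else 0 := by
  unfold cutSum
  rw [← Finset.sum_add_distrib]
  refine Finset.sum_congr rfl fun r _ => ?_
  unfold InCut
  rw [if_pos h.left, if_neg (not_lt.2 h.right)]
  by_cases hn : r < D.n
  · by_cases h1 : D.X r < D.X i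
    · have h2 : D.X r ≤ D.X (j - D.n) := h1.le.trans h.le
      simp [hn, h1, h2, not_le.2 h1]
    · simp [hn, h1, not_lt.1 h1]
  · simp [hn]

open Classical in
theorem sum_box {A : Type} [AddCommMonoid A] (f : ℕ → A) {u v i j : ℕ} (huv : u ≤ v) :
    ∑ r ∈ Finset.range (v + 1), (if r < D.n ∧ D.X i ≤ D.X r ∧ D.X r ≤ D.X (j - D.n) then f r else 0)
      = ∑ r ∈ Finset.range u, (if r < D.n ∧ D.X i ≤ D.X r ∧ D.X r ≤ D.X (j - D.n) then f r else 0)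
        + ∑ r ∈ D.box u v i j, f r := by
  rw [← Finset.sum_range_add_sum_Ico _ (show u ≤ v + 1 by omega)]
  congr 1
  rw [← Finset.sum_filter]
  refine Finset.sum_congr ?_ fun _ _ => rfl
  ext r
  simp only [box, Finset.mem_filter, Finset.mem_Ico, Finset.mem_range]
  constructor
  · rintro ⟨⟨h1, h2⟩, h3, h4⟩
    exact ⟨h3, h4, h1, by omega⟩
  · rintro ⟨h3, h4, h1, h2⟩
    exact ⟨⟨h1, by omega⟩, h3, h4⟩

theorem up_one {u v i j : ℕ} (h : D.Pair i j) (huv : u ≤ v) :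
    D.up 1 u v i j = (D.box u v i j).card := by
  have h1 := cutSum_pair (fun _ => 1) h u
  have h2 := cutSum_pair (fun _ => 1) h (v + 1)
  have h3 := sum_box (D := D) (fun _ => 1) (i := i) (j := j) huv
  rw [Finset.sum_const, smul_eq_mul, mul_one] at h3
  unfold up win cnt
  rw [mul_one, mul_one, h1, h2, h3]
  omega

theorem tot_one {u v i j : ℕ} (h : D.Pair i j) (huv : u ≤ v) :
    D.tot 1 u v i j = ∑ r ∈ D.box u v i j, D.W r := by
  have h1 := cutSum_pair D.W h u
  have h2 := cutSum_pair D.W h (v + 1)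
  have h3 := sum_box (D := D) D.W (i := i) (j := j) huv
  unfold tot wwin cw
  rw [mul_one, mul_one, h1, h2, h3]
  ring

/-- The grid consists of the points `p` with the weights `w`, sorted by their ordinates `Y`. -/
structure Sorted (D : Grid) (Y : ℕ → ℝ) (p : Fin D.n → ℝ × ℝ) (w : Fin D.n → ℝ)
    (e : Equiv.Perm (Fin D.n)) : Prop where
  x : ∀ q, D.X (e q) = (p q).1
  y : ∀ q, Y (e q) = (p q).2
  w : ∀ q, D.W (e q) = w q
  mono : ∀ r r', r ≤ r' → r' < D.n → Y r ≤ Y r'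

section Sorted
variable {Y : ℕ → ℝ} {p : Fin D.n → ℝ × ℝ} {w : Fin D.n → ℝ} {e : Equiv.Perm (Fin D.n)}

open Classical in
/-- The points of the grid in a rectangle. -/
noncomputable def inside (D : Grid) (Y : ℕ → ℝ) (lo hi : ℝ × ℝ) : Finset ℕ :=
  (Finset.range D.n).filter fun r =>
    (lo.1 ≤ D.X r ∧ D.X r ≤ hi.1) ∧ lo.2 ≤ Y r ∧ Y r ≤ hi.2

theorem Sorted.sum_inside {A : Type} [AddCommMonoid A] (h : D.Sorted Y p w e) (f : ℕ → A)
    (lo hi : ℝ × ℝ) : ∑ q ∈ enclosed p lo hi, f (e q) = ∑ r ∈ D.inside Y lo hi, f r := by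
  classical
  unfold enclosed inside
  rw [Finset.sum_filter, Finset.sum_filter, ← Fin.sum_univ_eq_sum_range
    (fun r => if (lo.1 ≤ D.X r ∧ D.X r ≤ hi.1) ∧ lo.2 ≤ Y r ∧ Y r ≤ hi.2 then f r else 0)]
  refine Eq.trans ?_ (Equiv.sum_comp e _)
  refine Finset.sum_congr rfl fun q _ => ?_
  rw [h.x, h.y]
  refine if_congr ?_ rfl rfl
  rw [Set.mem_Icc, Prod.le_def, Prod.le_def]
  tauto

theorem Sorted.card_enclosed (h : D.Sorted Y p w e) (lo hi : ℝ × ℝ) :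
    (enclosed p lo hi).card = (D.inside Y lo hi).card := by
  have := h.sum_inside (fun _ => 1) lo hi
  simpa using this

theorem Sorted.weight_eq (h : D.Sorted Y p w e) (lo hi : ℝ × ℝ) :
    weight p w lo hi = ∑ r ∈ D.inside Y lo hi, D.W r := by
  rw [← h.sum_inside]
  exact Finset.sum_congr rfl fun q _ => (h.w q).symm

/-- A row outside the range from `u` to `v` has an ordinate outside the rectangle, because `Full`
makes the ordinates jump at both ends of the range. -/
theorem Sorted.inside_eq_box (h : D.Sorted Y p w e) {u v i j : ℕ} (huv : u ≤ v)
    (hf : Full D.n Y u v) :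
    D.inside Y (D.X i, Y u) (D.X (j - D.n), Y v) = D.box u v i j := by
  classical
  obtain ⟨hv, hu, hv'⟩ := hf
  unfold inside box
  refine Finset.filter_congr fun r hr => and_congr_right fun _ => ?_
  rw [Finset.mem_range] at hr
  constructor
  · rintro ⟨h1, h2⟩
    constructor
    · by_contra hlt
      rcases hu with hu | hu
      · omega
      · have := h.mono r (u - 1) (by omega) (by omega)
        linarith
    · by_contra hlt
      rcases hv' with hv' | hv'
      · omega
      · have := h.mono (v + 1) r (by omega) hr
        linarith
  · rintro ⟨h1, h2⟩
    exact ⟨h.mono _ _ h1 hr, h.mono _ _ h2 hv⟩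

/-- Every set of points in a rectangle is the set of points of some box. -/
theorem Sorted.exists_box (h : D.Sorted Y p w e) (lo hi : ℝ × ℝ)
    (hne : (D.inside Y lo hi).Nonempty) :
    ∃ u v i j, u ≤ v ∧ Full D.n Y u v ∧ D.Pair i j ∧ D.box u v i j = D.inside Y lo hi := by
  classical
  have hmem : ∀ r, r ∈ D.inside Y lo hi ↔
      r < D.n ∧ (lo.1 ≤ D.X r ∧ D.X r ≤ hi.1) ∧ lo.2 ≤ Y r ∧ Y r ≤ hi.2 := by
    intro r
    simp [inside]
  -- The slab is spanned by a leftmost and a rightmost enclosed point. The rows are all those with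
  -- ordinates in the rectangle, whether or not their points lie in the slab, so equal ordinates are
  -- never split.
  obtain ⟨a, ha, ha'⟩ := Finset.exists_min_image _ D.X hne
  obtain ⟨b, hb, hb'⟩ := Finset.exists_max_image _ D.X hne
  have hex : ∃ r, r < D.n ∧ lo.2 ≤ Y r := ⟨a, ((hmem a).1 ha).1, ((hmem a).1 ha).2.2.1⟩
  have han := ((hmem a).1 ha).1
  have hbn := ((hmem b).1 hb).1
  have hu := Nat.find_spec hex
  have humin := fun r (hr : r < Nat.find hex) => Nat.find_min hex hr
  set u := Nat.find hex
  have hv : Y (Nat.findGreatest (fun r => Y r ≤ hi.2) (D.n - 1)) ≤ hi.2 :=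
    Nat.findGreatest_spec (P := fun r => Y r ≤ hi.2) (m := a) (by omega) ((hmem a).1 ha).2.2.2
  have hvn : Nat.findGreatest (fun r => Y r ≤ hi.2) (D.n - 1) ≤ D.n - 1 := Nat.findGreatest_le _
  have hvmax : ∀ r, r < D.n → Y r ≤ hi.2 →
      r ≤ Nat.findGreatest (fun r => Y r ≤ hi.2) (D.n - 1) :=
    fun r hr hr' => Nat.le_findGreatest (by omega) hr'
  set v := Nat.findGreatest (fun r => Y r ≤ hi.2) (D.n - 1)
  have hle : ∀ r, r ∈ D.inside Y lo hi → u ≤ r ∧ r ≤ v := by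
    intro r hr
    obtain ⟨h1, -, h2, h3⟩ := (hmem r).1 hr
    refine ⟨?_, hvmax r h1 h3⟩
    by_contra hlt
    exact humin r (by omega) ⟨h1, h2⟩
  refine ⟨u, v, a, D.n + b, (hle a ha).1.trans (hle a ha).2, ⟨by omega, ?_, ?_⟩,
    ⟨han, by omega, by omega, ?_⟩, ?_⟩
  · rcases Nat.eq_zero_or_pos u with h0 | h0
    · exact .inl h0
    · refine .inr ?_
      have := humin (u - 1) (by omega)
      push Not at this
      exact (this (by omega)).trans_le hu.2
  · by_cases hv1 : v + 1 = D.n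
    · exact .inl hv1
    · refine .inr ?_
      by_contra hlt
      have := hvmax (v + 1) (by omega) ((not_lt.1 hlt).trans hv)
      omega
  · rw [Nat.add_sub_cancel_left]
    exact ha' b hb
  · ext r
    rw [hmem]
    simp only [box, Finset.mem_filter, Finset.mem_range, Nat.add_sub_cancel_left]
    constructor
    · rintro ⟨h1, ⟨h2, h3⟩, h4, h5⟩
      exact ⟨h1, ⟨((hmem a).1 ha).2.1.1.trans h2, h3.trans ((hmem b).1 hb).2.1.2⟩,
        hu.2.trans (h.mono _ _ h4 h1), (h.mono _ _ h5 (by omega)).trans hv⟩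
    · intro hr
      have hr' := (hmem r).2 hr
      exact ⟨hr.1, ⟨ha' r hr', hb' r hr'⟩, hle r hr'⟩

/-- Candidates are rectangles with `k` points, and each rectangle with `k` points has a candidate of
the same weight. Here `k ≠ 0` is needed, because a candidate slab contains its two bounding points
and an empty set need not come from a box. -/
theorem Sorted.correctOutput (h : D.Sorted Y p w e) (hk : D.k ≠ 0) {st : RealRAM.State}
    (hb : D.Best Y Set.univ st) : CorrectOutput D.k p w st := by
  have hcand : ∀ u v i j, D.Cand Y u v i j →
      Encloses p D.k (D.X i, Y u) (D.X (j - D.n), Y v) ∧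
        weight p w (D.X i, Y u) (D.X (j - D.n), Y v) = D.tot 1 u v i j := by
    rintro u v i j ⟨c1, c2, c3, c4⟩
    refine ⟨⟨⟨c3.le, h.mono _ _ c1 c2.1⟩, ?_⟩, ?_⟩
    · rw [h.card_enclosed, h.inside_eq_box c1 c2, ← up_one c3 c1, c4]
    · rw [h.weight_eq, h.inside_eq_box c1 c2, tot_one c3 c1]
  have hrect : ∀ lo hi : ℝ × ℝ, Encloses p D.k lo hi →
      ∃ u v i j, D.Cand Y u v i j ∧ D.tot 1 u v i j = weight p w lo hi := by
    rintro lo hi ⟨-, hc⟩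
    rw [h.card_enclosed] at hc
    obtain ⟨u, v, i, j, c1, c2, c3, c4⟩ := h.exists_box lo hi
      (Finset.card_pos.1 (by omega))
    exact ⟨u, v, i, j, ⟨c1, c2, c3, by rw [up_one c3 c1, c4, hc]⟩,
      by rw [tot_one c3 c1, c4, h.weight_eq]⟩
  rcases hb with ⟨b1, b2⟩ | ⟨b1, u, v, i, j, b2, -, b4, b5, b6, b7, b8⟩
  · refine .inr ⟨b1, ?_⟩
    rintro ⟨lo, hi, hr⟩
    obtain ⟨u, v, i, j, hc, -⟩ := hrect lo hi hr
    exact b2 u v i j trivial hc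
  · refine .inl ⟨b1, ?_⟩
    rw [b4, b5, b6, b7]
    obtain ⟨h1, h2⟩ := hcand u v i j b2
    refine ⟨h1, fun lo hi hr => ?_⟩
    obtain ⟨u', v', i', j', hc, ht⟩ := hrect lo hi hr
    rw [h2, ← ht]
    exact b8 u' v' i' j' trivial hc

end Sorted
end Grid
end MinWeightRect

/-! ### Assembling the program, the case of no points, and the running time. -/

namespace MinWeightRect
open RealRAM

/-- Find a best rectangle with `k > 0` points. -/
def solveP : Program :=
  .seq sortP <| .seq sizeP <| .seq Grid.fillP <| .seq Grid.rootP <| .seq Grid.descendP Grid.scanP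

theorem clog_bounds (n : ℕ) :
    n ≤ 2 ^ Nat.clog 2 n ∧ 2 ^ Nat.clog 2 n ≤ 2 * n + 1 ∧ (1 ≤ n → 2 ^ Nat.clog 2 n ≤ 2 * n) ∧
      Nat.clog 2 n ≤ n := by
  have h1 : n ≤ 2 ^ Nat.clog 2 n := Nat.le_pow_clog (by omega) n
  rcases Nat.eq_zero_or_pos (Nat.clog 2 n) with h | h
  · rw [h] at h1 ⊢
    refine ⟨h1, ?_, ?_, ?_⟩ <;> simp
    omega
  · obtain ⟨r, hr⟩ : ∃ r, Nat.clog 2 n = r + 1 := ⟨_, (Nat.succ_pred_eq_of_pos h).symm⟩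
    have h2 : 2 ^ r < n := (Nat.lt_clog_iff_pow_lt (by omega)).1 (by omega)
    have h3 : r < 2 ^ r := Nat.lt_two_pow_self
    rw [hr] at h1 ⊢
    rw [pow_succ] at h1 ⊢
    omega

theorem input_word (n k : ℕ) (p : Fin n → ℝ × ℝ) (w : Fin n → ℝ) :
    (input n k p w).word 0 0 = n ∧ (input n k p w).word 0 1 = k ∧
      ∀ a, a ≠ 0 → ∀ i, (input n k p w).word a i = 0 := by
  refine ⟨by simp [input], by simp [input], fun a ha i => by simp [input, ha]⟩

theorem input_real {n : ℕ} (k : ℕ) (p : Fin n → ℝ × ℝ) (w : Fin n → ℝ) (q : Fin n) :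
    (input n k p w).real 0 q = (p q).1 ∧ (input n k p w).real 1 q = (p q).2 ∧
      (input n k p w).real 2 q = w q := by
  simp [input]

/-- The time for finding a best rectangle. -/
def solveTime (n N L : ℕ) : ℕ :=
  (3 + (n * (6 + ((10 + (n * (6 + 40) + 6)) + 40)) + 6)) + ((3 + ((L * 12 + 6) + 10)) +
  ((3 + (2 * n * (8 + (20 + ((N * (6 + Grid.stepP.maxCost) + 6) + 10))) + 8)) +
  ((20 + (n * (6 + (3 + ((n * (6 + (Program.seq Grid.pairP (incr 4)).maxCost) + 6) + 6))) + 6)) +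
  ((L * (5 + (10 + (30 * N ^ 2 * (6 + Grid.expandP.maxCost) + 6))) + 5) +
  (30 * N ^ 2 * (6 + (Program.seq Grid.loadP (.seq Grid.recordP (incr 14))).maxCost) + 6)))))

/-- The exponent is `18 = 3 · 6`: a key has six digits, and the base is at most the cube of `n + k +
2`. -/
theorem base_pow_le (n k : ℕ) : (4 * (n + 1)) ^ 6 ≤ (n + k + 2) ^ 18 := by
  have h : 4 * (n + 1) ≤ (n + k + 2) ^ 3 := by
    calc 4 * (n + 1) ≤ 2 ^ 2 * (n + k + 2) := by omega
      _ ≤ (n + k + 2) ^ 2 * (n + k + 2) :=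
        Nat.mul_le_mul_right _ (Nat.pow_le_pow_left (by omega) 2)
      _ = (n + k + 2) ^ 3 := by ring
  calc (4 * (n + 1)) ^ 6 ≤ ((n + k + 2) ^ 3) ^ 6 := Nat.pow_le_pow_left h 6
    _ = (n + k + 2) ^ 18 := by rw [← pow_mul]

theorem queue_bound_lt (n : ℕ) :
    (Nat.clog 2 n + 2) * (30 * (2 ^ Nat.clog 2 n) ^ 2) < (4 * (n + 1)) ^ 6 := by
  obtain ⟨-, h2, -, h3⟩ := clog_bounds n
  generalize 2 ^ Nat.clog 2 n = N at h2
  have h4 : 0 < (n + 1) ^ 3 := by positivity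
  have h5 : (n + 1) ^ 3 ≤ (n + 1) ^ 6 := Nat.pow_le_pow_right (by omega) (by omega)
  have h6 : Nat.clog 2 n + 2 ≤ 2 * (n + 1) := by omega
  have h7 : N ^ 2 ≤ (2 * (n + 1)) ^ 2 := Nat.pow_le_pow_left (by omega) 2
  calc (Nat.clog 2 n + 2) * (30 * N ^ 2) ≤ (2 * (n + 1)) * (30 * (2 * (n + 1)) ^ 2) := by gcongr
    _ = 240 * (n + 1) ^ 3 := by ring
    _ < 4096 * (n + 1) ^ 6 := by linarith
    _ = (4 * (n + 1)) ^ 6 := by rw [mul_pow]; norm_num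

theorem word_bounds (n k : ℕ) : (4 * (n + 1)) ^ 6 ≤ (n + k + 2) ^ 18 ∧
    k ≤ (n + k + 2) ^ 18 ∧
    (Nat.clog 2 n + 2) * (30 * (2 ^ Nat.clog 2 n) ^ 2) < (n + k + 2) ^ 18 := by
  refine ⟨base_pow_le n k, ?_, (queue_bound_lt n).trans_le (base_pow_le n k)⟩
  calc k ≤ n + k + 2 := by omega
    _ ≤ (n + k + 2) ^ 18 := Nat.le_self_pow (by omega) _

theorem runs_solveP (n k : ℕ) (hk : k ≠ 0) (p : Fin n → ℝ × ℝ) (w : Fin n → ℝ) :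
    Runs ((n + k + 2) ^ 18) solveP (input n k p w)
      (solveTime n (2 ^ Nat.clog 2 n) (Nat.clog 2 n)) (CorrectOutput k p w) := by
  obtain ⟨hb1, hb2, hb3⟩ := word_bounds n k
  obtain ⟨hc1, hc2, -, -⟩ := clog_bounds n
  have hN : 1 ≤ 2 ^ Nat.clog 2 n := Nat.one_le_two_pow
  obtain ⟨i0, i1, i2⟩ := input_word n k p w
  set B := (n + k + 2) ^ 18
  have hM : 4 * (n + 1) ≤ B := (Nat.le_self_pow (by omega) _).trans hb1
  obtain ⟨e, he, hmono⟩ := exists_sort ((input n k p w).real 1) n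
  refine (runs_sortP (by omega) (by omega) i0 rfl rfl rfl).seq ?_
  intro s₁ f₁ hs₁
  refine (runs_sizeP hM (by rw [f₁.word 0 (by decide), i0])).seq ?_
  rintro s₂ f₂ ⟨e2, e7⟩
  -- The grid is read off from the sorted arrays in memory, including the irrelevant cells from `n`
  -- on.
  let D : Grid := ⟨n, k, 2 ^ Nat.clog 2 n, s₂.real 4, s₂.real 6⟩
  have hfits : D.Fits B := ⟨hb1, hb2, by show 2 ^ Nat.clog 2 n < 4 * (n + 1); omega⟩
  have hbase : D.Base B s₂ :=
    { fits := hfits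
      n := by rw [f₂.word 0 (by decide), f₁.word 0 (by decide), i0]
      k := by rw [f₂.word 0 (by decide), f₁.word 0 (by decide), i1]
      N := e2
      M := e7
      X := rfl
      W := rfl }
  refine hbase.runs_fillP.seq ?_
  intro s₃ f₃ hE₃
  have g₃ : ∀ a, a ∉ sortP.wordMods → a ∉ sizeP.wordMods → a ∉ Grid.fillP.wordMods →
      s₃.word a = (input n k p w).word a :=
    fun a h1 h2 h3 => by rw [f₃.word a h3, f₂.word a h2, f₁.word a h1]
  have hE : 30 * D.N ^ 2 ≤ (Nat.clog 2 n + 2) * (30 * D.N ^ 2) :=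
    Nat.le_mul_of_pos_left _ (by omega)
  have hb3' : (Nat.clog 2 n + 2) * (30 * D.N ^ 2) < B := hb3
  refine (Grid.runs_rootP hfits hE₃ hN (by omega)
    (fun κ => by rw [g₃ 12 (by decide) (by decide) (by decide), i2 12 (by decide)])
    (by rw [g₃ 13 (by decide) (by decide) (by decide), i2 13 (by decide)])).seq ?_
  rintro s₄ f₄ ⟨e16, hq₄⟩
  have hE₄ := hE₃.frame f₄ (by decide) (by decide)
  refine (Grid.runs_descendP hfits hE₄ rfl e16 (by rw [f₄.word 14 (by decide),
    g₃ 14 (by decide) (by decide) (by decide), i2 14 (by decide)]) hq₄ hb3').seq ?_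
  rintro s₅ f₅ ⟨e16', lo, hlo, e14, hq₅⟩
  have hE₅ := hE₄.frame f₅ (by decide) (by decide)
  have hlo' : lo + 30 * D.N ^ 2 < B := by
    rw [Nat.add_mul] at hb3'
    omega
  refine (Grid.runs_scanP (Y := s₂.real 5) hfits hE₅ hc1 e16' e14 hq₅ hlo' ?_ ?_).mono le_rfl ?_
  · rw [f₅.real 5 (by decide), f₄.real 5 (by decide), f₃.real 5 (by decide)]
  · rw [f₅.word 1 (by decide), f₄.word 1 (by decide),
      g₃ 1 (by decide) (by decide) (by decide), i2 1 (by decide)]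
  · intro s₆ _ hbest
    have hx : ∀ q : Fin n, s₂.real 4 (e q) = (p q).1 ∧ s₂.real 5 (e q) = (p q).2 ∧
        s₂.real 6 (e q) = w q := by
      intro q
      obtain ⟨h1, h2, h3⟩ := hs₁ q q.2
      obtain ⟨k1, k2, k3⟩ := input_real k p w q
      rw [he, f₂.real 4 (by decide), f₂.real 5 (by decide), f₂.real 6 (by decide), h1, h2, h3,
        k1, k2, k3]
      exact ⟨rfl, rfl, rfl⟩
    have hsorted : D.Sorted (s₂.real 5) p w e :=
      { x := fun q => (hx q).1
        y := fun q => (hx q).2.1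
        w := fun q => (hx q).2.2
        mono := by
          intro r r' hr hr'
          have hr₁ : r < n := lt_of_le_of_lt hr hr'
          have h1 := (hx (e.symm ⟨r, hr₁⟩)).2.1
          have h2 := (hx (e.symm ⟨r', hr'⟩)).2.1
          have h3 := hmono (e.symm ⟨r, hr₁⟩) (e.symm ⟨r', hr'⟩) (by simpa using hr)
          rw [(input_real k p w _).2.1, (input_real k p w _).2.1, ← h1, ← h2] at h3
          simpa using h3 }
    exact hsorted.correctOutput hk hbest

/-- Find a rectangle without points. -/
def emptyP : Program :=
  .seq (assign 3 (.const 0)) <|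
  .seq (.while (.wordLt (var 3) (.get 0 (.const 0)))
    (.seq (.ite (.realLt (.get 0 (var 3)) (.get 3 (.const 0))) .skip
      (.setReal 3 (.const 0) (.add (.get 0 (var 3)) (.const 1)))) (incr 3))) <|
  .seq (.setReal 3 (.const 2) (.get 3 (.const 0))) (assign 1 (.const 1))

/-- A single location with abscissa larger than all of the input encloses nothing, and all
rectangles without points have weight zero. The ordinates of the corners keep their initial value
zero. -/
theorem runs_emptyP {B n : ℕ} (hB : 4 ≤ B) (hn : n < B) (p : Fin n → ℝ × ℝ) (w : Fin n → ℝ) :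
    Runs B emptyP (input n 0 p w) (3 + ((n * (6 + 40) + 6) + 20)) (CorrectOutput 0 p w) := by
  obtain ⟨i0, -, -⟩ := input_word n 0 p w
  have hinit : Runs B (assign 3 (.const 0)) (input n 0 p w) 3 fun st' => st'.word 3 0 = 0 := by
    refine (Runs.of_wp ?_).mono (by decide) fun _ _ h => h
    simp [Program.wp, WExpr.Ok, WExpr.eval]
  refine hinit.seq ?_
  intro s₁ f₁ e3
  refine (Runs.while n 40 (I := fun t st' => st'.word 3 0 = t ∧ st'.real 3 1 = 0 ∧
    st'.real 3 3 = 0 ∧ ∀ q < t, st'.real 0 q < st'.real 3 0)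
    ⟨e3, ?_, ?_, by omega⟩ ?_ ?_).seq ?_
  · rw [f₁.real 3 (by decide)]; simp [input]
  · rw [f₁.real 3 (by decide)]; simp [input]
  · rintro t ht s₂ f₂ ⟨e3, e31, e33, hI⟩
    have g0 : s₂.word 0 0 = n := by rw [f₂.word 0 (by decide), f₁.word 0 (by decide), i0]
    have t1 : t ≤ B := by omega
    have t2 : t < B := by omega
    have t3 : n ≤ B := by omega
    have t4 : 1 ≤ B := by omega
    refine ⟨by simp [Test.Ok, WExpr.Ok, WExpr.eval, e3, g0, t1, t3],
      by simpa [Test.Holds, WExpr.eval, e3, g0], (Runs.of_wp ?_).mono (by decide) fun _ _ h => h⟩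
    refine ⟨by simp [Test.Ok, RExpr.Ok, WExpr.Ok, WExpr.eval, e3, t1], fun hh => ?_, fun hh => ?_⟩
    · simp [Test.Holds, RExpr.eval, WExpr.eval, e3] at hh
      simp [Program.wp, WExpr.Ok, WExpr.eval, e3, t1, t2, t4, e31, e33]
      intro q hq
      rcases hq.lt_or_eq with hq | rfl
      · exact hI q hq
      · exact hh
    · simp [Test.Holds, RExpr.eval, WExpr.eval, e3] at hh
      simp [Program.wp, WExpr.Ok, RExpr.Ok, WExpr.eval, RExpr.eval, e3, t1, t2, t4, e31, e33]
      intro q hq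
      rcases hq.lt_or_eq with hq | rfl
      · have := hI q hq
        linarith
      · linarith
  · rintro s₂ f₂ ⟨e3, -⟩
    have g0 : s₂.word 0 0 = n := by rw [f₂.word 0 (by decide), f₁.word 0 (by decide), i0]
    simp [Test.Ok, Test.Holds, WExpr.Ok, WExpr.eval, e3, g0]
    omega
  · rintro s₂ f₂ ⟨-, e31, e33, hI⟩
    have t1 : 1 ≤ B := by omega
    have t2 : 2 ≤ B := by omega
    refine (Runs.of_wp ?_).mono (by decide) fun _ _ h => h
    simp [Program.wp, WExpr.Ok, RExpr.Ok, WExpr.eval, RExpr.eval, t1, t2]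
    have hx : ∀ q : Fin n, (p q).1 < s₂.real 3 0 := by
      intro q
      have h1 := hI q q.2
      rwa [f₂.real 0 (by decide), f₁.real 0 (by decide), (input_real 0 p w q).1] at h1
    have hempty : enclosed p (s₂.real 3 0, 0) (s₂.real 3 0, 0) = ∅ := by
      classical
      refine Finset.filter_eq_empty_iff.2 fun q _ hq => ?_
      have := hq.1.1
      have := hx q
      dsimp only at *
      linarith
    refine .inl ⟨by simp, ?_⟩
    simp only [State.real_setWord, State.real_setReal, if_true]
    simp only [Function.update_apply, e31, e33]
    norm_num
    refine ⟨⟨le_rfl, by rw [hempty]; rfl⟩, fun lo hi h => ?_⟩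
    rw [weight, weight, hempty, Finset.card_eq_zero.1 h.2]

/-- Find a best rectangle. -/
def mainP : Program := .ite (.wordEq (.get 0 (.const 1)) (.const 0)) emptyP solveP

theorem runs_mainP (n k : ℕ) (p : Fin n → ℝ × ℝ) (w : Fin n → ℝ) :
    Runs ((n + k + 2) ^ 18) mainP (input n k p w)
      (5 + ((3 + ((n * (6 + 40) + 6) + 20)) + solveTime n (2 ^ Nat.clog 2 n) (Nat.clog 2 n)))
      (CorrectOutput k p w) := by
  obtain ⟨hb1, hb2, -⟩ := word_bounds n k
  obtain ⟨-, i1, -⟩ := input_word n k p w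
  have hM : 4 * (n + 1) ≤ (n + k + 2) ^ 18 := (Nat.le_self_pow (by omega) _).trans hb1
  refine Runs.ite ?_ (fun h => ?_) fun h => ?_
  · simp only [Test.Ok, WExpr.Ok, WExpr.eval, i1]
    omega
  · simp only [Test.Holds, WExpr.eval, i1] at h
    subst h
    exact (runs_emptyP (by omega) (by omega) p w).mono (by omega) fun _ _ h => h
  · simp only [Test.Holds, WExpr.eval, i1] at h
    exact (runs_solveP n k h p w).mono (by omega) fun _ _ h => h

theorem exists_time_bound : ∃ K : ℕ, ∀ n, 2 ≤ n →
    5 + ((3 + ((n * (6 + 40) + 6) + 20)) + solveTime n (2 ^ Nat.clog 2 n) (Nat.clog 2 n)) ≤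
      K * (n ^ 2 * Nat.clog 2 n) := by
  unfold solveTime
  generalize Grid.stepP.maxCost = b
  generalize (Program.seq Grid.pairP (incr 4)).maxCost = c
  generalize Grid.expandP.maxCost = a
  generalize (Program.seq Grid.loadP (.seq Grid.recordP (incr 14))).maxCost = d
  -- From `N ≤ 2 n`: the tables have `2 n N ≤ 4 n²` steps, the root has `n²`, and a level or the
  -- scan has `30 N² ≤ 120 n²`. The `1000` absorbs sorting and lower-order terms.
  refine ⟨1000 + 4 * (6 + b) + (6 + c) + 120 * (6 + a) + 120 * (6 + d), fun n hn => ?_⟩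
  obtain ⟨-, -, h2, -⟩ := clog_bounds n
  replace h2 := h2 (by omega)
  have hL : 1 ≤ Nat.clog 2 n := Nat.clog_pos (by omega) hn
  generalize 2 ^ Nat.clog 2 n = N at h2
  generalize Nat.clog 2 n = L at hL
  have q1 : n ^ 2 ≤ n ^ 2 * L := Nat.le_mul_of_pos_right _ hL
  have q2 : L ≤ n ^ 2 * L := Nat.le_mul_of_pos_left _ (by positivity)
  have q3 : n ≤ n ^ 2 := Nat.le_self_pow (by omega) n
  have q4 : n * N ≤ 2 * n ^ 2 := by nlinarith
  have q5 : N ^ 2 ≤ 4 * n ^ 2 := by nlinarith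
  have q6 : L * N ^ 2 ≤ 4 * (n ^ 2 * L) := by nlinarith
  have r1 : (n * N) * (6 + b) ≤ (2 * (n ^ 2 * L)) * (6 + b) := Nat.mul_le_mul_right _ (by omega)
  have r2 : n ^ 2 * (6 + c) ≤ (n ^ 2 * L) * (6 + c) := Nat.mul_le_mul_right _ (by omega)
  have r3 : (L * N ^ 2) * (6 + a) ≤ (4 * (n ^ 2 * L)) * (6 + a) := Nat.mul_le_mul_right _ q6
  have r4 : N ^ 2 * (6 + d) ≤ (4 * (n ^ 2 * L)) * (6 + d) := Nat.mul_le_mul_right _ (by omega)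
  have r5 : 1 ≤ n ^ 2 * L := by omega
  generalize n ^ 2 * L = q at *
  linarith

/-- With `clog = r + 1` and `2 ^ r < n`, the bound `log 2 > 1/2` gives `r ≤ 2 log n`, and also `1 ≤
2 log n` because `n ≥ 2`. -/
theorem clog_le_log {n : ℕ} (hn : 2 ≤ n) : (Nat.clog 2 n : ℝ) ≤ 4 * Real.log n := by
  have hL : 1 ≤ Nat.clog 2 n := Nat.clog_pos (by omega) hn
  obtain ⟨r, hr⟩ : ∃ r, Nat.clog 2 n = r + 1 := ⟨Nat.clog 2 n - 1, by omega⟩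
  have h1 : 2 ^ r < n := (Nat.lt_clog_iff_pow_lt (by omega)).1 (by omega)
  have h2 : (2 : ℝ) ^ r ≤ n := by exact_mod_cast h1.le
  have h3 := Real.log_le_log (by positivity) h2
  rw [Real.log_pow] at h3
  have h4 : Real.log 2 ≤ Real.log n := Real.log_le_log (by norm_num) (by exact_mod_cast hn)
  have h5 : (1 : ℝ) / 2 < Real.log 2 := by
    have := Real.log_two_gt_d9
    linarith
  have h6 : (0 : ℝ) ≤ r := Nat.cast_nonneg r
  rw [hr]
  push_cast
  nlinarith

end MinWeightRect

theorem mainTheorem7 :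
    ∃ (P : RealRAM.Program) (d : ℕ) (C : ℝ),
      ∀ (n k : ℕ) (p : Fin n → ℝ × ℝ) (w : Fin n → ℝ), Function.Injective p →
        ∃ (t : ℕ) (s : RealRAM.State),
          RealRAM.Exec ((n + k + 2) ^ d) P (MinWeightRect.input n k p w) t s ∧
            MinWeightRect.CorrectOutput k p w s ∧
            (2 ≤ n → (t : ℝ) ≤ C * ((n : ℝ) ^ 2 * Real.log n)) := by
  obtain ⟨K, hK⟩ := MinWeightRect.exists_time_bound
  refine ⟨MinWeightRect.mainP, 18, K * 4, fun n k p w _ => ?_⟩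
  obtain ⟨t, s, he, ht, hs⟩ := MinWeightRect.runs_mainP n k p w
  refine ⟨t, s, he, hs, fun hn => ?_⟩
  have h1 : (t : ℝ) ≤ K * ((n : ℝ) ^ 2 * Nat.clog 2 n) := by
    exact_mod_cast ht.trans (hK n hn)
  have h2 := MinWeightRect.clog_le_log hn
  calc (t : ℝ) ≤ K * ((n : ℝ) ^ 2 * Nat.clog 2 n) := h1
    _ ≤ K * ((n : ℝ) ^ 2 * (4 * Real.log n)) := by gcongr
    _ = K * 4 * ((n : ℝ) ^ 2 * Real.log n) := by ring
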